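/- Let $\mathbb{K}$ be a commutative ring, let $R$ and $S$ be differential graded algebras (DGAs) over $\mathbb{K}$, that is, unital associative $\mathbb{Z}$-graded $\mathbb{K}$-algebras with a $\mathbb{K}$-linear differential $\partial$ of degree $-1$, $\partial^2=0$, satisfying the Leibniz rule $\partial(rs)=\partial(r)s+(-1)^{|r|}r\,\partial(s)$, and let $\varphi\colon R\to S$ be a morphism of DGAs. Every left or right DG $S$-module is regarded as a DG $R$-module via $\varphi$. Write $\mathcal{D}(R)$ for the derived category of left DG $R$-modules, obtained from the homotopy category of left DG $R$-modules by formally inverting the quasi-isomorphisms (similarly $\mathcal{D}(S)$), and $\mathcal{D}(\mathbb{K})$ for the derived category of complexes of $\mathbb{K}$-modules. The derived functors $\otimes^{\mathbf L}$ and $\mathrm{RHom}$ are computed by K-projective or K-injective resolutions. Then the following conditions are equivalent. 1. The canonical morphism $S\otimes^{\mathbf L}_R S\to S$ is an isomorphism. 2. For every left DG $S$-module $M$ the canonical morphism $S\otimes^{\mathbf L}_R M\to M$ is an isomorphism in $\mathcal{D}(S)$. 3. For every right DG $S$-module $M$ and every left DG $S$-module $N$ the canonical morphism $M\otimes^{\mathbf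 L}_R N\to M\otimes^{\mathbf L}_S N$ is an isomorphism in $\mathcal{D}(\mathbb{K})$. 4. For every left DG $S$-module $M$ the canonical morphism $M\to \mathrm{RHom}_R(S,M)$ is an isomorphism in $\mathcal{D}(S)$. 5. For all left DG $S$-modules $M,M'$ the canonical morphism $\mathrm{RHom}_S(M,M')\to \mathrm{RHom}_R(M,M')$ is an isomorphism in $\mathcal{D}(\mathbb{K})$. 6. The functor $\mathcal{D}(\varphi)\colon\mathcal{D}(S)\to\mathcal{D}(R)$ induced by restriction of scalars is a full embedding, that is, it is fully faithful. Here, if $P\to M$ is a K-projective resolution over $R$, the canonical morphism in (2) is the image of $S\otimes_R P\to M$, $s\otimes p\mapsto s\,\pi(p)$, where $\pi\colon P\to M$ is the resolution, and (1) is read in the same way with $M=S$; if $\iota\colon M\to I$ is a K-injective resolution over $R$, the one in (4) is the image of $M\to\mathrm{Hom}_R(S,I)$, $m\mapsto\bigl(s\mapsto(-1)^{|m||s|}\iota(sm)\bigr)$; and those in (3) and (5) are induced by the comparison $P_R\to P_S$, which is unique up to homotopy, from a K-projective resolution over $R$ to one over $S$ of $N$, respectively of $M$. A morphism $\varphi$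 satisfying these equivalent conditions is called a homological epimorphism of DGAs. -/

import Mathlib

open CategoryTheory
open scoped TensorProduct DirectSum

universe u

noncomputable section

/-! ## Differential graded algebras and modules

Gradings are indexed by `ℤ` and differentials have degree `-1`.  A product of elements of degrees
`i` and `j` is recorded as an element of degree `k` for every `k` with a proof of `i + j = k`. -/

/-- A differential graded algebra over the commutative ring `K`: a complex of `K`-modules
`… → R₁ → R₀ → R₋₁ → …` with a unital associative multiplication satisfying the Leibniz rule. -/
structure DGAlgebra (K : Type u) [CommRing K] where
  /-- the underlying complex -/
  cx : ChainComplex (ModuleCat.{u} K) ℤ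
  /-- the unit -/
  one : cx.X 0
  /-- the multiplication `Rᵢ × Rⱼ → Rᵢ₊ⱼ` -/
  mul (i j k : ℤ) (h : i + j = k) : cx.X i →ₗ[K] cx.X j →ₗ[K] cx.X k
  one_mul (i : ℤ) (x : cx.X i) : mul 0 i i (zero_add i) one x = x
  mul_one (i : ℤ) (x : cx.X i) : mul i 0 i (add_zero i) x one = x
  mul_assoc (i j k ij jk n : ℤ) (h₁ : i + j = ij) (h₂ : j + k = jk) (h₃ : ij + k = n)
    (h₄ : i + jk = n) (x : cx.X i) (y : cx.X j) (z : cx.X k) :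
    mul ij k n h₃ (mul i j ij h₁ x y) z = mul i jk n h₄ x (mul j k jk h₂ y z)
  leibniz (i j k i' j' k' : ℤ) (hi : i' + 1 = i) (hj : j' + 1 = j) (hk : k' + 1 = k)
    (h : i + j = k) (x : cx.X i) (y : cx.X j) :
    cx.d k k' (mul i j k h x y) =
      mul i' j k' (by omega) (cx.d i i' x) y +
        i.negOnePow • mul i j' k' (by omega) x (cx.d j j' y)

variable {K : Type u} [CommRing K]

/-- A morphism of DGAs: a morphism of complexes of degree zero which respects products and units. -/
structure DGAlgebra.Hom (R S : DGAlgebra K) where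
  /-- the underlying morphism of complexes -/
  hom : R.cx ⟶ S.cx
  map_one : hom.f 0 R.one = S.one
  map_mul (i j k : ℤ) (h : i + j = k) (x : R.cx.X i) (y : R.cx.X j) :
    hom.f k (R.mul i j k h x y) = S.mul i j k h (hom.f i x) (hom.f j y)

/-- A DG left `R`-module. -/
structure DGModule (R : DGAlgebra K) where
  /-- the underlying complex -/
  cx : ChainComplex (ModuleCat.{u} K) ℤ
  /-- the action `Rᵢ × Mⱼ → Mᵢ₊ⱼ` -/
  smul (i j k : ℤ) (h : i + j = k) : R.cx.X i →ₗ[K] cx.X j →ₗ[K] cx.X k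
  one_smul (i : ℤ) (x : cx.X i) : smul 0 i i (zero_add i) R.one x = x
  mul_smul (i j k ij jk n : ℤ) (h₁ : i + j = ij) (h₂ : j + k = jk) (h₃ : ij + k = n)
    (h₄ : i + jk = n) (r : R.cx.X i) (s : R.cx.X j) (x : cx.X k) :
    smul ij k n h₃ (R.mul i j ij h₁ r s) x = smul i jk n h₄ r (smul j k jk h₂ s x)
  leibniz (i j k i' j' k' : ℤ) (hi : i' + 1 = i) (hj : j' + 1 = j) (hk : k' + 1 = k)
    (h : i + j = k) (r : R.cx.X i) (x : cx.X j) :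
    cx.d k k' (smul i j k h r x) =
      smul i' j k' (by omega) (R.cx.d i i' r) x +
        i.negOnePow • smul i j' k' (by omega) r (cx.d j j' x)

/-- A DG right `R`-module, that is, a DG `Rᵒᵖ`-module. -/
structure DGRightModule (R : DGAlgebra K) where
  /-- the underlying complex -/
  cx : ChainComplex (ModuleCat.{u} K) ℤ
  /-- the action `Mᵢ × Rⱼ → Mᵢ₊ⱼ` -/
  smul (i j k : ℤ) (h : i + j = k) : cx.X i →ₗ[K] R.cx.X j →ₗ[K] cx.X k
  smul_one (i : ℤ) (x : cx.X i) : smul i 0 i (add_zero i) x R.one = x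
  smul_mul (i j k ij jk n : ℤ) (h₁ : i + j = ij) (h₂ : j + k = jk) (h₃ : ij + k = n)
    (h₄ : i + jk = n) (x : cx.X i) (r : R.cx.X j) (s : R.cx.X k) :
    smul ij k n h₃ (smul i j ij h₁ x r) s = smul i jk n h₄ x (R.mul j k jk h₂ r s)
  leibniz (i j k i' j' k' : ℤ) (hi : i' + 1 = i) (hj : j' + 1 = j) (hk : k' + 1 = k)
    (h : i + j = k) (x : cx.X i) (r : R.cx.X j) :
    cx.d k k' (smul i j k h x r) =
      smul i' j k' (by omega) (cx.d i i' x) r +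
        i.negOnePow • smul i j' k' (by omega) x (R.cx.d j j' r)

/-- `R` as a DG left module over itself. -/
abbrev DGAlgebra.leftSelf (R : DGAlgebra K) : DGModule R where
  cx := R.cx
  smul := R.mul
  one_smul := R.one_mul
  mul_smul := R.mul_assoc
  leibniz := R.leibniz

/-- `R` as a DG right module over itself. -/
abbrev DGAlgebra.rightSelf (R : DGAlgebra K) : DGRightModule R where
  cx := R.cx
  smul := R.mul
  smul_one := R.mul_one
  smul_mul := R.mul_assoc
  leibniz := R.leibniz

namespace DGModule

variable {R S : DGAlgebra K}

/-- A morphism of DG modules: an `R`-linear morphism of complexes of degree zero. -/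
@[ext]
structure Hom (M N : DGModule R) where
  /-- the underlying morphism of complexes -/
  hom : M.cx ⟶ N.cx
  map_smul (i j k : ℤ) (h : i + j = k) (r : R.cx.X i) (x : M.cx.X j) :
    hom.f k (M.smul i j k h r x) = N.smul i j k h r (hom.f j x)

/-- The category of DG left `R`-modules. -/
instance : Category (DGModule R) where
  Hom M N := Hom M N
  id M := { hom := 𝟙 M.cx, map_smul := by intros; simp }
  comp f g :=
    { hom := f.hom ≫ g.hom
      map_smul := by intros; simp [f.map_smul, g.map_smul] }

@[simp] lemma id_hom (M : DGModule R) : Hom.hom (𝟙 M) = 𝟙 M.cx := rfl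

@[simp] lemma comp_hom {M N P : DGModule R} (f : M ⟶ N) (g : N ⟶ P) :
    Hom.hom (f ≫ g) = Hom.hom f ≫ Hom.hom g := rfl

@[ext] lemma hom_ext {M N : DGModule R} (f g : M ⟶ N) (h : Hom.hom f = Hom.hom g) : f = g :=
  Hom.ext h

/-! ## The homotopy category and the derived category -/

/-- Two morphisms are homotopic if `f - g = ∂h + h∂` for some homomorphism `h : M → N` of graded
modules of degree `1`; such a homomorphism satisfies `h (r x) = (-1)^|r| r (h x)`. -/
def Homotopic {M N : DGModule R} (f g : M ⟶ N) : Prop :=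
  ∃ h : ∀ i j : ℤ, i + 1 = j → (M.cx.X i →ₗ[K] N.cx.X j),
    (∀ (i j k k' j' : ℤ) (hk : i + j = k) (hj' : j + 1 = j') (hk' : k + 1 = k')
      (r : R.cx.X i) (x : M.cx.X j),
      h k k' hk' (M.smul i j k hk r x) =
        i.negOnePow • N.smul i j' k' (by omega) r (h j j' hj' x)) ∧
    ∀ (i i' j : ℤ) (hi : i' + 1 = i) (hj : i + 1 = j) (x : M.cx.X i),
      f.hom.f i x - g.hom.f i x = N.cx.d j i (h i j hj x) + h i' i hi (M.cx.d i i' x)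

/-- A quasi-isomorphism of DG modules. -/
def IsQuasiIso {M N : DGModule R} (f : M ⟶ N) : Prop := QuasiIso (Hom.hom f)

variable (R) in
/-- Homotopy, as a relation on the morphisms of the category of DG modules. -/
def homotopyRel : HomRel (DGModule R) := fun _ _ f g => Homotopic f g

variable (R) in
/-- The homotopy category `𝒦(R)`. -/
abbrev HoCat : Type _ := CategoryTheory.Quotient (homotopyRel R)

variable (R) in
/-- The functor from DG modules to the homotopy category. -/
abbrev toHo : DGModule R ⥤ HoCat R := CategoryTheory.Quotient.functor (homotopyRel R)

variable (R) in
/-- The quasi-isomorphisms in the homotopy category. -/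
def hoQuasiIso : MorphismProperty (HoCat R) := fun M N f =>
  ∃ g : M.as ⟶ N.as, IsQuasiIso g ∧ (toHo R).map g = f

variable (R) in
/-- The derived category `𝒟(R)`. -/
abbrev DerCat : Type _ := (hoQuasiIso R).Localization

variable (R) in
/-- The functor from DG modules to the derived category. -/
abbrev toDer : DGModule R ⥤ DerCat R := toHo R ⋙ (hoQuasiIso R).Q

/-! ## Restriction of scalars -/

/-- Restriction of scalars of a DG module along a morphism of DGAs. -/
abbrev restrict (φ : R.Hom S) (M : DGModule S) : DGModule R where
  cx := M.cx
  smul i j k h := (M.smul i j k h).comp (φ.hom.f i).hom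
  one_smul i x := by simpa [φ.map_one] using M.one_smul i x
  mul_smul i j k ij jk n h₁ h₂ h₃ h₄ r s x := by
    simpa [φ.map_mul] using M.mul_smul i j k ij jk n h₁ h₂ h₃ h₄ (φ.hom.f i r) (φ.hom.f j s) x
  leibniz i j k i' j' k' hi hj hk h r x := by
    have hc : φ.hom.f i' (R.cx.d i i' r) = S.cx.d i i' (φ.hom.f i r) := by
      rw [← ModuleCat.comp_apply, ← ModuleCat.comp_apply, φ.hom.comm]
    simpa [hc] using M.leibniz i j k i' j' k' hi hj hk h (φ.hom.f i r) x

/-- Restriction of scalars as a functor on DG modules. -/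
abbrev restrictFunctor (φ : R.Hom S) : DGModule S ⥤ DGModule R where
  obj M := restrict φ M
  map {M N} f :=
    { hom := Hom.hom (M := M) (N := N) f
      map_smul := fun i j k h _ _ => Hom.map_smul (M := M) (N := N) f i j k h _ _ }

lemma restrict_homotopic (φ : R.Hom S) {M N : DGModule S} {f g : M ⟶ N} (h : Homotopic f g) :
    Homotopic ((restrictFunctor φ).map f) ((restrictFunctor φ).map g) := by
  obtain ⟨h, h₁, h₂⟩ := h
  refine ⟨fun i j hij => h i j hij, fun i j k k' j' hk hj' hk' r x => ?_, h₂⟩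
  exact h₁ i j k k' j' hk hj' hk' (φ.hom.f i r) x

/-- The functor `𝒦(S) → 𝒦(R)` induced by restriction of scalars. -/
def restrictHo (φ : R.Hom S) : HoCat S ⥤ HoCat R :=
  CategoryTheory.Quotient.lift _ (restrictFunctor φ ⋙ toHo R)
    (fun _ _ _ _ h => CategoryTheory.Quotient.sound _ (restrict_homotopic φ h))

lemma restrictHo_inverts (φ : R.Hom S) :
    (hoQuasiIso S).IsInvertedBy (restrictHo φ ⋙ (hoQuasiIso R).Q) := by
  rintro M N _ ⟨g, hg, rfl⟩
  exact (hoQuasiIso R).Q_inverts _ ⟨(restrictFunctor φ).map g, (hg : QuasiIso (Hom.hom g)), rfl⟩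

/-- The functor `𝒟(φ) : 𝒟(S) → 𝒟(R)` induced by restriction of scalars. -/
def restrictDer (φ : R.Hom S) : DerCat S ⥤ DerCat R :=
  Localization.Construction.lift (restrictHo φ ⋙ (hoQuasiIso R).Q) (restrictHo_inverts φ)

end DGModule

/-- Restriction of scalars of a DG right module along a morphism of DGAs. -/
abbrev DGRightModule.restrict {R S : DGAlgebra K} (φ : R.Hom S) (M : DGRightModule S) :
    DGRightModule R where
  cx := M.cx
  smul i j k h := (M.smul i j k h).compl₂ (φ.hom.f j).hom
  smul_one i x := by simpa [φ.map_one] using M.smul_one i x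
  smul_mul i j k ij jk n h₁ h₂ h₃ h₄ x r s := by
    simpa [φ.map_mul] using M.smul_mul i j k ij jk n h₁ h₂ h₃ h₄ x (φ.hom.f j r) (φ.hom.f k s)
  leibniz i j k i' j' k' hi hj hk h x r := by
    have hc : φ.hom.f j' (R.cx.d j j' r) = S.cx.d j j' (φ.hom.f j r) := by
      rw [← ModuleCat.comp_apply, ← ModuleCat.comp_apply, φ.hom.comm]
    simpa [hc] using M.leibniz i j k i' j' k' hi hj hk h x (φ.hom.f j r)

namespace DGModule

variable {R S : DGAlgebra K}

/-! ## The complex `Hom_R(M, N)` -/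

/-- The `K`-module of homomorphisms of graded `R`-modules `M → N` of degree `n`: families of
`K`-linear maps `Mₚ → N_q` for `p + n = q` such that `f (r x) = (-1)^(n|r|) r (f x)`. -/
def homSubmodule (M N : DGModule R) (n : ℤ) :
    Submodule K (∀ t : {t : ℤ × ℤ // t.1 + n = t.2}, M.cx.X t.1.1 →ₗ[K] N.cx.X t.1.2) where
  carrier := {f | ∀ (i p p' q q' : ℤ) (hp : i + p = p') (hq : p + n = q) (hq' : p' + n = q')
    (r : R.cx.X i) (x : M.cx.X p),
    f ⟨(p', q'), hq'⟩ (M.smul i p p' hp r x) =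
      (n * i).negOnePow • N.smul i q q' (by omega) r (f ⟨(p, q), hq⟩ x)}
  zero_mem' := by intros i p p' q q' hp hq hq' r x; simp
  add_mem' := by
    intro f g hf hg i p p' q q' hp hq hq' r x
    simp [hf i p p' q q' hp hq hq' r x, hg i p p' q q' hp hq hq' r x]
  smul_mem' := by
    intro c f hf i p p' q q' hp hq hq' r x
    simp [hf i p p' q q' hp hq hq' r x, smul_comm c]

/-- The homomorphisms of graded `R`-modules `M → N` of degree `n`. -/
def HomDeg (M N : DGModule R) (n : ℤ) : Type u := homSubmodule M N n

instance (M N : DGModule R) (n : ℤ) : AddCommGroup (HomDeg M N n) :=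
  inferInstanceAs (AddCommGroup (homSubmodule M N n))

instance (M N : DGModule R) (n : ℤ) : Module K (HomDeg M N n) :=
  inferInstanceAs (Module K (homSubmodule M N n))

/-- The component `Mₚ → N_q` of a homomorphism of degree `n`, where `p + n = q`. -/
def HomDeg.app {M N : DGModule R} {n : ℤ} (f : HomDeg M N n) (p q : ℤ) (h : p + n = q) :
    M.cx.X p →ₗ[K] N.cx.X q := f.1 ⟨(p, q), h⟩

/-- A homomorphism of degree `n` from its components. -/
def HomDeg.mk {M N : DGModule R} {n : ℤ}
    (f : ∀ p q : ℤ, p + n = q → (M.cx.X p →ₗ[K] N.cx.X q))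
    (hf : ∀ (i p p' q q' : ℤ) (hp : i + p = p') (hq : p + n = q) (hq' : p' + n = q')
      (r : R.cx.X i) (x : M.cx.X p),
      f p' q' hq' (M.smul i p p' hp r x) =
        (n * i).negOnePow • N.smul i q q' (by omega) r (f p q hq x)) : HomDeg M N n :=
  ⟨fun t => f t.1.1 t.1.2 t.2, hf⟩

section

variable {M N : DGModule R} {n : ℤ}

@[simp] lemma HomDeg.mk_app (f : ∀ p q : ℤ, p + n = q → (M.cx.X p →ₗ[K] N.cx.X q)) (hf)
    (p q : ℤ) (h : p + n = q) : (HomDeg.mk (M := M) (N := N) f hf).app p q h = f p q h := rfl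

@[simp] lemma HomDeg.add_app (f g : HomDeg M N n) (p q : ℤ) (h : p + n = q) :
    (f + g).app p q h = f.app p q h + g.app p q h := rfl

@[simp] lemma HomDeg.smul_app (c : K) (f : HomDeg M N n) (p q : ℤ) (h : p + n = q) :
    (c • f).app p q h = c • f.app p q h := rfl

@[simp] lemma HomDeg.zero_app (p q : ℤ) (h : p + n = q) :
    (0 : HomDeg M N n).app p q h = 0 := rfl

@[simp] lemma HomDeg.units_smul_app (c : ℤˣ) (f : HomDeg M N n) (p q : ℤ) (h : p + n = q) :
    (c • f).app p q h = c • f.app p q h := by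
  rcases Int.units_eq_one_or c with rfl | rfl
  · simp
  · rw [Units.neg_smul, Units.neg_smul]; simp; rfl

lemma HomDeg.app_smul (f : HomDeg M N n) (i p p' q q' : ℤ) (hp : i + p = p') (hq : p + n = q)
    (hq' : p' + n = q') (r : R.cx.X i) (x : M.cx.X p) :
    f.app p' q' hq' (M.smul i p p' hp r x) =
      (n * i).negOnePow • N.smul i q q' (by omega) r (f.app p q hq x) :=
  f.2 i p p' q q' hp hq hq' r x

lemma HomDeg.ext {f g : HomDeg M N n}
    (h : ∀ (p q : ℤ) (hq : p + n = q) (x : M.cx.X p), f.app p q hq x = g.app p q hq x) :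
    f = g :=
  Subtype.ext (funext fun t => LinearMap.ext fun x => h t.1.1 t.1.2 t.2 x)

end

/-- The differential `f ↦ ∂f - (-1)ⁿ f∂` on homomorphisms of degree `n`. -/
def homDiff (M N : DGModule R) (n n' : ℤ) (hn : n' + 1 = n) :
    HomDeg M N n →ₗ[K] HomDeg M N n' where
  toFun f := HomDeg.mk (fun p q hq =>
      (N.cx.d (q + 1) q).hom ∘ₗ f.app p (q + 1) (by omega) -
        n.negOnePow • (f.app (p - 1) q (by omega) ∘ₗ (M.cx.d p (p - 1)).hom)) (by
    intro i p p' q q' hp hq hq' r x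
    simp only [LinearMap.sub_apply, LinearMap.comp_apply, LinearMap.smul_apply]
    rw [f.app_smul i p p' (q + 1) (q' + 1) hp (by omega) (by omega),
      M.leibniz i p p' (i - 1) (p - 1) (p' - 1) (by omega) (by omega) (by omega),
      map_add, LinearMap.map_smul_of_tower, LinearMap.map_smul_of_tower,
      f.app_smul (i - 1) p (p' - 1) (q + 1) q' (by omega) (by omega) (by omega),
      f.app_smul i (p - 1) (p' - 1) q q' (by omega) (by omega) (by omega),
      N.leibniz i (q + 1) (q' + 1) (i - 1) q q' (by omega) (by omega) (by omega)]
    obtain rfl : n = n' + 1 := hn.symm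
    have e₁ : (n' + 1) * i = n' * i + i := by ring
    have e₂ : (n' + 1) * (i - 1) = n' * i + i - n' - 1 := by ring
    rw [e₁, e₂]
    simp only [Int.negOnePow_add, Int.negOnePow_sub, Int.negOnePow_one, map_sub,
      LinearMap.map_smul_of_tower]
    rcases Int.units_eq_one_or (n' * i).negOnePow with h | h <;>
    rcases Int.units_eq_one_or n'.negOnePow with h' | h' <;>
    rcases Int.units_eq_one_or i.negOnePow with h'' | h'' <;>
    simp [h, h', h''] <;> abel)
  map_add' f g := by
    refine HomDeg.ext fun p q hq x => ?_
    simp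
    abel
  map_smul' c f := by
    refine HomDeg.ext fun p q hq x => ?_
    simp [smul_sub, smul_comm c]

lemma homDiff_app (M N : DGModule R) (n n' : ℤ) (hn : n' + 1 = n) (f : HomDeg M N n)
    (p p' q q' : ℤ) (hp : p' + 1 = p) (hq : p + n = q) (hq' : p + n' = q') (x : M.cx.X p) :
    (homDiff M N n n' hn f).app p q' hq' x =
      N.cx.d q q' (f.app p q hq x) -
        n.negOnePow • f.app p' q' (by omega) (M.cx.d p p' x) := by
  obtain rfl : q = q' + 1 := by omega
  obtain rfl : p' = p - 1 := by omega
  rfl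

/-- The complex `Hom_R(M, N)`. -/
abbrev homCx (M N : DGModule R) : ChainComplex (ModuleCat.{u} K) ℤ where
  X n := ModuleCat.of K (HomDeg M N n)
  d n n' := if h : n' + 1 = n then ModuleCat.ofHom (homDiff M N n n' h) else 0
  shape n n' h := dif_neg h
  d_comp_d' n n' n'' h h' := by
    have h : n' + 1 = n := h
    have h' : n'' + 1 = n' := h'
    rw [dif_pos h, dif_pos h']
    ext f
    refine HomDeg.ext fun p q hq x => ?_
    change (homDiff M N n' n'' h' (homDiff M N n n' h f)).app p q hq x = 0
    have hM : M.cx.d (p - 1) (p - 1 - 1) (M.cx.d p (p - 1) x) = 0 := by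
      rw [← ModuleCat.comp_apply]; simp
    have hN : ∀ y, N.cx.d (q + 1) q (N.cx.d (q + 1 + 1) (q + 1) y) = 0 := by
      intro y; rw [← ModuleCat.comp_apply]; simp
    rw [homDiff_app M N n' n'' h' _ p (p - 1) (q + 1) q (by omega) (by omega),
      homDiff_app M N n n' h _ p (p - 1) (q + 1 + 1) (q + 1) (by omega) (by omega),
      homDiff_app M N n n' h _ (p - 1) (p - 1 - 1) (q + 1) q (by omega) (by omega), hM, map_sub, hN]
    obtain rfl : n = n' + 1 := h.symm
    rcases Int.units_eq_one_or n'.negOnePow with h | h <;>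
    simp [h, Int.negOnePow_add]

lemma homCx_d (M N : DGModule R) (n n' : ℤ) (hn : n' + 1 = n) :
    (homCx M N).d n n' = ModuleCat.ofHom (homDiff M N n n' hn) := dif_pos hn

/-- A morphism into a complex `Hom_R(M, N)` is given by its components. -/
def homCxLift {M N : DGModule R} {C : ChainComplex (ModuleCat.{u} K) ℤ}
    (f : ∀ n : ℤ, C.X n →ₗ[K] HomDeg M N n)
    (hf : ∀ (n n' : ℤ) (hn : n' + 1 = n) (c : C.X n),
      homDiff M N n n' hn (f n c) = f n' (C.d n n' c)) : C ⟶ homCx M N where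
  f n := ModuleCat.ofHom (f n)
  comm' n n' hn := by
    have hn : n' + 1 = n := hn
    rw [homCx_d M N n n' hn]
    ext c
    exact hf n n' hn c

lemma hom_comm {C D : ChainComplex (ModuleCat.{u} K) ℤ} (g : C ⟶ D) (n n' : ℤ) (c : C.X n) :
    g.f n' (C.d n n' c) = D.d n n' (g.f n c) := by
  rw [← ModuleCat.comp_apply, ← ModuleCat.comp_apply, g.comm]

/-- Postcomposition `Hom_R(M, N) → Hom_R(M, N')` with a morphism `N → N'`. -/
def homPost (M : DGModule R) {N N' : DGModule R} (g : N ⟶ N') : homCx M N ⟶ homCx M N' :=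
  homCxLift
    (fun n =>
      { toFun := fun (f : HomDeg M N n) =>
          HomDeg.mk (fun p q hq => (g.hom.f q).hom ∘ₗ f.app p q hq) (by
            intro i p p' q q' hp hq hq' r x
            simp only [LinearMap.comp_apply]
            rw [f.app_smul i p p' q q' hp hq hq', LinearMap.map_smul_of_tower]
            exact congrArg _ (g.map_smul i q q' _ r _))
        map_add' := fun (f f' : HomDeg M N n) => HomDeg.ext fun p q hq x =>
          (g.hom.f q).hom.map_add _ _
        map_smul' := fun c (f : HomDeg M N n) => HomDeg.ext fun p q hq x =>
          (g.hom.f q).hom.map_smul c _ }) (by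
    intro n n' hn f
    refine HomDeg.ext fun p q hq x => ?_
    rw [homCx_d M N n n' hn]
    change _ = g.hom.f q ((homDiff M N n n' hn f).app p q hq x)
    rw [homDiff_app M N' n n' hn _ p (p - 1) (q + 1) q (by omega) (by omega),
      homDiff_app M N n n' hn _ p (p - 1) (q + 1) q (by omega) (by omega), map_sub, hom_comm]
    congr 1
    exact (LinearMap.map_smul_of_tower (g.hom.f q).hom _ _).symm)

/-- Precomposition `Hom_R(M', N) → Hom_R(M, N)` with a morphism `M → M'`. -/
def homPre {M M' : DGModule R} (g : M ⟶ M') (N : DGModule R) : homCx M' N ⟶ homCx M N :=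
  homCxLift
    (fun n =>
      { toFun := fun (f : HomDeg M' N n) =>
          HomDeg.mk (fun p q hq => f.app p q hq ∘ₗ (g.hom.f p).hom) (by
            intro i p p' q q' hp hq hq' r x
            simp only [LinearMap.comp_apply]
            rw [← f.app_smul i p p' q q' hp hq hq']
            exact congrArg _ (g.map_smul i p p' hp r x))
        map_add' := fun (f f' : HomDeg M' N n) => rfl
        map_smul' := fun c (f : HomDeg M' N n) => rfl }) (by
    intro n n' hn f
    refine HomDeg.ext fun p q hq x => ?_
    rw [homCx_d M' N n n' hn]
    change _ = (homDiff M' N n n' hn f).app p q hq (g.hom.f p x)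
    rw [homDiff_app M N n n' hn _ p (p - 1) (q + 1) q (by omega) (by omega),
      homDiff_app M' N n n' hn _ p (p - 1) (q + 1) q (by omega) (by omega), ← hom_comm]
    rfl)

/-- The forgetful map `Hom_S(M, N) → Hom_R(M, N)` for a morphism of DGAs `R → S`. -/
def homRestrict (φ : R.Hom S) (M N : DGModule S) :
    homCx M N ⟶ homCx (restrict φ M) (restrict φ N) :=
  homCxLift
    (fun n =>
      { toFun := fun (f : HomDeg M N n) => HomDeg.mk (fun p q hq => f.app p q hq)
          (fun i p p' q q' hp hq hq' r x =>
            f.app_smul i p p' q q' hp hq hq' (φ.hom.f i r) x)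
        map_add' := fun f f' => rfl
        map_smul' := fun c f => rfl }) (by
    intro n n' hn f
    rw [homCx_d M N n n' hn]
    rfl)

/-- The action of `S` on `Hom_R(S, I)`: `(s f)(x) = (-1)^(|s|(|f| + |x|)) f (x s)`. -/
def coextendSMul (φ : R.Hom S) (I : DGModule R) (i j k : ℤ) (h : i + j = k) (s : S.cx.X i)
    (f : HomDeg (restrict φ S.leftSelf) I j) : HomDeg (restrict φ S.leftSelf) I k :=
  HomDeg.mk (fun p q hq => (i * (j + p)).negOnePow •
    (f.app (p + i) q (by omega) ∘ₗ (S.mul p i (p + i) rfl).flip s)) (by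
      intro a p p' q q' hp hq hq' r x
      simp only [LinearMap.smul_apply, LinearMap.comp_apply, LinearMap.flip_apply]
      have e : S.mul p' i (p' + i) rfl ((restrict φ S.leftSelf).smul a p p' hp r x) s =
          (restrict φ S.leftSelf).smul a (p + i) (p' + i) (by omega) r
            (S.mul p i (p + i) rfl x s) :=
        S.mul_assoc a p i p' (p + i) (p' + i) hp rfl rfl (by omega) (φ.hom.f a r) x s
      refine (congrArg (fun z => (i * (j + p')).negOnePow • f.app (p' + i) q' (by omega) z)
        e).trans ?_
      rw [f.app_smul a (p + i) (p' + i) q q' (by omega) (by omega) (by omega),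
        LinearMap.map_smul_of_tower, smul_smul, smul_smul, ← Int.negOnePow_add,
        ← Int.negOnePow_add]
      congr 2
      subst h hp
      ring)

lemma coextendSMul_app (φ : R.Hom S) (I : DGModule R) (i j k : ℤ) (h : i + j = k) (s : S.cx.X i)
    (f : HomDeg (restrict φ S.leftSelf) I j) (p p' q : ℤ) (hp : p + i = p') (hq : p + k = q)
    (x : S.cx.X p) :
    (coextendSMul φ I i j k h s f).app p q hq x =
      (i * (j + p)).negOnePow • f.app p' q (by omega) (S.mul p i p' hp x s) := by
  subst hp
  rfl

/-- For a morphism of DGAs `R → S` and a DG `R`-module `I`, the complex `Hom_R(S, I)` as a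
DG `S`-module. -/
abbrev coextend (φ : R.Hom S) (I : DGModule R) : DGModule S where
  cx := homCx (restrict φ S.leftSelf) I
  smul i j k h := LinearMap.mk₂ K
    (fun (s : S.cx.X i) (f : HomDeg (restrict φ S.leftSelf) I j) =>
      (coextendSMul φ I i j k h s f : HomDeg (restrict φ S.leftSelf) I k))
    (fun s s' f => HomDeg.ext fun p q hq (x : S.cx.X p) => by
      rw [HomDeg.add_app, LinearMap.add_apply]
      simp only [coextendSMul_app φ I i j k h _ _ p (p + i) q rfl, map_add, smul_add])
    (fun c s f => HomDeg.ext fun p q hq (x : S.cx.X p) => by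
      rw [HomDeg.smul_app, LinearMap.smul_apply]
      simp only [coextendSMul_app φ I i j k h _ _ p (p + i) q rfl, map_smul]
      rw [smul_comm])
    (fun s f f' => HomDeg.ext fun p q hq (x : S.cx.X p) => by
      rw [HomDeg.add_app, LinearMap.add_apply]
      simp only [coextendSMul_app φ I i j k h _ _ p (p + i) q rfl, HomDeg.add_app,
        LinearMap.add_apply, smul_add])
    (fun c s f => HomDeg.ext fun p q hq (x : S.cx.X p) => by
      rw [HomDeg.smul_app, LinearMap.smul_apply]
      simp only [coextendSMul_app φ I i j k h _ _ p (p + i) q rfl, HomDeg.smul_app,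
        LinearMap.smul_apply]
      rw [smul_comm])
  one_smul j (f : HomDeg (restrict φ S.leftSelf) I j) :=
    HomDeg.ext fun p q hq (x : S.cx.X p) => by
      refine (coextendSMul_app φ I 0 j j (zero_add j) S.one f p p q (add_zero p) hq x).trans ?_
      simp [S.mul_one]
  mul_smul i j k ij jk n h₁ h₂ h₃ h₄ r s (f : HomDeg (restrict φ S.leftSelf) I k) :=
    HomDeg.ext fun p q hq (x : S.cx.X p) => by
      refine (coextendSMul_app φ I ij k n h₃ _ f p (p + ij) q rfl hq x).trans ?_
      refine Eq.trans ?_ (coextendSMul_app φ I i jk n h₄ r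
        (coextendSMul φ I j k jk h₂ s f) p (p + i) q rfl hq x).symm
      rw [coextendSMul_app φ I j k jk h₂ s f (p + i) (p + ij) q (by omega) (by omega),
        S.mul_assoc p i j (p + i) ij (p + ij) rfl h₁ (by omega) rfl, smul_smul,
        ← Int.negOnePow_add]
      congr 1
      rw [Int.negOnePow_eq_iff]
      subst h₁ h₂
      exact ⟨-(i * j), by ring⟩
  leibniz i j k i' j' k' hi hj hk h s (f : HomDeg (restrict φ S.leftSelf) I j) := by
    rw [homCx_d _ _ k k' hk, homCx_d _ _ j j' hj]
    refine HomDeg.ext fun p q hq (x : S.cx.X p) => ?_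
    change (homDiff _ _ k k' hk (coextendSMul φ I i j k h s f)).app p q hq x =
      (coextendSMul φ I i' j k' (by omega) (S.cx.d i i' s) f +
        i.negOnePow • coextendSMul φ I i j' k' (by omega) s (homDiff _ _ j j' hj f)).app p q hq x
    rw [HomDeg.add_app, HomDeg.units_smul_app, LinearMap.add_apply, LinearMap.smul_apply]
    rw [homDiff_app _ _ k k' hk _ p (p - 1) (q + 1) q (by omega) (by omega),
      coextendSMul_app φ I i j k h s f p (p + i) (q + 1) rfl,
      coextendSMul_app φ I i j k h s f (p - 1) (p + i - 1) q (by omega),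
      coextendSMul_app φ I i' j k' _ _ f p (p + i - 1) q (by omega),
      coextendSMul_app φ I i j' k' _ s _ p (p + i) q rfl,
      homDiff_app _ _ j j' hj _ (p + i) (p + i - 1) (q + 1) q (by omega) (by omega)]
    change _ = _ + i.negOnePow • (i * (j' + p)).negOnePow • (_ - j.negOnePow •
      f.app _ _ _ (S.cx.d (p + i) (p + i - 1) _))
    rw [S.leibniz p i (p + i) (p - 1) i' (p + i - 1) (by omega) hi (by omega) rfl]
    change _ - k.negOnePow • (i * (j + (p - 1))).negOnePow • f.app _ _ _
      (S.mul _ _ _ _ (S.cx.d p (p - 1) x) s) = _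
    simp only [map_add, LinearMap.map_smul_of_tower]
    obtain rfl : i = i' + 1 := hi.symm
    obtain rfl : j = j' + 1 := hj.symm
    subst h
    simp only [mul_add, add_mul, mul_sub, one_mul, mul_one, Int.negOnePow_add,
      Int.negOnePow_sub, Int.negOnePow_one]
    rcases Int.units_eq_one_or (i' * j').negOnePow with h₁ | h₁ <;>
    rcases Int.units_eq_one_or (i' * p).negOnePow with h₂ | h₂ <;>
    rcases Int.units_eq_one_or i'.negOnePow with h₃ | h₃ <;>
    rcases Int.units_eq_one_or j'.negOnePow with h₄ | h₄ <;>
    rcases Int.units_eq_one_or p.negOnePow with h₅ | h₅ <;>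
    simp [h₁, h₂, h₃, h₄, h₅] <;> abel

/-- For a DG `S`-module `M` and a morphism `ι : M → I` of DG `R`-modules, the morphism
`M → Hom_R(S, I)` of DG `S`-modules which sends `m` to `x ↦ (-1)^(|m||x|) ι (x m)`. -/
def toCoextend (φ : R.Hom S) (M : DGModule S) {I : DGModule R} (ι : restrict φ M ⟶ I) :
    M ⟶ coextend φ I where
  hom := homCxLift
    (fun n =>
      { toFun := fun m => HomDeg.mk (fun p q hq => (n * p).negOnePow •
            ((ι.hom.f q).hom ∘ₗ (M.smul p n q hq).flip m)) (by
          intro a p p' q q' hp hq hq' r x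
          simp only [LinearMap.smul_apply, LinearMap.comp_apply, LinearMap.flip_apply]
          have e : M.smul p' n q' hq' ((restrict φ S.leftSelf).smul a p p' hp r x) m =
              (restrict φ M).smul a q q' (by omega) r (M.smul p n q hq x m) :=
            M.mul_smul a p n p' q q' hp hq hq' (by omega) (φ.hom.f a r) x m
          refine (congrArg (fun z => (n * p').negOnePow • ι.hom.f q' z) e).trans ?_
          rw [LinearMap.map_smul_of_tower, smul_smul, ← Int.negOnePow_add, ← mul_add, hp]
          exact congrArg _ (ι.map_smul a q q' (by omega) r _))
        map_add' := fun m m' => HomDeg.ext fun p q hq x => by simp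
        map_smul' := fun c m => HomDeg.ext fun p q hq (x : S.cx.X p) => by
          change (n * p).negOnePow • (ι.hom.f q).hom (M.smul p n q hq x (c • m)) =
            c • (n * p).negOnePow • (ι.hom.f q).hom (M.smul p n q hq x m)
          rw [LinearMap.map_smul, LinearMap.map_smul, smul_comm] }) (by
    intro n n' hn m
    refine HomDeg.ext fun p q hq (x : S.cx.X p) => ?_
    rw [homDiff_app _ _ n n' hn _ p (p - 1) (q + 1) q (by omega) (by omega)]
    change I.cx.d (q + 1) q ((n * p).negOnePow • ι.hom.f (q + 1) (M.smul p n (q + 1) _ x m)) -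
        n.negOnePow • (n * (p - 1)).negOnePow • ι.hom.f q
          (M.smul (p - 1) n q _ (S.cx.d p (p - 1) x) m) =
      (n' * p).negOnePow • ι.hom.f q (M.smul p n' q _ x (M.cx.d n n' m))
    have e : I.cx.d (q + 1) q (ι.hom.f (q + 1) (M.smul p n (q + 1) (by omega) x m)) =
        ι.hom.f q (M.cx.d (q + 1) q (M.smul p n (q + 1) (by omega) x m)) :=
      (hom_comm ι.hom _ _ _).symm
    rw [LinearMap.map_smul_of_tower, e, M.leibniz p n (q + 1) (p - 1) n' q (by omega) hn rfl]
    obtain rfl : n = n' + 1 := hn.symm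
    simp only [add_mul, mul_sub, one_mul, mul_one, Int.negOnePow_add,
      Int.negOnePow_sub, Int.negOnePow_one, map_add, LinearMap.map_smul_of_tower]
    rcases Int.units_eq_one_or (n' * p).negOnePow with h₂ | h₂ <;>
    rcases Int.units_eq_one_or n'.negOnePow with h₃ | h₃ <;>
    rcases Int.units_eq_one_or p.negOnePow with h₅ | h₅ <;>
    simp [h₂, h₃, h₅])
  map_smul i j k h s m := HomDeg.ext fun p q hq (x : S.cx.X p) => by
    refine Eq.trans ?_ (coextendSMul_app φ I i j k h s _ p (p + i) q rfl hq x).symm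
    change (k * p).negOnePow • ι.hom.f q (M.smul p k q hq x (M.smul i j k h s m)) =
      (i * (j + p)).negOnePow • (j * (p + i)).negOnePow • ι.hom.f q
        (M.smul (p + i) j q _ (S.mul p i (p + i) rfl x s) m)
    rw [M.mul_smul p i j (p + i) k q rfl h (by omega) hq, smul_smul, ← Int.negOnePow_add]
    congr 1
    rw [Int.negOnePow_eq_iff]
    subst h
    exact ⟨-(i * j), by ring⟩

end DGModule

/-! ## The complex `M ⊗_R N` -/

namespace DGTensor

variable {R S : DGAlgebra K}

/-- The degree `n` part of the tensor product of the complexes `M` and `N` over `K`. -/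
abbrev Raw (M : DGRightModule R) (N : DGModule R) (n : ℤ) : Type u :=
  ⨁ p : {p : ℤ × ℤ // p.1 + p.2 = n}, M.cx.X p.1.1 ⊗[K] N.cx.X p.1.2

/-- The pure tensors in `M ⊗_K N`. -/
def rawMul (M : DGRightModule R) (N : DGModule R) (i j n : ℤ) (h : i + j = n) :
    M.cx.X i →ₗ[K] N.cx.X j →ₗ[K] Raw M N n :=
  (TensorProduct.mk K (M.cx.X i) (N.cx.X j)).compr₂
    (DirectSum.lof K {p : ℤ × ℤ // p.1 + p.2 = n}
      (fun p => M.cx.X p.1.1 ⊗[K] N.cx.X p.1.2) ⟨(i, j), h⟩)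

/-- The submodule spanned by the elements `x r ⊗ y - x ⊗ r y`. -/
def relations (M : DGRightModule R) (N : DGModule R) (n : ℤ) : Submodule K (Raw M N n) :=
  Submodule.span K {z | ∃ (i j k ij jk : ℤ) (h₁ : i + j = ij) (h₂ : j + k = jk)
    (h₃ : ij + k = n) (h₄ : i + jk = n) (x : M.cx.X i) (r : R.cx.X j) (y : N.cx.X k),
    z = rawMul M N ij k n h₃ (M.smul i j ij h₁ x r) y -
      rawMul M N i jk n h₄ x (N.smul j k jk h₂ r y)}

/-- The degree `n` part of `M ⊗_R N`. -/
abbrev Deg (M : DGRightModule R) (N : DGModule R) (n : ℤ) : Type u :=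
  Raw M N n ⧸ relations M N n

/-- The pure tensors in `M ⊗_R N`. -/
def tmul (M : DGRightModule R) (N : DGModule R) (i j n : ℤ) (h : i + j = n) :
    M.cx.X i →ₗ[K] N.cx.X j →ₗ[K] Deg M N n :=
  (rawMul M N i j n h).compr₂ (relations M N n).mkQ

section

variable (M : DGRightModule R) (N : DGModule R) (n : ℤ)

lemma tmul_smul (i j k ij jk : ℤ) (h₁ : i + j = ij) (h₂ : j + k = jk) (h₃ : ij + k = n)
    (h₄ : i + jk = n) (x : M.cx.X i) (r : R.cx.X j) (y : N.cx.X k) :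
    tmul M N ij k n h₃ (M.smul i j ij h₁ x r) y = tmul M N i jk n h₄ x (N.smul j k jk h₂ r y) := by
  refine (Submodule.Quotient.eq _).2 (Submodule.subset_span ?_)
  exact ⟨i, j, k, ij, jk, h₁, h₂, h₃, h₄, x, r, y, rfl⟩

variable {M N n} {A : Type u} [AddCommGroup A] [Module K A]

/-- The linear map out of `(M ⊗_R N)ₙ` given by a balanced family of bilinear maps. -/
def lift (b : ∀ i j : ℤ, i + j = n → (M.cx.X i →ₗ[K] N.cx.X j →ₗ[K] A))
    (hb : ∀ (i j k ij jk : ℤ) (h₁ : i + j = ij) (h₂ : j + k = jk) (h₃ : ij + k = n)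
      (h₄ : i + jk = n) (x : M.cx.X i) (r : R.cx.X j) (y : N.cx.X k),
      b ij k h₃ (M.smul i j ij h₁ x r) y = b i jk h₄ x (N.smul j k jk h₂ r y)) :
    Deg M N n →ₗ[K] A :=
  (relations M N n).liftQ
    (DirectSum.toModule K _ A fun p => TensorProduct.lift (b p.1.1 p.1.2 p.2)) (by
      refine Submodule.span_le.2 ?_
      rintro _ ⟨i, j, k, ij, jk, h₁, h₂, h₃, h₄, x, r, y, rfl⟩
      simp only [rawMul, SetLike.mem_coe, LinearMap.mem_ker, map_sub, LinearMap.compr₂_apply,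
        TensorProduct.mk_apply, DirectSum.toModule_lof, TensorProduct.lift.tmul]
      exact sub_eq_zero.2 (hb i j k ij jk h₁ h₂ h₃ h₄ x r y))

@[simp] lemma lift_tmul (b : ∀ i j : ℤ, i + j = n → (M.cx.X i →ₗ[K] N.cx.X j →ₗ[K] A))
    (hb) (i j : ℤ) (h : i + j = n) (x : M.cx.X i) (y : N.cx.X j) :
    lift b hb (tmul M N i j n h x y) = b i j h x y := by
  exact (Submodule.liftQ_apply _ _ _).trans (by simp [rawMul])

lemma lin_ext {f g : Deg M N n →ₗ[K] A}
    (h : ∀ (i j : ℤ) (hij : i + j = n) (x : M.cx.X i) (y : N.cx.X j),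
      f (tmul M N i j n hij x y) = g (tmul M N i j n hij x y)) : f = g := by
  refine Submodule.linearMap_qext _ (DirectSum.linearMap_ext _ fun p => ?_)
  exact TensorProduct.ext' fun x y => h p.1.1 p.1.2 p.2 x y

end

/-- The differential `x ⊗ y ↦ ∂x ⊗ y + (-1)^|x| x ⊗ ∂y`. -/
def diff (M : DGRightModule R) (N : DGModule R) (n n' : ℤ) (hn : n' + 1 = n) :
    Deg M N n →ₗ[K] Deg M N n' :=
  lift (fun i j h =>
    (tmul M N (i - 1) j n' (by omega)).comp (M.cx.d i (i - 1)).hom +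
      i.negOnePow • (tmul M N i (j - 1) n' (by omega)).compl₂ (N.cx.d j (j - 1)).hom) (by
    intro i j k ij jk h₁ h₂ h₃ h₄ x r y
    simp only [LinearMap.add_apply, LinearMap.comp_apply, LinearMap.smul_apply,
      LinearMap.compl₂_apply]
    rw [M.leibniz i j ij (i - 1) (j - 1) (ij - 1) (by omega) (by omega) (by omega),
      N.leibniz j k jk (j - 1) (k - 1) (jk - 1) (by omega) (by omega) (by omega)]
    simp only [map_add, LinearMap.add_apply, LinearMap.map_smul_of_tower, LinearMap.smul_apply]
    rw [tmul_smul M N n' (i - 1) j k (ij - 1) jk (by omega) h₂ (by omega) (by omega),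
      tmul_smul M N n' i (j - 1) k (ij - 1) (jk - 1) (by omega) (by omega) (by omega) (by omega),
      tmul_smul M N n' i j (k - 1) ij (jk - 1) (by omega) (by omega) (by omega) (by omega)]
    subst h₁
    simp [Int.negOnePow_add, smul_smul, add_assoc])

lemma diff_tmul (M : DGRightModule R) (N : DGModule R) (n n' : ℤ) (hn : n' + 1 = n)
    (i j i' j' : ℤ) (hi : i' + 1 = i) (hj : j' + 1 = j) (h : i + j = n)
    (x : M.cx.X i) (y : N.cx.X j) :
    diff M N n n' hn (tmul M N i j n h x y) =
      tmul M N i' j n' (by omega) (M.cx.d i i' x) y +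
        i.negOnePow • tmul M N i j' n' (by omega) x (N.cx.d j j' y) := by
  obtain rfl : i' = i - 1 := by omega
  obtain rfl : j' = j - 1 := by omega
  simp [diff]

/-- The complex `M ⊗_R N`. -/
abbrev cx (M : DGRightModule R) (N : DGModule R) : ChainComplex (ModuleCat.{u} K) ℤ where
  X n := ModuleCat.of K (Deg M N n)
  d n n' := if h : n' + 1 = n then ModuleCat.ofHom (diff M N n n' h) else 0
  shape n n' h := dif_neg h
  d_comp_d' n n' n'' h h' := by
    have h : n' + 1 = n := h
    have h' : n'' + 1 = n' := h'
    rw [dif_pos h, dif_pos h']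
    ext1
    refine lin_ext fun i j hij x y => ?_
    change diff M N n' n'' h' (diff M N n n' h (tmul M N i j n hij x y)) = 0
    have hM : M.cx.d (i - 1) (i - 1 - 1) (M.cx.d i (i - 1) x) = 0 := by
      rw [← ModuleCat.comp_apply]; simp
    have hN : N.cx.d (j - 1) (j - 1 - 1) (N.cx.d j (j - 1) y) = 0 := by
      rw [← ModuleCat.comp_apply]; simp
    rw [diff_tmul M N n n' h i j (i - 1) (j - 1) (by omega) (by omega), map_add,
      LinearMap.map_smul_of_tower,
      diff_tmul M N n' n'' h' (i - 1) j (i - 1 - 1) (j - 1) (by omega) (by omega),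
      diff_tmul M N n' n'' h' i (j - 1) (i - 1) (j - 1 - 1) (by omega) (by omega), hM, hN]
    rcases Int.units_eq_one_or i.negOnePow with h | h <;>
    simp [h, Int.negOnePow_sub]

lemma cx_d (M : DGRightModule R) (N : DGModule R) (n n' : ℤ) (hn : n' + 1 = n) :
    (cx M N).d n n' = ModuleCat.ofHom (diff M N n n' hn) := dif_pos hn

/-- A morphism out of a complex `M ⊗_R N` is given by its values on pure tensors. -/
def cxLift {M : DGRightModule R} {N : DGModule R} {C : ChainComplex (ModuleCat.{u} K) ℤ}
    (b : ∀ n i j : ℤ, i + j = n → (M.cx.X i →ₗ[K] N.cx.X j →ₗ[K] C.X n))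
    (hb : ∀ (n i j k ij jk : ℤ) (h₁ : i + j = ij) (h₂ : j + k = jk) (h₃ : ij + k = n)
      (h₄ : i + jk = n) (x : M.cx.X i) (r : R.cx.X j) (y : N.cx.X k),
      b n ij k h₃ (M.smul i j ij h₁ x r) y = b n i jk h₄ x (N.smul j k jk h₂ r y))
    (hf : ∀ (n n' i j i' j' : ℤ) (_ : n' + 1 = n) (_ : i' + 1 = i) (_ : j' + 1 = j)
      (h : i + j = n) (x : M.cx.X i) (y : N.cx.X j),
      C.d n n' (b n i j h x y) = b n' i' j (by omega) (M.cx.d i i' x) y +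
        i.negOnePow • b n' i j' (by omega) x (N.cx.d j j' y)) :
    cx M N ⟶ C where
  f n := ModuleCat.ofHom (lift (b n) (hb n))
  comm' n n' hn := by
    have hn : n' + 1 = n := hn
    rw [cx_d M N n n' hn]
    ext1
    refine lin_ext fun i j hij x y => ?_
    change C.d n n' (lift (b n) (hb n) (tmul M N i j n hij x y)) =
      lift (b n') (hb n') (diff M N n n' hn (tmul M N i j n hij x y))
    rw [lift_tmul, hf n n' i j (i - 1) (j - 1) hn (by omega) (by omega) hij,
      diff_tmul M N n n' hn i j (i - 1) (j - 1) (by omega) (by omega), map_add,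
      LinearMap.map_smul_of_tower, lift_tmul, lift_tmul]

/-- The morphism `M ⊗_R P → M ⊗_S N`, `x ⊗ y ↦ x ⊗ f y`, for a DG right `S`-module `M`, a DG left
`S`-module `N`, a DG left `R`-module `P` and a morphism `f : P → N` of DG `R`-modules. -/
def changeRings (φ : R.Hom S) (M : DGRightModule S) {P : DGModule R} {N : DGModule S}
    (f : P ⟶ DGModule.restrict φ N) : cx (M.restrict φ) P ⟶ cx M N :=
  cxLift (fun n i j h => (tmul M N i j n h).compl₂ (f.hom.f j).hom) (by
    intro n i j k ij jk h₁ h₂ h₃ h₄ x r y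
    refine (tmul_smul M N n i j k ij jk h₁ h₂ h₃ h₄ x (φ.hom.f j r) (f.hom.f k y)).trans ?_
    exact congrArg (tmul M N i jk n h₄ x) (f.map_smul j k jk h₂ r y).symm) (by
    intro n n' i j i' j' hn hi hj h x y
    rw [cx_d M N n n' hn]
    refine (diff_tmul M N n n' hn i j i' j' hi hj h x (f.hom.f j y)).trans ?_
    rw [← DGModule.hom_comm f.hom j j' y]
    rfl)

end DGTensor

namespace DGModule

variable {R S : DGAlgebra K}

/-- The action of `S` on `S ⊗_R P`: `s (t ⊗ y) = (s t) ⊗ y`. -/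
def extendSMul (φ : R.Hom S) (P : DGModule R) (i j k : ℤ) (h : i + j = k) (s : S.cx.X i) :
    DGTensor.Deg (S.rightSelf.restrict φ) P j →ₗ[K] DGTensor.Deg (S.rightSelf.restrict φ) P k :=
  DGTensor.lift (fun p q hpq =>
    (DGTensor.tmul (S.rightSelf.restrict φ) P (i + p) q k (by omega)).comp
      (S.mul i p (i + p) rfl s)) (by
    intro p q l pq ql h₁ h₂ h₃ h₄ x r y
    refine Eq.trans ?_ (DGTensor.tmul_smul (S.rightSelf.restrict φ) P k (i + p) q l (i + pq) ql
      (by omega) h₂ (by omega) (by omega) (S.mul i p (i + p) rfl s x) r y)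
    exact congrArg (fun z => DGTensor.tmul (S.rightSelf.restrict φ) P (i + pq) l k (by omega) z y)
      (S.mul_assoc i p q (i + p) pq (i + pq) rfl h₁ (by omega) rfl s x (φ.hom.f q r)).symm)

lemma extendSMul_tmul (φ : R.Hom S) (P : DGModule R) (i j k : ℤ) (h : i + j = k) (s : S.cx.X i)
    (p q p' : ℤ) (hpq : p + q = j) (hp : i + p = p') (t : S.cx.X p) (y : P.cx.X q) :
    extendSMul φ P i j k h s (DGTensor.tmul (S.rightSelf.restrict φ) P p q j hpq t y) =
      DGTensor.tmul (S.rightSelf.restrict φ) P p' q k (by omega) (S.mul i p p' hp s t) y := by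
  subst hp
  exact DGTensor.lift_tmul _ _ _ _ _ _ _

lemma extendSMul_leibniz (φ : R.Hom S) (P : DGModule R) (i j k i' j' k' : ℤ) (hi : i' + 1 = i)
    (hj : j' + 1 = j) (hk : k' + 1 = k) (h : i + j = k) (s : S.cx.X i) :
    DGTensor.diff (S.rightSelf.restrict φ) P k k' hk ∘ₗ extendSMul φ P i j k h s =
      extendSMul φ P i' j k' (by omega) (S.cx.d i i' s) +
        i.negOnePow • (extendSMul φ P i j' k' (by omega) s ∘ₗ
          DGTensor.diff (S.rightSelf.restrict φ) P j j' hj) := by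
  refine DGTensor.lin_ext fun p q hpq t y => ?_
  rw [LinearMap.add_apply, LinearMap.smul_apply, LinearMap.comp_apply, LinearMap.comp_apply]
  rw [extendSMul_tmul φ P i j k h s p q (i + p) hpq rfl,
    DGTensor.diff_tmul _ _ k k' hk (i + p) q (i + p - 1) (q - 1) (by omega) (by omega),
    DGTensor.diff_tmul _ _ j j' hj p q (p - 1) (q - 1) (by omega) (by omega),
    extendSMul_tmul φ P i' j k' _ _ p q (i + p - 1) hpq (by omega), map_add,
    LinearMap.map_smul_of_tower,
    extendSMul_tmul φ P i j' k' _ s (p - 1) q (i + p - 1) (by omega) (by omega),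
    extendSMul_tmul φ P i j' k' _ s p (q - 1) (i + p) (by omega) rfl]
  have e := S.leibniz i p (i + p) i' (p - 1) (i + p - 1) hi (by omega) (by omega) rfl s t
  refine (congrArg (fun z => DGTensor.tmul (S.rightSelf.restrict φ) P (i + p - 1) q k'
    (by omega) z y + _) e).trans ?_
  rw [map_add, LinearMap.map_smul_of_tower, LinearMap.add_apply, LinearMap.smul_apply, smul_add,
    smul_smul, Int.negOnePow_add, add_assoc]

/-- The action of `S` on `S ⊗_R P`, as a bilinear map. -/
def extendSMulₗ (φ : R.Hom S) (P : DGModule R) (i j k : ℤ) (h : i + j = k) :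
    S.cx.X i →ₗ[K] DGTensor.Deg (S.rightSelf.restrict φ) P j →ₗ[K]
      DGTensor.Deg (S.rightSelf.restrict φ) P k where
  toFun s := extendSMul φ P i j k h s
  map_add' s s' := DGTensor.lin_ext fun p q hpq t y => by
    simp only [LinearMap.add_apply, extendSMul_tmul φ P i j k h _ p q (i + p) hpq rfl, map_add]
  map_smul' c s := DGTensor.lin_ext fun p q hpq t y => by
    simp only [LinearMap.smul_apply, extendSMul_tmul φ P i j k h _ p q (i + p) hpq rfl,
      map_smul, RingHom.id_apply]

lemma extendSMul_one (φ : R.Hom S) (P : DGModule R) (i : ℤ) :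
    extendSMul φ P 0 i i (zero_add i) S.one = LinearMap.id := by
  refine DGTensor.lin_ext fun p q hpq t y => ?_
  rw [extendSMul_tmul φ P 0 i i _ _ p q p hpq (zero_add p), S.one_mul]
  rfl

lemma extendSMul_mul (φ : R.Hom S) (P : DGModule R) (i j k ij jk n : ℤ) (h₁ : i + j = ij)
    (h₂ : j + k = jk) (h₃ : ij + k = n) (h₄ : i + jk = n) (r : S.cx.X i) (s : S.cx.X j) :
    extendSMul φ P ij k n h₃ (S.mul i j ij h₁ r s) =
      extendSMul φ P i jk n h₄ r ∘ₗ extendSMul φ P j k jk h₂ s := by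
  refine DGTensor.lin_ext fun p q hpq t y => ?_
  rw [LinearMap.comp_apply, extendSMul_tmul φ P j k jk h₂ s p q (j + p) hpq rfl,
    extendSMul_tmul φ P i jk n h₄ r (j + p) q (ij + p) (by omega) (by omega),
    extendSMul_tmul φ P ij k n h₃ _ p q (ij + p) hpq rfl,
    S.mul_assoc i j p ij (j + p) (ij + p) h₁ rfl rfl (by omega)]

/-- For a morphism of DGAs `R → S` and a DG `R`-module `P`, the complex `S ⊗_R P` as a
DG `S`-module. -/
abbrev extend (φ : R.Hom S) (P : DGModule R) : DGModule S where
  cx := DGTensor.cx (S.rightSelf.restrict φ) P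
  smul i j k h := extendSMulₗ φ P i j k h
  one_smul i z := LinearMap.congr_fun (extendSMul_one φ P i) z
  mul_smul i j k ij jk n h₁ h₂ h₃ h₄ r s z :=
    LinearMap.congr_fun (extendSMul_mul φ P i j k ij jk n h₁ h₂ h₃ h₄ r s) z
  leibniz i j k i' j' k' hi hj hk h s z := by
    rw [DGTensor.cx_d _ _ k k' hk, DGTensor.cx_d _ _ j j' hj]
    exact LinearMap.congr_fun (extendSMul_leibniz φ P i j k i' j' k' hi hj hk h s) z

lemma fromExtend_balanced (φ : R.Hom S) {P : DGModule R} (M : DGModule S) (π : P ⟶ restrict φ M)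
    (n i j k ij jk : ℤ) (h₁ : i + j = ij) (h₂ : j + k = jk) (h₃ : ij + k = n)
    (h₄ : i + jk = n) (x : S.cx.X i) (r : R.cx.X j) (y : P.cx.X k) :
    (M.smul ij k n h₃).compl₂ (π.hom.f k).hom (S.mul i j ij h₁ x (φ.hom.f j r)) y =
      (M.smul i jk n h₄).compl₂ (π.hom.f jk).hom x (P.smul j k jk h₂ r y) := by
  refine (M.mul_smul i j k ij jk n h₁ h₂ h₃ h₄ x (φ.hom.f j r) (π.hom.f k y)).trans ?_
  exact congrArg (M.smul i jk n h₄ x) (π.map_smul j k jk h₂ r y).symm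

/-- For a DG `S`-module `M` and a morphism `π : P → M` of DG `R`-modules, the morphism
`S ⊗_R P → M` of DG `S`-modules which sends `s ⊗ y` to `s (π y)`. -/
def fromExtend (φ : R.Hom S) {P : DGModule R} (M : DGModule S) (π : P ⟶ restrict φ M) :
    extend φ P ⟶ M where
  hom := DGTensor.cxLift (fun n i j h => (M.smul i j n h).compl₂ (π.hom.f j).hom)
    (fromExtend_balanced φ M π) (by
      intro n n' i j i' j' hn hi hj h (x : S.cx.X i) y
      refine (M.leibniz i j n i' j' n' hi hj hn h x (π.hom.f j y)).trans ?_
      rw [LinearMap.compl₂_apply, LinearMap.compl₂_apply]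
      refine congrArg (fun z => _ + i.negOnePow • M.smul i j' n' (by omega) x z) ?_
      exact (hom_comm π.hom j j' y).symm)
  map_smul i j k h s z := by
    refine LinearMap.congr_fun
      (f := DGTensor.lift (fun p q h => (M.smul p q k h).compl₂ (π.hom.f q).hom)
        (fromExtend_balanced φ M π k) ∘ₗ extendSMul φ P i j k h s)
      (g := M.smul i j k h s ∘ₗ
        DGTensor.lift (fun p q h => (M.smul p q j h).compl₂ (π.hom.f q).hom)
          (fromExtend_balanced φ M π j))
      (DGTensor.lin_ext fun p q hpq t y => ?_) z
    rw [LinearMap.comp_apply, LinearMap.comp_apply,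
      extendSMul_tmul φ P i j k h s p q (i + p) hpq rfl]
    refine (DGTensor.lift_tmul _ _ _ _ _ _ _).trans ?_
    refine (M.mul_smul i p q (i + p) j k rfl hpq (by omega) h s t (π.hom.f q y)).trans ?_
    exact congrArg (M.smul i j k h s) (DGTensor.lift_tmul (M := S.rightSelf.restrict φ) (N := P)
      _ (fromExtend_balanced φ M π j) p q hpq t y).symm

/-! ## Resolutions -/

/-- `P` is K-projective if `Hom_R(P, -)` preserves quasi-isomorphisms. -/
def IsKProjective (P : DGModule R) : Prop :=
  ∀ ⦃M N : DGModule R⦄ (f : M ⟶ N), IsQuasiIso f → QuasiIso (homPost P f)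

/-- `I` is K-injective if `Hom_R(-, I)` preserves quasi-isomorphisms. -/
def IsKInjective (I : DGModule R) : Prop :=
  ∀ ⦃M N : DGModule R⦄ (f : M ⟶ N), IsQuasiIso f → QuasiIso (homPre f I)

/-- A K-projective resolution of `M`. -/
structure KProjectiveResolution (M : DGModule R) where
  /-- the resolving DG module -/
  obj : DGModule R
  /-- the augmentation -/
  map : obj ⟶ M
  isKProjective : IsKProjective obj
  isQuasiIso : IsQuasiIso map

/-- A K-injective resolution of `M`. -/
structure KInjectiveResolution (M : DGModule R) where
  /-- the resolving DG module -/
  obj : DGModule R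
  /-- the coaugmentation -/
  map : M ⟶ obj
  isKInjective : IsKInjective obj
  isQuasiIso : IsQuasiIso map

/-- Resolutions computing the derived functors of a DG `S`-module `M` over `S` and over `R`:
a K-projective resolution over `S`, a K-projective resolution over `R`, and a
morphism of DG `R`-modules from the latter to the former which lies over `M` up to homotopy (it
exists and is unique up to homotopy). -/
structure ComparedResolutions (φ : R.Hom S) (M : DGModule S) where
  /-- the resolution over `S` -/
  resS : KProjectiveResolution M
  /-- the resolution over `R` -/
  resR : KProjectiveResolution (restrict φ M)
  /-- the comparison morphism -/
  comparison : resR.obj ⟶ restrict φ resS.obj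
  homotopic : Homotopic (comparison ≫ (restrictFunctor φ).map resS.map) resR.map

end DGModule

/-- The statement `p`, which concerns an object of a derived category computed by means of an
auxiliary resolution in `ρ`, is true: such resolutions exist, and `p` holds for all of them. -/
def ForResolutions {ρ : Type*} (p : ρ → Prop) : Prop := Nonempty ρ ∧ ∀ x : ρ, p x

/-! ## The derived category of `K` and the canonical maps -/

variable (K) in
/-- The functor from complexes of `K`-modules to the derived category `𝒟(K)`. -/
abbrev toDerBase : ChainComplex (ModuleCat.{u} K) ℤ ⥤
    (HomologicalComplex.quasiIso (ModuleCat.{u} K) (ComplexShape.down ℤ)).Localization :=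
  (HomologicalComplex.quasiIso (ModuleCat.{u} K) (ComplexShape.down ℤ)).Q

namespace DGModule

variable {R S : DGAlgebra K}

/-- The canonical morphism `S ⊗ᴸ_R M → M` in `𝒟(S)`, where `S ⊗ᴸ_R M` is computed by a
K-projective resolution `P → M` over `R`: the composite `S ⊗_R P → S ⊗_R M → M`. -/
def tensorCanonical (φ : R.Hom S) (M : DGModule S)
    (P : KProjectiveResolution (restrict φ M)) :
    (toDer S).obj (extend φ P.obj) ⟶ (toDer S).obj M :=
  (toDer S).map (fromExtend φ M P.map)

/-- The canonical morphism `M ⊗ᴸ_R N → M ⊗ᴸ_S N` in `𝒟(K)`, where both sides are computed by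
K-projective resolutions of `N`. -/
def tensorChangeCanonical (φ : R.Hom S) (M : DGRightModule S) (N : DGModule S)
    (P : ComparedResolutions φ N) :
    (toDerBase K).obj (DGTensor.cx (M.restrict φ) P.resR.obj) ⟶
      (toDerBase K).obj (DGTensor.cx M P.resS.obj) :=
  (toDerBase K).map (DGTensor.changeRings φ M P.comparison)

/-- The canonical morphism `M → RHom_R(S, M)` in `𝒟(S)`, where `RHom_R(S, M)` is computed by a
K-injective resolution `M → I` over `R`: the composite `M → Hom_R(S, M) → Hom_R(S, I)`. -/
def homCanonical (φ : R.Hom S) (M : DGModule S) (I : KInjectiveResolution (restrict φ M)) :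
    (toDer S).obj M ⟶ (toDer S).obj (coextend φ I.obj) :=
  (toDer S).map (toCoextend φ M I.map)

/-- The canonical morphism `RHom_S(M, M') → RHom_R(M, M')` in `𝒟(K)`, where both sides are
computed by K-projective resolutions of `M`. -/
def homChangeCanonical (φ : R.Hom S) (M M' : DGModule S) (P : ComparedResolutions φ M) :
    (toDerBase K).obj (homCx P.resS.obj M') ⟶
      (toDerBase K).obj (homCx P.resR.obj (restrict φ M')) :=
  (toDerBase K).map (homRestrict φ P.resS.obj M' ≫ homPre P.comparison (restrict φ M'))

end DGModule

end

noncomputable section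

variable {K : Type u} [CommRing K]

/-! ## Quasi-isomorphisms elementwise -/

namespace ElementwiseHomology

variable {C D E : ChainComplex (ModuleCat.{u} K) ℤ}

/-! Everything rests on the adjunctions around restriction of scalars, which exist on complexes:
`Hom_S(S ⊗_R P, N) ≅ Hom_R(P, N)` (`extendAdj`) and `Hom_S(N, Hom_R(S, I)) ≅ Hom_R(N, I)`
(`coextendAdj`). The first shows that `S ⊗_R P` is K-projective over `S` when `P` is K-projective
over `R`. Let `c : Q → P` compare a resolution `Q` of `M` over `R` with a resolution `P` of `M` over
`S`. Then the map `Hom_S(P, N) → Hom_R(Q, N)` of condition 5 is, up to the isomorphism `extendAdj`,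
precomposition with `S ⊗_R Q → P`. Both ends of the latter are K-projective, so the following are
the same: it is a quasi-isomorphism; it is a homotopy equivalence; precomposition with it is a
quasi-isomorphism for every `N`.

The implications among the first five conditions form a cycle. 1 → 4: `S ⊗_R Q → S` is a homotopy
equivalence, so `M = Hom_S(S, M)` maps quasi-isomorphically to `Hom_R(Q, M)`, which computes the
same as `Hom_R(S, I)`. 4 → 5: apply `Hom_S(P, -)` to `M → Hom_R(S, I)` and use the second
adjunction. 5 → 2: the principle above. 2 → 3: `M ⊗_R Q ≅ M ⊗_S (S ⊗_R Q)`, and tensoring preserves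
homotopy equivalences. 3 → 1: take both modules equal to `S`.

For 2 ↔ 6, morphisms out of a K-projective module in the derived category are homotopy classes of
morphisms, so the first adjunction passes to the derived categories. Under it, the action of `𝒟(φ)`
on morphisms from `M` to `N` becomes precomposition with the counit `S ⊗_R Q → M`; it is bijective
for all `N` exactly when the counit is an isomorphism, by Yoneda.

Every condition also asserts that resolutions exist, and proving this takes the second half of the
file. Each module is covered by a K-projective one, surjectively on elements and on cycles: free
modules of rank one hit the cycles, a contractible module hits the rest. Iterating with the kernels
gives a sequence whose direct sum, with the differential `∂ + δ`, is a K-projective resolution.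
Dually, each module embeds into a product of a contractible module and of character modules of `R`,
and products replace direct sums.

The common technical device is to express quasi-isomorphisms by elements, as acyclicity of the cone
(`ConeAcyclic`). K-projectivity and K-injectivity then become the solvability of two equations
between homogeneous maps (`quasiIso_homPost_iff`, `quasiIso_homPre_iff`), and the closure properties
follow by writing down or successively constructing solutions. -/

/-- The mapping cone of `f` is acyclic, in terms of elements. -/
def ConeAcyclic (f : C ⟶ D) : Prop :=
  ∀ (k i j l : ℤ), k + 1 = i → i + 1 = j → j + 1 = l → ∀ (x : C.X i) (y : D.X j),
    C.d i k x = 0 → D.d j i y = f.f i x →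
    ∃ (x' : C.X j) (y' : D.X l), C.d j i x' = x ∧ f.f j x' + D.d l j y' = y

lemma d_d (C : ChainComplex (ModuleCat.{u} K) ℤ) (i j k : ℤ) (x : C.X i) :
    C.d j k (C.d i j x) = 0 := by
  rw [← ModuleCat.comp_apply]; simp

lemma exists_cycle (i k : ℤ) (h : k + 1 = i) (x : C.X i) (hx : C.d i k x = 0) :
    ∃ z : C.cycles i, C.iCycles i z = x := by
  have e := ShortComplex.exact_of_f_is_kernel
    (ShortComplex.mk (C.iCycles i) (C.d i k) (by simp))
    (C.cyclesIsKernel i k ((ComplexShape.down ℤ).next_eq' h))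
  exact (ShortComplex.moduleCat_exact_iff _).1 e x hx

lemma iCycles_injective (i : ℤ) : Function.Injective (C.iCycles i) :=
  (ModuleCat.mono_iff_injective _).1 inferInstance

lemma d_iCycles (i k : ℤ) (z : C.cycles i) : C.d i k (C.iCycles i z) = 0 := by
  rw [← ModuleCat.comp_apply]; simp

lemma homologyπ_surjective (i : ℤ) : Function.Surjective (C.homologyπ i) :=
  (ModuleCat.epi_iff_surjective _).1 inferInstance

lemma homologyπ_eq_zero_iff (i j : ℤ) (h : i + 1 = j) (z : C.cycles i) :
    C.homologyπ i z = 0 ↔ ∃ y, C.d j i y = C.iCycles i z := by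
  have e := ShortComplex.exact_of_g_is_cokernel
    (ShortComplex.mk (C.toCycles j i) (C.homologyπ i) (by simp))
    (C.homologyIsCokernel j i ((ComplexShape.down ℤ).prev_eq' h))
  constructor
  · intro hz
    obtain ⟨y, hy⟩ := (ShortComplex.moduleCat_exact_iff _).1 e z hz
    refine ⟨y, ?_⟩
    rw [← C.toCycles_i j i, ModuleCat.comp_apply]
    exact congrArg _ hy
  · rintro ⟨y, hy⟩
    have : C.toCycles j i y = z := iCycles_injective i (by
      rw [← hy, ← ModuleCat.comp_apply, C.toCycles_i])
    rw [← this, ← ModuleCat.comp_apply]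
    simp

lemma quasiIso_iff_injective_surjective (f : C ⟶ D) : QuasiIso f ↔
    (∀ (k i j : ℤ), k + 1 = i → i + 1 = j → ∀ (x : C.X i) (y : D.X j), C.d i k x = 0 →
      D.d j i y = f.f i x → ∃ x' : C.X j, C.d j i x' = x) ∧
    (∀ (k i j : ℤ), k + 1 = i → i + 1 = j → ∀ y : D.X i, D.d i k y = 0 →
      ∃ (x : C.X i) (y' : D.X j), C.d i k x = 0 ∧ f.f i x + D.d j i y' = y) := by
  have hn : ∀ i (z : C.cycles i), HomologicalComplex.homologyMap f i (C.homologyπ i z) =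
      D.homologyπ i (HomologicalComplex.cyclesMap f i z) := fun i z => by
    rw [← ModuleCat.comp_apply, HomologicalComplex.homologyπ_naturality, ModuleCat.comp_apply]
  have hc : ∀ i (z : C.cycles i), D.iCycles i (HomologicalComplex.cyclesMap f i z) =
      f.f i (C.iCycles i z) := fun i z => by
    rw [← ModuleCat.comp_apply, HomologicalComplex.cyclesMap_i, ModuleCat.comp_apply]
  constructor
  · intro hf
    have hb : ∀ i, Function.Bijective (HomologicalComplex.homologyMap f i) := fun i =>
      ConcreteCategory.bijective_of_isIso _
    refine ⟨fun k i j hk hj x y hx hy => ?_, fun k i j hk hj y hy => ?_⟩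
    · obtain ⟨z, rfl⟩ := exists_cycle i k hk x hx
      refine (homologyπ_eq_zero_iff i j hj z).1 ((hb i).1 ?_)
      rw [hn, map_zero]
      exact (homologyπ_eq_zero_iff i j hj _).2 ⟨y, by rw [hy, hc]⟩
    · obtain ⟨z, rfl⟩ := exists_cycle i k hk y hy
      obtain ⟨c, hc'⟩ := (hb i).2 (D.homologyπ i z)
      obtain ⟨w, rfl⟩ := homologyπ_surjective i c
      rw [hn, ← sub_eq_zero, ← map_sub, homologyπ_eq_zero_iff i j hj] at hc'
      obtain ⟨y', hy'⟩ := hc'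
      refine ⟨C.iCycles i w, -y', d_iCycles i k w, ?_⟩
      rw [map_neg, hy', map_sub, hc]
      abel
  · rintro ⟨h₁, h₂⟩
    refine ⟨fun i => (quasiIsoAt_iff_isIso_homologyMap f i).2 ?_⟩
    refine (ConcreteCategory.isIso_iff_bijective _).2 ⟨?_, fun c => ?_⟩
    · refine (injective_iff_map_eq_zero _).2 fun c hc' => ?_
      obtain ⟨z, rfl⟩ := homologyπ_surjective i c
      rw [hn, homologyπ_eq_zero_iff i (i + 1) rfl] at hc'
      obtain ⟨y, hy⟩ := hc'
      rw [hc] at hy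
      exact (homologyπ_eq_zero_iff i (i + 1) rfl z).2
        (h₁ (i - 1) i (i + 1) (by omega) rfl _ y (d_iCycles i _ z) hy)
    · obtain ⟨z, rfl⟩ := homologyπ_surjective i c
      obtain ⟨x, y', hx, hy⟩ := h₂ (i - 1) i (i + 1) (by omega) rfl _ (d_iCycles i _ z)
      obtain ⟨w, rfl⟩ := exists_cycle i (i - 1) (by omega) x hx
      refine ⟨C.homologyπ i w, ?_⟩
      rw [hn, ← sub_eq_zero, ← map_sub, homologyπ_eq_zero_iff i (i + 1) rfl]
      refine ⟨-y', ?_⟩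
      rw [map_sub, hc, ← hy, map_neg]
      abel

/-- A single condition carries both halves: the equation for `x'` is injectivity on homology, and
the case `x = 0` is surjectivity. Conversely, a first solution for `x` is corrected by a cycle to
satisfy the second equation. -/
lemma coneAcyclic_iff_quasiIso (f : C ⟶ D) : ConeAcyclic f ↔ QuasiIso f := by
  rw [quasiIso_iff_injective_surjective]
  constructor
  · intro h
    refine ⟨fun k i j hk hj x y hx hy => ?_, fun k i j hk hj y hy => ?_⟩
    · obtain ⟨x', -, hx', -⟩ := h k i j (j + 1) hk hj rfl x y hx hy
      exact ⟨x', hx'⟩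
    · obtain ⟨x', y', hx', hy'⟩ :=
        h (k - 1) k i j (by omega) hk hj 0 y (by simp) (by simpa using hy)
      exact ⟨x', y', hx', hy'⟩
  · rintro ⟨h₁, h₂⟩ k i j l hk hj hl x y hx hy
    obtain ⟨x', hx'⟩ := h₁ k i j hk hj x y hx hy
    obtain ⟨x'', y', h, h'⟩ := h₂ i j l hj hl (y - f.f j x') (by
      rw [map_sub, hy, ← hx', ← DGModule.hom_comm, sub_self])
    refine ⟨x' + x'', y', by rw [map_add, h, hx', add_zero], ?_⟩
    rw [map_add, add_assoc, h']
    abel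

/-- Chain maps which differ by a null-homotopic map are quasi-isomorphisms simultaneously. -/
lemma quasiIso_of_homotopy {f g : C ⟶ D} (s : ∀ i j : ℤ, i + 1 = j → (C.X i →ₗ[K] D.X j))
    (hs : ∀ (i i' j : ℤ) (hi : i' + 1 = i) (hj : i + 1 = j) (x : C.X i),
      f.f i x - g.f i x = D.d j i (s i j hj x) + s i' i hi (C.d i i' x)) (hf : QuasiIso f) :
    QuasiIso g := by
  rw [← coneAcyclic_iff_quasiIso] at hf ⊢
  intro k i j l hk hj hl x y hx hy
  have e := hs i k j hk hj x
  rw [hx, map_zero, add_zero, sub_eq_iff_eq_add] at e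
  -- A homotopy identifies the two cones by `(x, y) ↦ (x, y + s x)`.
  obtain ⟨x', y', hx', hy'⟩ := hf k i j l hk hj hl x (y + s i j hj x) hx (by
    rw [e, map_add, hy, add_comm])
  refine ⟨x', s j l hl x' + y', hx', ?_⟩
  have e' := hs j i l hj hl x'
  rw [hx'] at e'
  rw [map_add, eq_sub_of_add_eq e'.symm, ← sub_eq_zero, ← sub_eq_zero.2 hy']
  abel

/-- A chain map with one-sided inverses up to quasi-isomorphism is a quasi-isomorphism. -/
lemma quasiIso_of_quasiIso_comp {f : C ⟶ D} {g g' : D ⟶ C} (h : QuasiIso (f ≫ g))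
    (h' : QuasiIso (g' ≫ f)) : QuasiIso f := by
  refine ⟨fun i => (quasiIsoAt_iff_isIso_homologyMap f i).2 ?_⟩
  refine (ConcreteCategory.isIso_iff_bijective _).2 ⟨?_, ?_⟩
  · have : Function.Bijective (HomologicalComplex.homologyMap (f ≫ g) i) :=
      ConcreteCategory.bijective_of_isIso _
    rw [HomologicalComplex.homologyMap_comp] at this
    refine Function.Injective.of_comp (f := HomologicalComplex.homologyMap g i) ?_
    intro x y hxy
    exact this.1 hxy
  · have : Function.Bijective (HomologicalComplex.homologyMap (g' ≫ f) i) :=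
      ConcreteCategory.bijective_of_isIso _
    rw [HomologicalComplex.homologyMap_comp] at this
    intro y
    obtain ⟨x, hx⟩ := this.2 y
    exact ⟨HomologicalComplex.homologyMap g' i x, hx⟩

lemma isIso_of_bijective (f : C ⟶ D) (h : ∀ i, Function.Bijective (f.f i)) : IsIso f := by
  have : ∀ i, IsIso (f.f i) := fun i => (ConcreteCategory.isIso_iff_bijective _).2 (h i)
  exact HomologicalComplex.Hom.isIso_of_components f

lemma quasiIso_of_bijective (f : C ⟶ D) (h : ∀ i, Function.Bijective (f.f i)) : QuasiIso f := by
  have := isIso_of_bijective f h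
  infer_instance

end ElementwiseHomology

namespace DGModule

open ElementwiseHomology

variable {R : DGAlgebra K} {L M N P : DGModule R}

/-! ## Composition of homogeneous maps -/

namespace HomDeg

/-- The composite of homogeneous maps. -/
def comp {m n l : ℤ} (g : HomDeg N P m) (f : HomDeg M N n) (h : n + m = l) : HomDeg M P l :=
  HomDeg.mk (fun p q hq => g.app (p + n) q (by omega) ∘ₗ f.app p (p + n) rfl) (by
    intro i p p' q q' hp hq hq' r x
    simp only [LinearMap.comp_apply]
    rw [f.app_smul i p p' (p + n) (p' + n) hp rfl rfl, LinearMap.map_smul_of_tower,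
      g.app_smul i (p + n) (p' + n) q q' (by omega) (by omega) (by omega), smul_smul,
      ← Int.negOnePow_add, ← add_mul, h])

lemma comp_app {m n l : ℤ} (g : HomDeg N P m) (f : HomDeg M N n) (h : n + m = l) (p q s : ℤ)
    (hs : p + l = s) (hq : p + n = q) (x : M.cx.X p) :
    (g.comp f h).app p s hs x = g.app q s (by omega) (f.app p q hq x) := by
  subst hq
  rfl

lemma comp_assoc {a b c ab bc n : ℤ} (h : HomDeg N P c) (g : HomDeg M N b) (f : HomDeg L M a)
    (h₁ : a + b = ab) (h₂ : b + c = bc) (h₃ : ab + c = n) (h₄ : a + bc = n) :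
    h.comp (g.comp f h₁) h₃ = (h.comp g h₂).comp f h₄ :=
  HomDeg.ext fun p q hq x => by
    rw [comp_app _ _ _ _ (p + ab) _ _ rfl, comp_app _ _ _ _ (p + a) _ _ rfl,
      comp_app _ _ _ _ (p + a) _ _ rfl, comp_app _ _ _ _ (p + ab) _ _ (by omega)]

@[simp] lemma neg_app {n : ℤ} (f : HomDeg M N n) (p q : ℤ) (h : p + n = q) :
    (-f).app p q h = -f.app p q h := rfl

@[simp] lemma sub_app {n : ℤ} (f g : HomDeg M N n) (p q : ℤ) (h : p + n = q) :
    (f - g).app p q h = f.app p q h - g.app p q h := rfl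

lemma comp_add {m n l : ℤ} (g : HomDeg N P m) (f f' : HomDeg M N n) (h : n + m = l) :
    g.comp (f + f') h = g.comp f h + g.comp f' h :=
  HomDeg.ext fun p q hq x => by simp [comp_app _ _ _ _ (p + n) _ _ rfl]

lemma comp_sub {m n l : ℤ} (g : HomDeg N P m) (f f' : HomDeg M N n) (h : n + m = l) :
    g.comp (f - f') h = g.comp f h - g.comp f' h :=
  HomDeg.ext fun p q hq x => by simp [comp_app _ _ _ _ (p + n) _ _ rfl]

lemma add_comp {m n l : ℤ} (g g' : HomDeg N P m) (f : HomDeg M N n) (h : n + m = l) :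
    (g + g').comp f h = g.comp f h + g'.comp f h :=
  HomDeg.ext fun p q hq x => by simp [comp_app _ _ _ _ (p + n) _ _ rfl]

lemma neg_comp {m n l : ℤ} (g : HomDeg N P m) (f : HomDeg M N n)
    (h : n + m = l) : (-g).comp f h = -g.comp f h := rfl

lemma sub_comp {m n l : ℤ} (g g' : HomDeg N P m) (f : HomDeg M N n) (h : n + m = l) :
    (g - g').comp f h = g.comp f h - g'.comp f h :=
  HomDeg.ext fun p q hq x => by simp [comp_app _ _ _ _ (p + n) _ _ rfl]

lemma units_smul_comp {m n l : ℤ} (c : ℤˣ) (g : HomDeg N P m) (f : HomDeg M N n)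
    (h : n + m = l) : (c • g).comp f h = c • g.comp f h :=
  HomDeg.ext fun p q hq x => by simp [comp_app _ _ _ _ (p + n) _ _ rfl]

lemma comp_units_smul {m n l : ℤ} (c : ℤˣ) (g : HomDeg N P m) (f : HomDeg M N n)
    (h : n + m = l) : g.comp (c • f) h = c • g.comp f h :=
  HomDeg.ext fun p q hq x => by simp [comp_app _ _ _ _ (p + n) _ _ rfl]

@[simp] lemma zero_comp {m n l : ℤ} (f : HomDeg M N n) (h : n + m = l) :
    (0 : HomDeg N P m).comp f h = 0 := rfl

@[simp] lemma comp_zero {m n l : ℤ} (g : HomDeg N P m) (h : n + m = l) :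
    g.comp (0 : HomDeg M N n) h = 0 :=
  HomDeg.ext fun p q hq x => by simp [comp_app _ _ _ _ (p + n) _ _ rfl]

end HomDeg

/-! ## Homogeneous maps and morphisms -/

/-- The identification of two components of a complex in equal degrees. -/
def castDeg (C : ChainComplex (ModuleCat.{u} K) ℤ) {i j : ℤ} (h : i = j) : C.X i →ₗ[K] C.X j :=
  h ▸ LinearMap.id

@[simp] lemma castDeg_self (C : ChainComplex (ModuleCat.{u} K) ℤ) {i : ℤ} (h : i = i)
    (x : C.X i) : castDeg C h x = x := rfl

@[simp] lemma castDeg_castDeg (C : ChainComplex (ModuleCat.{u} K) ℤ) {i j k : ℤ} (h : i = j)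
    (h' : j = k) (x : C.X i) : castDeg C h' (castDeg C h x) = castDeg C (h.trans h') x := by
  subst h h'
  rfl

@[simp] lemma d_castDeg (C : ChainComplex (ModuleCat.{u} K) ℤ) {i j : ℤ} (h : i = j) (k : ℤ)
    (x : C.X i) : C.d j k (castDeg C h x) = C.d i k x := by
  subst h
  rfl

lemma castDeg_d (C : ChainComplex (ModuleCat.{u} K) ℤ) {i j : ℤ} (h : i = j) (k : ℤ)
    (x : C.X k) : castDeg C h (C.d k i x) = C.d k j x := by
  subst h
  rfl

@[simp] lemma smul_castDeg (M : DGModule R) {i j k k' : ℤ} (h : i = j) (hk : k + j = k')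
    (r : R.cx.X k) (x : M.cx.X i) :
    M.smul k j k' hk r (castDeg M.cx h x) = M.smul k i k' (by omega) r x := by
  subst h
  rfl

lemma castDeg_smul (M : DGModule R) {i j k k' : ℤ} (h : i = j) (hk : k + k' = i)
    (r : R.cx.X k) (x : M.cx.X k') :
    castDeg M.cx h (M.smul k k' i hk r x) = M.smul k k' j (by omega) r x := by
  subst h
  rfl

namespace HomDeg

/-- A morphism of DG modules as a homogeneous map of degree zero. -/
def ofHom (f : M ⟶ N) : HomDeg M N 0 :=
  HomDeg.mk (fun p q hq => castDeg N.cx (by omega) ∘ₗ (f.hom.f p).hom) (by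
    intro i p p' q q' hp hq hq' r x
    obtain rfl : p = q := by omega
    obtain rfl : p' = q' := by omega
    simpa using f.map_smul i p p' hp r x)

@[simp] lemma ofHom_app (f : M ⟶ N) (p : ℤ) (h : p + 0 = p) (x : M.cx.X p) :
    (ofHom f).app p p h x = f.hom.f p x := rfl

lemma ofHom_id_comp {n : ℤ} (f : HomDeg M N n) (h : n + 0 = n) : (ofHom (𝟙 N)).comp f h = f :=
  HomDeg.ext fun p q hq x => by rw [comp_app _ _ _ _ q _ _ hq]; simp

lemma comp_ofHom_id {n : ℤ} (f : HomDeg M N n) (h : 0 + n = n) : f.comp (ofHom (𝟙 M)) h = f :=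
  HomDeg.ext fun p q hq x => by rw [comp_app _ _ _ _ p _ _ (add_zero p)]; simp

lemma ofHom_comp (f : M ⟶ N) (g : N ⟶ P) :
    ofHom (f ≫ g) = (ofHom g).comp (ofHom f) (add_zero 0) :=
  HomDeg.ext fun p q hq x => by
    obtain rfl : p = q := by omega
    rw [comp_app _ _ _ _ p _ _ (add_zero p)]; simp

end HomDeg

open HomDeg

/-- The Leibniz rule for composition: the two terms in which `∂` stands between `g` and `f` cancel.
Most sign computations below go through it instead of through elements. -/
lemma homDiff_comp {m n l l' m' n' : ℤ} (g : HomDeg N P m) (f : HomDeg M N n) (h : n + m = l)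
    (hl : l' + 1 = l) (hm : m' + 1 = m) (hn : n' + 1 = n) :
    homDiff M P l l' hl (g.comp f h) = (homDiff N P m m' hm g).comp f (by omega) +
      m.negOnePow • g.comp (homDiff M N n n' hn f) (by omega) := by
  have e : l.negOnePow = m.negOnePow * n.negOnePow := by
    rw [← h, Int.negOnePow_add, mul_comm]
  refine HomDeg.ext fun p q hq x => ?_
  rw [homDiff_app M P l l' hl _ p (p - 1) (q + 1) q (by omega) (by omega) hq]
  rw [HomDeg.add_app, HomDeg.units_smul_app, LinearMap.add_apply, LinearMap.smul_apply]
  rw [comp_app _ _ _ p (p + n) _ _ rfl, comp_app _ _ _ (p - 1) (p - 1 + n) _ _ rfl,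
    comp_app _ _ _ p (p + n) _ _ rfl, comp_app _ _ _ p (p - 1 + n) _ _ (by omega),
    homDiff_app N P m m' hm _ (p + n) (p - 1 + n) (q + 1) q (by omega) (by omega),
    homDiff_app M N n n' hn _ p (p - 1) (p + n) (p - 1 + n) (by omega) rfl, map_sub,
    LinearMap.map_smul_of_tower, smul_sub, smul_smul, e]
  abel

lemma homDiff_ofHom (f : M ⟶ N) (n' : ℤ) (h : n' + 1 = 0) : homDiff M N 0 n' h (ofHom f) = 0 := by
  refine HomDeg.ext fun p q hq x => ?_
  rw [homDiff_app M N 0 n' h _ p q p q (by omega) (by omega) hq, ofHom_app, ofHom_app, hom_comm]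
  simp

/-- A cycle of degree zero in `Hom(M, N)` as a morphism. -/
def toHom (f : HomDeg M N 0) (hf : homDiff M N 0 (-1) (by omega) f = 0) : M ⟶ N where
  hom :=
    { f := fun p => ModuleCat.ofHom (f.app p p (add_zero p))
      comm' := fun i j hij => by
        have hij : j + 1 = i := hij
        ext x
        have := congrArg (fun t => t.app i j (by omega) x) hf
        rw [homDiff_app M N 0 (-1) (by omega) f i j i j (by omega) (by omega)] at this
        simpa [sub_eq_zero] using this }
  map_smul i j k h r x := by
    refine (f.app_smul i j k j k h (by omega) (by omega) r x).trans ?_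
    simp

@[simp] lemma ofHom_toHom (f : HomDeg M N 0) (hf) : ofHom (toHom f hf) = f :=
  HomDeg.ext fun p q hq x => by
    obtain rfl : p = q := by omega
    rfl

lemma toHom_app (f : HomDeg M N 0) (hf) (p : ℤ) (x : M.cx.X p) :
    (toHom f hf).hom.f p x = f.app p p (add_zero p) x := rfl

/-- On degree one the differential of the Hom complex is `∂s + s∂`, so homotopies are exactly the
elements of degree one with prescribed boundary. -/
lemma homotopic_iff (f g : M ⟶ N) :
    Homotopic f g ↔ ∃ s : HomDeg M N 1, homDiff M N 1 0 (by omega) s = ofHom f - ofHom g := by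
  constructor
  · rintro ⟨s, hs, h⟩
    refine ⟨HomDeg.mk s (fun i p p' q q' hp hq hq' r x => ?_), ?_⟩
    · rw [one_mul]
      exact hs i p p' q' q hp hq hq' r x
    · refine HomDeg.ext fun p q hq x => ?_
      obtain rfl : p = q := by omega
      rw [homDiff_app M N 1 0 _ _ p (p - 1) (p + 1) p (by omega) rfl]
      simpa using (h p (p - 1) (p + 1) (by omega) rfl x).symm
  · rintro ⟨s, hs⟩
    refine ⟨fun i j hij => s.app i j hij, fun i j k k' j' hk hj' hk' r x => ?_,
      fun i i' j hi hj x => ?_⟩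
    · simpa using s.app_smul i j k j' k' hk hj' hk' r x
    · have := congrArg (fun t => t.app i i (add_zero i) x) hs
      rw [homDiff_app M N 1 0 _ _ i i' j i (by omega) hj] at this
      simpa using this.symm

/-- A quotient category identifies morphisms along the congruence generated by a relation; since
homotopy is one already, equality in `𝒦(R)` means homotopy. -/
instance : Congruence (homotopyRel R) where
  equivalence :=
    { refl := fun f => (homotopic_iff f f).2 ⟨0, by simp⟩
      symm := fun {f g} h => by
        obtain ⟨s, hs⟩ := (homotopic_iff f g).1 h
        exact (homotopic_iff g f).2 ⟨-s, by rw [map_neg, hs, neg_sub]⟩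
      trans := fun {f g h} a b => by
        obtain ⟨s, hs⟩ := (homotopic_iff f g).1 a
        obtain ⟨t, ht⟩ := (homotopic_iff g h).1 b
        exact (homotopic_iff f h).2 ⟨s + t, by rw [map_add, hs, ht, sub_add_sub_cancel]⟩ }
  comp_left f g g' h := by
    obtain ⟨s, hs⟩ := (homotopic_iff g g').1 h
    refine (homotopic_iff _ _).2 ⟨s.comp (ofHom f) (by omega), ?_⟩
    rw [homDiff_comp (m' := 0) (n' := -1) s (ofHom f) (by omega) (by omega) (by omega) (by omega),
      homDiff_ofHom, hs, ofHom_comp, ofHom_comp, sub_comp]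
    simp
  comp_right {_ _ _ f f'} g h := by
    obtain ⟨s, hs⟩ := (homotopic_iff f f').1 h
    refine (homotopic_iff _ _).2 ⟨(ofHom g).comp s (by omega), ?_⟩
    rw [homDiff_comp (m' := -1) (n' := 0) (ofHom g) s (by omega) (by omega) (by omega) (by omega),
      homDiff_ofHom, hs, ofHom_comp, ofHom_comp, comp_sub]
    simp

lemma toHo_map_eq_iff (f g : M ⟶ N) : (toHo R).map f = (toHo R).map g ↔ Homotopic f g :=
  CategoryTheory.Quotient.functor_map_eq_iff (homotopyRel R) f g

lemma Homotopic.symm {f g : M ⟶ N} (h : Homotopic f g) : Homotopic g f := by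
  rw [← toHo_map_eq_iff] at h ⊢
  exact h.symm

lemma Homotopic.comp_left (f : L ⟶ M) {g g' : M ⟶ N} (h : Homotopic g g') :
    Homotopic (f ≫ g) (f ≫ g') :=
  HomRel.IsStableUnderPrecomp.comp_left (r := homotopyRel R) f h

lemma Homotopic.comp_right {f f' : L ⟶ M} (h : Homotopic f f') (g : M ⟶ N) :
    Homotopic (f ≫ g) (f' ≫ g) :=
  HomRel.IsStableUnderPostcomp.comp_right (r := homotopyRel R) g h

lemma Homotopic.isQuasiIso {f g : M ⟶ N} (h : Homotopic f g) (hf : IsQuasiIso f) :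
    IsQuasiIso g := by
  obtain ⟨s, -, hs⟩ := h
  exact quasiIso_of_homotopy s hs hf

/-! ## K-projective and K-injective modules elementwise -/

lemma homPost_apply (M : DGModule R) (g : N ⟶ P) {n : ℤ} (f : HomDeg M N n) :
    (homPost M g).f n f = (ofHom g).comp f (add_zero n) :=
  HomDeg.ext fun p q hq x => by rw [comp_app _ _ _ _ q _ _ hq]; rfl

lemma homPre_apply (g : M ⟶ N) (P : DGModule R) {n : ℤ} (f : HomDeg N P n) :
    (homPre g P).f n f = f.comp (ofHom g) (zero_add n) :=
  HomDeg.ext fun p q hq x => by rw [comp_app _ _ _ _ p _ _ (add_zero p)]; rfl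

lemma homCx_d_apply {n n' : ℤ} (h : n' + 1 = n) (f : HomDeg M N n) :
    (homCx M N).d n n' f = homDiff M N n n' h f := by
  rw [homCx_d M N n n' h]
  rfl

/-- The cone criterion in terms of homogeneous maps. Every proof of K-projectivity by direct
construction below solves these two equations for `α'` and `β'`. -/
lemma quasiIso_homPost_iff (M : DGModule R) (g : N ⟶ P) : QuasiIso (homPost M g) ↔
    ∀ (k i j l : ℤ) (hk : k + 1 = i) (hj : i + 1 = j) (hl : j + 1 = l) (α : HomDeg M N i)
      (β : HomDeg M P j), homDiff M N i k hk α = 0 →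
      homDiff M P j i hj β = (ofHom g).comp α (add_zero i) →
      ∃ (α' : HomDeg M N j) (β' : HomDeg M P l), homDiff M N j i hj α' = α ∧
        (ofHom g).comp α' (add_zero j) + homDiff M P l j hl β' = β := by
  rw [← coneAcyclic_iff_quasiIso]
  refine forall₄_congr fun k i j l => forall₃_congr fun hk hj hl => forall₂_congr fun α β => ?_
  rw [homCx_d_apply hk, homCx_d_apply hj, homPost_apply]
  refine forall₂_congr fun _ _ => exists₂_congr fun α' β' => ?_
  rw [homCx_d_apply hl, homCx_d_apply hj, homPost_apply]

lemma quasiIso_homPre_iff (g : M ⟶ N) (P : DGModule R) : QuasiIso (homPre g P) ↔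
    ∀ (k i j l : ℤ) (hk : k + 1 = i) (hj : i + 1 = j) (hl : j + 1 = l) (α : HomDeg N P i)
      (β : HomDeg M P j), homDiff N P i k hk α = 0 →
      homDiff M P j i hj β = α.comp (ofHom g) (zero_add i) →
      ∃ (α' : HomDeg N P j) (β' : HomDeg M P l), homDiff N P j i hj α' = α ∧
        α'.comp (ofHom g) (zero_add j) + homDiff M P l j hl β' = β := by
  rw [← coneAcyclic_iff_quasiIso]
  refine forall₄_congr fun k i j l => forall₃_congr fun hk hj hl => forall₂_congr fun α β => ?_
  rw [homCx_d_apply hk, homCx_d_apply hj, homPre_apply]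
  refine forall₂_congr fun _ _ => exists₂_congr fun α' β' => ?_
  rw [homCx_d_apply hl, homCx_d_apply hj, homPre_apply]

/-- Morphisms out of a K-projective module lift along quasi-isomorphisms, up to homotopy. -/
lemma IsKProjective.exists_lift {P : DGModule R} (hP : IsKProjective P) {g : M ⟶ N}
    (hg : IsQuasiIso g) (f : P ⟶ N) : ∃ f' : P ⟶ M, Homotopic (f' ≫ g) f := by
  -- The criterion with `α = 0` and `β = f` in degree zero: `α'` is then a cycle of degree zero,
  -- hence a morphism, and `-β'` is the homotopy.
  obtain ⟨α', β', h, h'⟩ := (quasiIso_homPost_iff P g).1 (hP g hg) (-2) (-1) 0 1 (by omega)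
    (by omega) (by omega) 0 (ofHom f) (by simp) (by rw [homDiff_ofHom]; simp)
  refine ⟨toHom α' h, (homotopic_iff _ _).2 ⟨-β', ?_⟩⟩
  rw [ofHom_comp, ofHom_toHom, map_neg, ← h']
  abel

/-- Injectivity on homology: `f - f'` is a cycle of degree zero which bounds after composition with
`g`, so it bounds. -/
lemma IsKProjective.homotopic_of_comp {P : DGModule R} (hP : IsKProjective P) {g : M ⟶ N}
    (hg : IsQuasiIso g) {f f' : P ⟶ M} (h : Homotopic (f ≫ g) (f' ≫ g)) : Homotopic f f' := by
  obtain ⟨s, hs⟩ := (homotopic_iff _ _).1 h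
  obtain ⟨α', β', h, -⟩ := (quasiIso_homPost_iff P g).1 (hP g hg) (-1) 0 1 2 (by omega)
    (by omega) (by omega) (ofHom f - ofHom f') s (by simp [homDiff_ofHom])
    (by rw [hs, ofHom_comp, ofHom_comp, comp_sub])
  exact (homotopic_iff _ _).2 ⟨α', h⟩

/-- A morphism which is invertible up to homotopy. -/
def IsHomotopyEquiv (f : M ⟶ N) : Prop :=
  ∃ g : N ⟶ M, Homotopic (f ≫ g) (𝟙 M) ∧ Homotopic (g ≫ f) (𝟙 N)

/-- Whitehead's argument: lifting the identity of `N` gives `g` with `g ≫ f` homotopic to the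
identity; then `f ≫ g` and the identity of `M` agree after `f`, hence up to homotopy. -/
lemma isHomotopyEquiv_of_isQuasiIso (hM : IsKProjective M) (hN : IsKProjective N) {f : M ⟶ N}
    (hf : IsQuasiIso f) : IsHomotopyEquiv f := by
  obtain ⟨g, hg⟩ := hN.exists_lift hf (𝟙 N)
  refine ⟨g, hM.homotopic_of_comp hf ?_, hg⟩
  simpa using hg.comp_left f

/-- Since `1 - e` is the boundary of `s`, precomposition with `e` differs from the identity by the
homotopy `α ↦ ± α s`. The solutions below are built from it. -/
lemma quasiIso_homPre_of_homotopic_id {e : M ⟶ M} (h : Homotopic (𝟙 M) e) (N : DGModule R) :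
    QuasiIso (homPre e N) := by
  obtain ⟨s, hs⟩ := (homotopic_iff _ _).1 h
  rw [quasiIso_homPre_iff]
  intro k i j l hk hj hl α β hα hβ
  have e₁ := homDiff_comp (m' := k) (n' := 0) α s (by omega) hj hk (by omega)
  have h₁ : homDiff M N j i hj (β + i.negOnePow • α.comp s (by omega)) = α := by
    rw [map_add, LinearMap.map_smul_of_tower, hβ, e₁, hα, hs, zero_comp, zero_add, smul_smul,
      Int.units_mul_self, _root_.one_smul, comp_sub, comp_ofHom_id]
    abel
  have he : j.negOnePow = -i.negOnePow := by rw [← hj, Int.negOnePow_succ]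
  refine ⟨β + i.negOnePow • α.comp s (by omega),
    j.negOnePow • (β + i.negOnePow • α.comp s (by omega)).comp s (by omega), h₁, ?_⟩
  have e₂ := homDiff_comp (m' := i) (n' := 0) (β + i.negOnePow • α.comp s (by omega)) s
    (by omega) hl hj (by omega)
  rw [LinearMap.map_smul_of_tower, e₂, h₁, hs, smul_add, smul_smul, Int.units_mul_self,
    _root_.one_smul,
    comp_sub, comp_ofHom_id, he, Units.neg_smul]
  abel

lemma IsHomotopyEquiv.quasiIso_homPre {f : M ⟶ N} (hf : IsHomotopyEquiv f) (P : DGModule R) :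
    QuasiIso (homPre f P) := by
  obtain ⟨g, h, h'⟩ := hf
  have e := quasiIso_homPre_of_homotopic_id h.symm P
  have e' := quasiIso_homPre_of_homotopic_id h'.symm P
  have c : ∀ {A B C : DGModule R} (a : A ⟶ B) (b : B ⟶ C),
      homPre (a ≫ b) P = homPre b P ≫ homPre a P := fun a b => rfl
  rw [c] at e e'
  exact quasiIso_of_quasiIso_comp e' e

lemma IsHomotopyEquiv.isQuasiIso {f : M ⟶ N} (hf : IsHomotopyEquiv f) : IsQuasiIso f := by
  obtain ⟨g, h, h'⟩ := hf
  have e : IsQuasiIso (f ≫ g) := h.symm.isQuasiIso (inferInstanceAs (QuasiIso (𝟙 M.cx)))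
  have e' : IsQuasiIso (g ≫ f) := h'.symm.isQuasiIso (inferInstanceAs (QuasiIso (𝟙 N.cx)))
  exact quasiIso_of_quasiIso_comp e e'

/-- A morphism is a homotopy equivalence if precomposition with it is a quasi-isomorphism. -/
lemma isHomotopyEquiv_of_quasiIso_homPre {f : M ⟶ N} (h : ∀ P, QuasiIso (homPre f P)) :
    IsHomotopyEquiv f := by
  -- With `M` as target, surjectivity on homology hits the identity of `M` and produces a one-sided
  -- inverse up to homotopy.
  obtain ⟨α', β', h₁, h₂⟩ := (quasiIso_homPre_iff f M).1 (h M) (-2) (-1) 0 1 (by omega)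
    (by omega) (by omega) 0 (ofHom (𝟙 M)) (by simp) (by rw [homDiff_ofHom]; simp)
  have hg : Homotopic (f ≫ toHom α' h₁) (𝟙 M) := by
    refine (homotopic_iff _ _).2 ⟨-β', ?_⟩
    rw [ofHom_comp, ofHom_toHom, map_neg, ← h₂]
    abel
  refine ⟨toHom α' h₁, hg, ?_⟩
  have hg' : Homotopic (f ≫ toHom α' h₁ ≫ f) (f ≫ 𝟙 N) := by
    simpa using hg.comp_right f
  obtain ⟨s, hs⟩ := (homotopic_iff _ _).1 hg'
  -- With `N` as target, injectivity on homology cancels `f` on the left of the homotopy `hg'`.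
  obtain ⟨γ, -, h₃, -⟩ := (quasiIso_homPre_iff f N).1 (h N) (-1) 0 1 2 (by omega)
    (by omega) (by omega) (ofHom (toHom α' h₁ ≫ f) - ofHom (𝟙 N)) s (by simp [homDiff_ofHom])
    (by rw [hs, ofHom_comp f, ofHom_comp f, sub_comp])
  exact (homotopic_iff _ _).2 ⟨γ, h₃⟩

end DGModule

/-! ### Free modules, and the adjoints of restriction of scalars on complexes -/

namespace DGModule

open ElementwiseHomology HomDeg

variable {R S : DGAlgebra K}

/-- The Leibniz rule for `1 · 1` reads `∂1 = ∂1 + ∂1`. -/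
lemma _root_.DGAlgebra.d_one (R : DGAlgebra K) (k : ℤ) : R.cx.d 0 k R.one = 0 := by
  by_cases hk : k + 1 = 0
  · have := R.leibniz 0 0 0 k k k hk hk hk (add_zero 0) R.one R.one
    rw [R.one_mul, R.mul_one, R.one_mul, Int.negOnePow_zero, _root_.one_smul] at this
    simpa using this
  · rw [R.cx.shape 0 k hk]
    rfl

/-! ## Homogeneous maps out of the free module of rank one -/

/-- The homogeneous map `R → N` which sends `1` to a given element. -/
def ofElem {N : DGModule R} {n : ℤ} (y : N.cx.X n) : HomDeg R.leftSelf N n :=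
  HomDeg.mk (fun p q hq => (n * p).negOnePow • (N.smul p n q hq).flip y) (by
    intro i p p' q q' hp hq hq' r (x : R.cx.X p)
    change (n * p').negOnePow • N.smul p' n q' hq' (R.mul i p p' hp r x) y =
      (n * i).negOnePow • N.smul i q q' _ r ((n * p).negOnePow • N.smul p n q hq x y)
    rw [N.mul_smul i p n p' q q' hp hq hq' (by omega), LinearMap.map_smul_of_tower, smul_smul,
      ← Int.negOnePow_add, ← mul_add, hp])

lemma ofElem_app {N : DGModule R} {n : ℤ} (y : N.cx.X n) (p q : ℤ) (hq : p + n = q)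
    (x : R.cx.X p) :
    (ofElem y).app p q hq x = (n * p).negOnePow • N.smul p n q hq x y := rfl

lemma ofElem_app_one {N : DGModule R} {n : ℤ} (y : N.cx.X n) :
    (ofElem y).app 0 n (zero_add n) R.one = y := by
  rw [ofElem_app, N.one_smul]
  simp

lemma ofElem_ext {N : DGModule R} {n : ℤ} {f g : HomDeg R.leftSelf N n}
    (h : f.app 0 n (zero_add n) R.one = g.app 0 n (zero_add n) R.one) : f = g := by
  refine HomDeg.ext fun p q hq (x : R.cx.X p) => ?_
  have e : ∀ f : HomDeg R.leftSelf N n, f.app p q hq x =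
      (n * p).negOnePow • N.smul p n q (by omega) x (f.app 0 n (zero_add n) R.one) := fun f => by
    rw [← f.app_smul p 0 p n q (add_zero p) (zero_add n) hq x R.one]
    exact congrArg _ (R.mul_one p x).symm
  rw [e, e g, h]

lemma homDiff_app_one {N : DGModule R} {n n' : ℤ} (hn : n' + 1 = n) (f : HomDeg R.leftSelf N n) :
    (homDiff _ N n n' hn f).app 0 n' (zero_add n') R.one =
      N.cx.d n n' (f.app 0 n (zero_add n) R.one) := by
  rw [homDiff_app _ N n n' hn f 0 (-1) n n' (by omega) (by omega) (by omega)]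
  have e : R.leftSelf.cx.d 0 (-1) R.one = 0 := R.d_one (-1)
  rw [e]
  simp

lemma homDiff_ofElem {N : DGModule R} {n n' : ℤ} (hn : n' + 1 = n) (y : N.cx.X n) :
    homDiff _ N n n' hn (ofElem y) = ofElem (N.cx.d n n' y) :=
  ofElem_ext (by rw [homDiff_app_one, ofElem_app_one, ofElem_app_one])

/-- Evaluation at `1`, as a morphism `Hom_R(R, N) → N`. -/
def evalOne (N : DGModule R) : homCx R.leftSelf N ⟶ N.cx where
  f n := ModuleCat.ofHom
    { toFun := fun f : HomDeg R.leftSelf N n => f.app 0 n (zero_add n) R.one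
      map_add' := fun f g => rfl
      map_smul' := fun c f => rfl }
  comm' n n' hn := by
    have hn : n' + 1 = n := hn
    rw [homCx_d _ _ n n' hn]
    ext f
    exact (homDiff_app_one hn f).symm

lemma evalOne_bijective (N : DGModule R) (n : ℤ) : Function.Bijective ((evalOne N).f n) :=
  ⟨fun _ _ h => ofElem_ext h, fun y => ⟨ofElem y, ofElem_app_one y⟩⟩

instance (N : DGModule R) : QuasiIso (evalOne N) :=
  quasiIso_of_bijective _ (evalOne_bijective N)

variable (R) in
-- Evaluation at `1` identifies `Hom_R(R, -)` with the underlying complex, naturally in the module.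
lemma isKProjective_leftSelf : IsKProjective R.leftSelf := by
  intro M N f hf
  have h : QuasiIso f.hom := hf
  have e : homPost R.leftSelf f ≫ evalOne N = evalOne M ≫ f.hom := rfl
  have h₁ : QuasiIso (homPost R.leftSelf f ≫ evalOne N) := by rw [e]; infer_instance
  exact quasiIso_of_comp_right _ (evalOne N)

/-! ## Extension of scalars -/

lemma diff_one_tmul (φ : R.Hom S) (P : DGModule R) (n n' : ℤ) (hn : n' + 1 = n) (y : P.cx.X n) :
    DGTensor.diff (S.rightSelf.restrict φ) P n n' hn
        (DGTensor.tmul (S.rightSelf.restrict φ) P 0 n n (zero_add n) S.one y) =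
      DGTensor.tmul (S.rightSelf.restrict φ) P 0 n' n' (zero_add n') S.one (P.cx.d n n' y) := by
  rw [DGTensor.diff_tmul _ _ n n' hn 0 n (-1) n' (by omega) hn]
  have e : (S.rightSelf.restrict φ).cx.d 0 (-1) S.one = 0 := S.d_one (-1)
  rw [e, map_zero, LinearMap.zero_apply, zero_add, Int.negOnePow_zero, _root_.one_smul]

lemma extendSMul_one_tmul (φ : R.Hom S) (P : DGModule R) (i j k : ℤ) (h : i + j = k)
    (s : S.cx.X i) (y : P.cx.X j) :
    extendSMul φ P i j k h s
        (DGTensor.tmul (S.rightSelf.restrict φ) P 0 j j (zero_add j) S.one y) =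
      DGTensor.tmul (S.rightSelf.restrict φ) P i j k h s y :=
  (extendSMul_tmul φ P i j k h s 0 j i (zero_add j) (add_zero i) S.one y).trans
    (congrArg (fun z => DGTensor.tmul (S.rightSelf.restrict φ) P i j k h z y) (S.mul_one i s))

lemma one_tmul_smul (φ : R.Hom S) (P : DGModule R) (i j k : ℤ) (h : i + j = k)
    (r : R.cx.X i) (y : P.cx.X j) :
    DGTensor.tmul (S.rightSelf.restrict φ) P 0 k k (zero_add k) S.one (P.smul i j k h r y) =
      extendSMul φ P i j k h (φ.hom.f i r)
        (DGTensor.tmul (S.rightSelf.restrict φ) P 0 j j (zero_add j) S.one y) := by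
  rw [extendSMul_one_tmul]
  refine (DGTensor.tmul_smul (S.rightSelf.restrict φ) P k 0 i j i k (by omega) h h
      (by omega) S.one r y).symm.trans ?_
  exact congrArg (fun z => DGTensor.tmul (S.rightSelf.restrict φ) P i j k h z y) (S.one_mul i _)

/-- The morphism `P → S ⊗_R P`, `y ↦ 1 ⊗ y`. -/
def unitExtend (φ : R.Hom S) (P : DGModule R) : P ⟶ restrict φ (extend φ P) where
  hom :=
    { f := fun n => ModuleCat.ofHom
        (DGTensor.tmul (S.rightSelf.restrict φ) P 0 n n (zero_add n) S.one)
      comm' := fun n n' hn => by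
        have hn : n' + 1 = n := hn
        change _ ≫ (DGTensor.cx (S.rightSelf.restrict φ) P).d n n' = _
        rw [DGTensor.cx_d _ _ n n' hn]
        refine ModuleCat.hom_ext (LinearMap.ext fun y => ?_)
        exact diff_one_tmul φ P n n' hn y }
  map_smul i j k h r y := one_tmul_smul φ P i j k h r y

lemma fromExtend_tmul (φ : R.Hom S) {P : DGModule R} (M : DGModule S) (π : P ⟶ restrict φ M)
    (i j n : ℤ) (h : i + j = n) (s : S.cx.X i) (y : P.cx.X j) :
    (fromExtend φ M π).hom.f n (DGTensor.tmul (S.rightSelf.restrict φ) P i j n h s y) =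
      M.smul i j n h s (π.hom.f j y) :=
  DGTensor.lift_tmul (M := S.rightSelf.restrict φ) (N := P) _
    (fromExtend_balanced φ M π n) i j h s y

lemma unitExtend_fromExtend (φ : R.Hom S) {P : DGModule R} (M : DGModule S)
    (π : P ⟶ restrict φ M) :
    unitExtend φ P ≫ (restrictFunctor φ).map (fromExtend φ M π) = π := by
  refine DGModule.hom_ext _ _ (HomologicalComplex.hom_ext _ _ fun n =>
    ModuleCat.hom_ext (LinearMap.ext fun y => ?_))
  exact (fromExtend_tmul φ M π 0 n n (zero_add n) S.one y).trans (M.one_smul n (π.hom.f n y))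

/-- The map `Hom_S(S ⊗_R P, N) → Hom_R(P, N)`. -/
def extendAdj (φ : R.Hom S) (P : DGModule R) (N : DGModule S) :
    homCx (extend φ P) N ⟶ homCx P (restrict φ N) :=
  homRestrict φ (extend φ P) N ≫ homPre (unitExtend φ P) (restrict φ N)

lemma extend_balanced (φ : R.Hom S) (P : DGModule R) (N : DGModule S) {n : ℤ}
    (g : HomDeg P (restrict φ N) n) (p q : ℤ) (hq : p + n = q)
    (i j k ij jk : ℤ) (h₁ : i + j = ij) (h₂ : j + k = jk) (h₃ : ij + k = p) (_ : i + jk = p)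
    (x : S.cx.X i) (r : R.cx.X j) (y : P.cx.X k) :
    ((n * ij).negOnePow • (N.smul ij (k + n) q (by omega)).compl₂ (g.app k (k + n) rfl))
        (S.mul i j ij h₁ x (φ.hom.f j r)) y =
      ((n * i).negOnePow • (N.smul i (jk + n) q (by omega)).compl₂ (g.app jk (jk + n) rfl))
        x (P.smul j k jk h₂ r y) := by
  simp only [LinearMap.smul_apply, LinearMap.compl₂_apply]
  rw [g.app_smul j k jk (k + n) (jk + n) h₂ rfl rfl, LinearMap.map_smul_of_tower, smul_smul,
    ← Int.negOnePow_add, ← mul_add, h₁]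
  congr 1
  exact N.mul_smul i j (k + n) ij (jk + n) q h₁ (by omega) (by omega) (by omega) x (φ.hom.f j r) _

/-- The components of the homogeneous map `S ⊗_R P → N` extending a homogeneous map `P → N`. -/
def extendLift (φ : R.Hom S) (P : DGModule R) (N : DGModule S) {n : ℤ}
    (g : HomDeg P (restrict φ N) n) (p q : ℤ) (hq : p + n = q) :
    DGTensor.Deg (S.rightSelf.restrict φ) P p →ₗ[K] N.cx.X q :=
  DGTensor.lift (M := S.rightSelf.restrict φ) (N := P) (fun i j hij =>
      (n * i).negOnePow • (N.smul i (j + n) q (by omega)).compl₂ (g.app j (j + n) rfl))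
      (extend_balanced φ P N g p q hq)

lemma extendLift_tmul (φ : R.Hom S) (P : DGModule R) (N : DGModule S) {n : ℤ}
    (g : HomDeg P (restrict φ N) n) (p q : ℤ) (hq : p + n = q) (i j j' : ℤ) (hij : i + j = p)
    (hj : j + n = j') (s : S.cx.X i) (y : P.cx.X j) :
    extendLift φ P N g p q hq (DGTensor.tmul (S.rightSelf.restrict φ) P i j p hij s y) =
      (n * i).negOnePow • N.smul i j' q (by omega) s (g.app j j' hj y) := by
  subst hj
  exact DGTensor.lift_tmul (M := S.rightSelf.restrict φ) (N := P) _
    (extend_balanced φ P N g p q hq) i j hij s y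

lemma extendLift_smul (φ : R.Hom S) (P : DGModule R) (N : DGModule S) {n : ℤ}
    (g : HomDeg P (restrict φ N) n) (i p p' q q' : ℤ) (hp : i + p = p') (hq : p + n = q)
    (hq' : p' + n = q') (s : S.cx.X i) :
    extendLift φ P N g p' q' hq' ∘ₗ extendSMul φ P i p p' hp s =
      (n * i).negOnePow • (N.smul i q q' (by omega) s ∘ₗ extendLift φ P N g p q hq) := by
  refine DGTensor.lin_ext fun a b hab t y => ?_
  rw [LinearMap.comp_apply, LinearMap.smul_apply, LinearMap.comp_apply,
    extendSMul_tmul φ P i p p' hp s a b (i + a) hab rfl,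
    extendLift_tmul φ P N g p q hq a b (b + n) hab rfl]
  refine (extendLift_tmul φ P N g p' q' hq' (i + a) b (b + n) (by omega) rfl _ y).trans ?_
  rw [LinearMap.map_smul_of_tower, smul_smul, ← Int.negOnePow_add, ← mul_add]
  congr 1
  exact N.mul_smul i a (b + n) (i + a) q q' rfl (by omega) (by omega) (by omega) s t _

/-- The homogeneous map `S ⊗_R P → N` extending a homogeneous map `P → N`. -/
def extendHom (φ : R.Hom S) (P : DGModule R) (N : DGModule S) {n : ℤ}
    (g : HomDeg P (restrict φ N) n) : HomDeg (extend φ P) N n :=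
  HomDeg.mk (extendLift φ P N g) (fun i p p' q q' hp hq hq' s z =>
    LinearMap.congr_fun (extendLift_smul φ P N g i p p' q q' hp hq hq' s) z)

lemma extend_app_tmul (φ : R.Hom S) (P : DGModule R) (N : DGModule S) {n : ℤ}
    (f : HomDeg (extend φ P) N n) (p q i j j' : ℤ) (hq : p + n = q) (hij : i + j = p)
    (hj : j + n = j') (s : S.cx.X i) (y : P.cx.X j) :
    f.app p q hq (DGTensor.tmul (S.rightSelf.restrict φ) P i j p hij s y) =
      (n * i).negOnePow • N.smul i j' q (by omega) s (f.app j j' hj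
        (DGTensor.tmul (S.rightSelf.restrict φ) P 0 j j (zero_add j) S.one y)) := by
  have e := extendSMul_one_tmul φ P i j p hij s y
  rw [← e]
  exact f.app_smul i j p j' q hij hj hq s
    (DGTensor.tmul (S.rightSelf.restrict φ) P 0 j j (zero_add j) S.one y)

/-- The elements `1 ⊗ y` generate `S ⊗_R P` over `S`. -/
lemma extend_hom_ext (φ : R.Hom S) (P : DGModule R) (N : DGModule S) {n : ℤ}
    {f g : HomDeg (extend φ P) N n}
    (h : ∀ (p q : ℤ) (hq : p + n = q) (y : P.cx.X p),
      f.app p q hq (DGTensor.tmul (S.rightSelf.restrict φ) P 0 p p (zero_add p) S.one y) =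
      g.app p q hq (DGTensor.tmul (S.rightSelf.restrict φ) P 0 p p (zero_add p) S.one y)) :
    f = g := by
  have e : ∀ p q hq, f.app p q hq = g.app p q hq := fun p q hq =>
    DGTensor.lin_ext (M := S.rightSelf.restrict φ) (N := P) fun i j hij s y => by
      rw [extend_app_tmul φ P N f p q i j (j + n) hq hij rfl,
        extend_app_tmul φ P N g p q i j (j + n) hq hij rfl, h]
  exact HomDeg.ext fun p q hq z => LinearMap.congr_fun (e p q hq) z

/-- The adjunction of extension and restriction, on complexes and in every degree: the inverse sends
`g` to `s ⊗ y ↦ (-1)^(n|s|) s g(y)`. -/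
lemma extendAdj_bijective (φ : R.Hom S) (P : DGModule R) (N : DGModule S) (n : ℤ) :
    Function.Bijective ((extendAdj φ P N).f n) := by
  constructor
  · intro (f : HomDeg (extend φ P) N n) (g : HomDeg (extend φ P) N n) h
    refine extend_hom_ext φ P N fun p q hq y => ?_
    exact LinearMap.congr_fun (congrArg (fun t : HomDeg P (restrict φ N) n => t.app p q hq) h) y
  · intro (g : HomDeg P (restrict φ N) n)
    refine ⟨extendHom φ P N g, HomDeg.ext fun p q hq y => ?_⟩
    refine (extendLift_tmul φ P N g p q hq 0 p q (zero_add p) hq S.one y).trans ?_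
    rw [N.one_smul]
    simp

instance (φ : R.Hom S) (P : DGModule R) (N : DGModule S) : QuasiIso (extendAdj φ P N) :=
  quasiIso_of_bijective _ (extendAdj_bijective φ P N)

/-- Extension is left adjoint to restriction, and restriction preserves quasi-isomorphisms. -/
lemma isKProjective_extend (φ : R.Hom S) {P : DGModule R} (hP : IsKProjective P) :
    IsKProjective (extend φ P) := by
  intro M N f hf
  have h : QuasiIso (homPost P ((restrictFunctor φ).map f)) := hP ((restrictFunctor φ).map f) hf
  have e : homPost (extend φ P) f ≫ extendAdj φ P N =
    extendAdj φ P M ≫ homPost P ((restrictFunctor φ).map f) := rfl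
  have h₁ : QuasiIso (homPost (extend φ P) f ≫ extendAdj φ P N) := by rw [e]; infer_instance
  exact quasiIso_of_comp_right _ (extendAdj φ P N)

/-- Holds because `c` factors as `y ↦ 1 ⊗ y` followed by `S ⊗_R Q → P`. It turns the comparison map
of condition 5 into precomposition with a morphism of DG `S`-modules, the link between `RHom` and
the tensor product. -/
lemma homRestrict_homPre (φ : R.Hom S) {Q : DGModule R} {P : DGModule S}
    (c : Q ⟶ restrict φ P) (N : DGModule S) :
    homRestrict φ P N ≫ homPre c (restrict φ N) =
      homPre (fromExtend φ P c) N ≫ extendAdj φ Q N := by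
  have e : homPre (fromExtend φ P c) N ≫ extendAdj φ Q N = homRestrict φ P N ≫
    homPre (unitExtend φ Q ≫ (restrictFunctor φ).map (fromExtend φ P c)) (restrict φ N) := rfl
  rw [e, unitExtend_fromExtend]

lemma quasiIso_homRestrict_homPre_iff (φ : R.Hom S) {Q : DGModule R} {P : DGModule S}
    (c : Q ⟶ restrict φ P) (N : DGModule S) :
    QuasiIso (homRestrict φ P N ≫ homPre c (restrict φ N)) ↔
      QuasiIso (homPre (fromExtend φ P c) N) := by
  rw [homRestrict_homPre]
  exact quasiIso_iff_comp_right _ _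

/-! ## Coextension of scalars -/

/-- The morphism `Hom_R(S, I) → I`, `f ↦ f 1`. -/
def counitCoextend (φ : R.Hom S) (I : DGModule R) : restrict φ (coextend φ I) ⟶ I where
  hom :=
    { f := fun n => ModuleCat.ofHom
        { toFun := fun f : HomDeg (restrict φ S.leftSelf) I n => f.app 0 n (zero_add n) S.one
          map_add' := fun f g => rfl
          map_smul' := fun c f => rfl }
      comm' := fun n n' hn => by
        have hn : n' + 1 = n := hn
        change _ = (homCx (restrict φ S.leftSelf) I).d n n' ≫ _
        rw [homCx_d _ _ n n' hn]
        ext (f : HomDeg (restrict φ S.leftSelf) I n)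
        refine Eq.symm ((homDiff_app _ _ n n' hn f 0 (-1) n n' (by omega) (by omega) (by omega)
          S.one).trans ?_)
        have e : (restrict φ S.leftSelf).cx.d 0 (-1) S.one = 0 := S.d_one (-1)
        rw [e, map_zero, smul_zero, sub_zero]
        rfl }
  map_smul i j k h r f := by
    have f' : HomDeg (restrict φ S.leftSelf) I j := f
    refine (coextendSMul_app φ I i j k h (φ.hom.f i r) f 0 i k (by omega) (by omega) S.one).trans ?_
    -- The action on `Hom_R(S, I)` moves `φ(r)` to the right of the argument; at the argument `1` it
    -- can be moved to the left, where `R`-linearity applies. The two signs are both `(-1)^(ij)` and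
    -- cancel.
    have e : S.mul 0 i i (zero_add i) S.one (φ.hom.f i r) =
      (restrict φ S.leftSelf).smul i 0 i (add_zero i) r S.one :=
      (S.one_mul i _).trans (S.mul_one i _).symm
    rw [e]
    refine (congrArg _ (HomDeg.app_smul (M := restrict φ S.leftSelf) (N := I) f i 0 i j k
      (by omega) (by omega) (by omega) r S.one)).trans ?_
    rw [smul_smul, ← Int.negOnePow_add, Int.negOnePow_even _ ⟨i * j, by ring⟩, _root_.one_smul]
    rfl

lemma toCoextend_counitCoextend (φ : R.Hom S) (M : DGModule S) {I : DGModule R}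
    (ι : restrict φ M ⟶ I) :
    (restrictFunctor φ).map (toCoextend φ M ι) ≫ counitCoextend φ I = ι := by
  refine DGModule.hom_ext _ _ ?_
  ext n m
  change (n * 0).negOnePow • ι.hom.f n (M.smul 0 n n _ S.one m) = _
  rw [M.one_smul]
  simp

/-- The map `Hom_S(N, Hom_R(S, I)) → Hom_R(N, I)`. -/
def coextendAdj (φ : R.Hom S) (N : DGModule S) (I : DGModule R) :
    homCx N (coextend φ I) ⟶ homCx (restrict φ N) I :=
  homRestrict φ N (coextend φ I) ≫ homPost (restrict φ N) (counitCoextend φ I)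

lemma coextendAdj_app (φ : R.Hom S) (N : DGModule S) (I : DGModule R) {n : ℤ}
    (f : HomDeg N (coextend φ I) n) (p q : ℤ) (hq : p + n = q) (y : N.cx.X p) :
    HomDeg.app (n := n) ((coextendAdj φ N I).f n f) p q hq y =
      HomDeg.app (M := restrict φ S.leftSelf) (N := I) (n := q) (f.app p q hq y) 0 q (zero_add q)
        S.one := rfl

/-- The homogeneous map `R`-linear in `s` given by `s ↦ (-1)^(|y||s|) g (s y)`. -/
def coextendElem (φ : R.Hom S) (N : DGModule S) (I : DGModule R) {n : ℤ}
    (g : HomDeg (restrict φ N) I n) (p q : ℤ) (hq : p + n = q) (y : N.cx.X p) :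
    HomDeg (restrict φ S.leftSelf) I q :=
  HomDeg.mk (fun a b hb => (p * a).negOnePow •
      (g.app (a + p) b (by omega) ∘ₗ (N.smul a p (a + p) rfl).flip y)) (by
    intro i a a' b b' ha hb hb' r (x : S.cx.X a)
    simp only [LinearMap.smul_apply, LinearMap.comp_apply, LinearMap.flip_apply]
    have e : N.smul a' p (a' + p) rfl ((restrict φ S.leftSelf).smul i a a' ha r x) y =
        (restrict φ N).smul i (a + p) (a' + p) (by omega) r (N.smul a p (a + p) rfl x y) :=
      N.mul_smul i a p a' (a + p) (a' + p) ha rfl rfl (by omega) (φ.hom.f i r) x y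
    refine (congrArg (fun z => (p * a').negOnePow • g.app (a' + p) b' (by omega) z) e).trans ?_
    rw [g.app_smul i (a + p) (a' + p) b b' (by omega) (by omega) (by omega),
      LinearMap.map_smul_of_tower, smul_smul, smul_smul, ← Int.negOnePow_add,
      ← Int.negOnePow_add]
    congr 2
    subst ha hq
    ring)

lemma coextendElem_app (φ : R.Hom S) (N : DGModule S) (I : DGModule R) {n : ℤ}
    (g : HomDeg (restrict φ N) I n) (p q : ℤ) (hq : p + n = q) (y : N.cx.X p)
    (a b c : ℤ) (hb : a + q = b) (hc : a + p = c) (x : S.cx.X a) :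
    (coextendElem φ N I g p q hq y).app a b hb x =
      (p * a).negOnePow • g.app c b (by omega) (N.smul a p c hc x y) := by
  subst hc
  rfl

/-- The homogeneous map `N → Hom_R(S, I)` associated with a homogeneous map `N → I`. -/
def coextendHom (φ : R.Hom S) (N : DGModule S) (I : DGModule R) {n : ℤ}
    (g : HomDeg (restrict φ N) I n) : HomDeg N (coextend φ I) n :=
  HomDeg.mk (fun p q hq =>
    { toFun := fun y => coextendElem φ N I g p q hq y
      map_add' := fun y y' => HomDeg.ext fun a b hb (x : S.cx.X a) => by
        rw [HomDeg.add_app, LinearMap.add_apply]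
        simp only [coextendElem_app φ N I g p q hq _ a b (a + p) hb rfl, map_add, smul_add]
      map_smul' := fun c y => HomDeg.ext fun a b hb (x : S.cx.X a) => by
        refine Eq.trans ?_ (LinearMap.congr_fun (HomDeg.smul_app c
          (coextendElem φ N I g p q hq y) a b hb) x).symm
        rw [LinearMap.smul_apply]
        simp only [coextendElem_app φ N I g p q hq _ a b (a + p) hb rfl, map_smul]
        rw [smul_comm] }) (by
    intro i p p' q q' hp hq hq' s y
    refine HomDeg.ext fun a b hb (x : S.cx.X a) => ?_
    refine (coextendElem_app φ N I g p' q' hq' _ a b (a + p') hb rfl x).trans ?_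
    refine Eq.trans ?_ (LinearMap.congr_fun (HomDeg.units_smul_app (n * i).negOnePow
      (coextendSMul φ I i q q' (by omega) s (coextendElem φ N I g p q hq y)) a b hb) x).symm
    rw [LinearMap.smul_apply,
      coextendSMul_app φ I i q q' (by omega) s _ a (a + i) b rfl hb x,
      coextendElem_app φ N I g p q hq _ (a + i) b (a + p') (by omega) (by omega),
      N.mul_smul a i p (a + i) p' (a + p') rfl hp (by omega) rfl, smul_smul, smul_smul,
      ← Int.negOnePow_add, ← Int.negOnePow_add]
    congr 1
    rw [Int.negOnePow_eq_iff]
    subst hp hq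
    exact ⟨-(n * i) - i * p, by ring⟩)

/-- A map `f` into `Hom_R(S, I)` is recovered from its values at `1`, because `f(y)(s) = ± (s
f(y))(1) = ± f(s y)(1)`; conversely this formula extends any homogeneous map `N → I`. -/
lemma coextendAdj_bijective (φ : R.Hom S) (N : DGModule S) (I : DGModule R) (n : ℤ) :
    Function.Bijective ((coextendAdj φ N I).f n) := by
  constructor
  · intro (f : HomDeg N (coextend φ I) n) (g : HomDeg N (coextend φ I) n) h
    refine HomDeg.ext fun p q hq y => HomDeg.ext fun a b hb (s : S.cx.X a) => ?_
    have e : ∀ f : HomDeg N (coextend φ I) n,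
        HomDeg.app (M := restrict φ S.leftSelf) (N := I) (n := q) (f.app p q hq y) a b hb s =
        (a * q).negOnePow • (n * a).negOnePow •
          HomDeg.app (n := n) ((coextendAdj φ N I).f n f) (a + p) b (by omega)
            (N.smul a p (a + p) rfl s y) := fun f => by
      rw [coextendAdj_app, f.app_smul a p (a + p) q b rfl hq (by omega) s y]
      have e₁ := LinearMap.congr_fun (HomDeg.units_smul_app (n * a).negOnePow
        (coextendSMul φ I a q b (by omega) s (f.app p q hq y)) 0 b (zero_add b)) S.one
      refine Eq.symm ((congrArg (fun z => (a * q).negOnePow • (n * a).negOnePow • z) e₁).trans ?_)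
      rw [LinearMap.smul_apply, coextendSMul_app φ I a q b _ s _ 0 a b (by omega) (by omega),
        S.one_mul, smul_smul (n * a).negOnePow, Int.units_mul_self, _root_.one_smul, smul_smul,
        add_zero, Int.units_mul_self, _root_.one_smul]
    rw [e, e g, h]
  · intro (g : HomDeg (restrict φ N) I n)
    refine ⟨coextendHom φ N I g, HomDeg.ext fun p q hq y => ?_⟩
    rw [coextendAdj_app]
    refine (coextendElem_app φ N I g p q hq y 0 q p (by omega) (by omega) S.one).trans ?_
    rw [N.one_smul]
    simp

instance (φ : R.Hom S) (N : DGModule S) (I : DGModule R) : QuasiIso (coextendAdj φ N I) :=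
  quasiIso_of_bijective _ (coextendAdj_bijective φ N I)

/-- The morphism `M → Hom_R(S, I)` corresponds to `ι` under the adjunction. Hence condition 4, after
`Hom_S(P, -)`, becomes a statement about `Hom_S(P, M) → Hom_R(P, I)`. -/
lemma homPost_toCoextend (φ : R.Hom S) (P M : DGModule S) {I : DGModule R}
    (ι : restrict φ M ⟶ I) :
    homPost P (toCoextend φ M ι) ≫ coextendAdj φ P I =
      homRestrict φ P M ≫ homPost (restrict φ P) ι := by
  have e : homPost P (toCoextend φ M ι) ≫ coextendAdj φ P I = homRestrict φ P M ≫
    homPost (restrict φ P) ((restrictFunctor φ).map (toCoextend φ M ι) ≫ counitCoextend φ I) := rfl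
  rw [e, toCoextend_counitCoextend]

/-- If `M → Hom_R(S, I)` is a quasi-isomorphism for some K-injective resolution `I` of `M`, then
`Hom_S(P, M) → Hom_R(Q, M)` is one, for a K-projective module `P` and a resolution `Q` of `P`. -/
lemma quasiIso_homRestrict_of_toCoextend (φ : R.Hom S) {P M : DGModule S} (hP : IsKProjective P)
    {Q : DGModule R} (hQ : IsKProjective Q) {c : Q ⟶ restrict φ P} (hc : IsQuasiIso c)
    (I : KInjectiveResolution (restrict φ M)) (h : IsQuasiIso (toCoextend φ M I.map)) :
    QuasiIso (homRestrict φ P M ≫ homPre c (restrict φ M)) := by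
  have h₁ := hP _ h
  have h₂ : QuasiIso (homRestrict φ P M ≫ homPost (restrict φ P) I.map) := by
    rw [← homPost_toCoextend]
    infer_instance
  have h₃ := I.isKInjective c hc
  have h₄ := hQ _ I.isQuasiIso
  -- Both composites send `f` to `ι f c`: they compare the computations of `RHom_R(P, M)` by the
  -- projective `Q` and by the injective `I`, both of which map quasi-isomorphically to `Hom_R(Q,
  -- I)`.
  have e : (homRestrict φ P M ≫ homPre c (restrict φ M)) ≫ homPost Q I.map =
    (homRestrict φ P M ≫ homPost (restrict φ P) I.map) ≫ homPre c I.obj := rfl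
  have h₅ : QuasiIso ((homRestrict φ P M ≫ homPre c (restrict φ M)) ≫ homPost Q I.map) := by
    rw [e]
    infer_instance
  exact quasiIso_of_comp_right _ (homPost Q I.map)

/-- If `Hom_S(S, M) → Hom_R(Q, M)` is a quasi-isomorphism for a K-projective resolution `Q` of `S`,
then `M → Hom_R(S, I)` is one for every K-injective resolution `I` of `M`. -/
lemma isQuasiIso_toCoextend (φ : R.Hom S) {M : DGModule S} {Q : DGModule R}
    (hQ : IsKProjective Q) {c : Q ⟶ restrict φ S.leftSelf} (hc : IsQuasiIso c)
    (h : QuasiIso (homRestrict φ S.leftSelf M ≫ homPre c (restrict φ M)))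
    (I : KInjectiveResolution (restrict φ M)) : IsQuasiIso (toCoextend φ M I.map) := by
  have h₃ := I.isKInjective c hc
  have h₄ := hQ _ I.isQuasiIso
  -- Both composites send `f : S → M` to `y ↦ ι f(c y)`, as `f` is determined by `f(1)`.
  have e : (evalOne M ≫ (toCoextend φ M I.map).hom) ≫ homPre c I.obj =
      (homRestrict φ S.leftSelf M ≫ homPre c (restrict φ M)) ≫ homPost Q I.map := by
    ext n (f : HomDeg S.leftSelf M n)
    refine HomDeg.ext fun p q hq y => ?_
    change (n * p).negOnePow • I.map.hom.f q (M.smul p n q hq (c.hom.f p y)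
      (f.app 0 n (zero_add n) S.one)) = I.map.hom.f q (f.app p q hq (c.hom.f p y))
    rw [← LinearMap.map_smul_of_tower, ← f.app_smul p 0 p n q (add_zero p) (zero_add n) hq]
    exact congrArg (fun z => I.map.hom.f q (f.app p q hq z)) (S.mul_one p _)
  have h₅ : QuasiIso ((evalOne M ≫ (toCoextend φ M I.map).hom) ≫ homPre c I.obj) := by
    rw [e]
    infer_instance
  have h₆ : QuasiIso (evalOne M ≫ (toCoextend φ M I.map).hom) :=
    quasiIso_of_comp_right _ (homPre c I.obj)
  exact quasiIso_of_comp_left (evalOne M) _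

end DGModule

/-! ## Morphisms in localizations -/

namespace CategoryTheory.MorphismProperty

variable {C : Type*} [Category* C] {D : Type*} [Category* D] {W : MorphismProperty C}

lemma lift_map_Q_map (G : C ⥤ D) (hG : W.IsInvertedBy G) {X Y : C} (f : X ⟶ Y) :
    (Localization.Construction.lift G hG).map (W.Q.map f) = G.map f := by
  exact (Functor.congr_hom (Localization.Construction.fac G hG) f).trans
    ((Category.id_comp _).trans (Category.comp_id _))

lemma isIso_map_of_isIso_Q_map (G : C ⥤ D) (hG : W.IsInvertedBy G) {X Y : C} (f : X ⟶ Y)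
    (h : IsIso (W.Q.map f)) : IsIso (G.map f) := by
  rw [← lift_map_Q_map G hG f]
  exact Functor.map_isIso _ _

/-- An object such that all morphisms out of it lift uniquely along the morphisms in `W`. -/
def IsColocalAt (W : MorphismProperty C) (P : C) : Prop :=
  ∀ ⦃X Y : C⦄ (w : X ⟶ Y), W w → Function.Bijective (fun f : P ⟶ X => f ≫ w)

/-- The functor `Hom(P, -)` inverts `W`, so it extends to the localization; the extension applied to
the two equal morphisms and evaluated at the identity of `P` returns `f` and `g`. -/
lemma IsColocalAt.Q_map_injective {P : C} (hP : IsColocalAt W P) {X : C} {f g : P ⟶ X}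
    (h : W.Q.map f = W.Q.map g) : f = g := by
  have hG : W.IsInvertedBy (coyoneda.obj (Opposite.op P)) := fun X Y w hw =>
    (isIso_iff_bijective _).2 (hP w hw)
  have e := congrArg (Localization.Construction.lift _ hG).map h
  rw [lift_map_Q_map, lift_map_Q_map] at e
  have e' : 𝟙 P ≫ f = 𝟙 P ≫ g := ConcreteCategory.congr_hom e (𝟙 P)
  rwa [Category.id_comp, Category.id_comp] at e'

/-- A morphism in the localization comes from a morphism in the original category. -/
def InImage (P : C) (X : W.Localization) (f : W.Q.obj P ⟶ X) : Prop :=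
  ∃ (x : C) (e : W.Q.obj x = X) (f' : P ⟶ x), f = W.Q.map f' ≫ eqToHom e

/-- Localization does not change the objects, so the equality in `InImage` is no restriction here.
It is present because `preservesImage` has to speak of arbitrary objects of the localization. -/
lemma inImage_iff {P X : C} (f : W.Q.obj P ⟶ W.Q.obj X) :
    InImage P _ f ↔ ∃ f', f = W.Q.map f' := by
  constructor
  · rintro ⟨x, e, f', rfl⟩
    obtain rfl := (Localization.Construction.objEquiv W).injective e
    exact ⟨f', by simp⟩
  · rintro ⟨f', rfl⟩
    exact ⟨X, rfl, f', by simp⟩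

/-- Morphisms such that composition with them preserves the morphisms which come from the
original category. -/
def preservesImage (W : MorphismProperty C) (P : C) : MorphismProperty W.Localization :=
  fun X _ g => ∀ f : W.Q.obj P ⟶ X, InImage P X f → InImage P _ (f ≫ g)

instance (P : C) : (preservesImage W P).IsStableUnderComposition where
  comp_mem f g hf hg h hh := by
    rw [← Category.assoc]
    exact hg _ (hf _ hh)

/-- The localization is generated by the morphisms of `C` and the formal inverses. Composition with
the inverse of `w` keeps a morphism out of `P` in the image, because that morphism lifts along `w`.
-/
lemma IsColocalAt.preservesImage_eq_top {P : C} (hP : IsColocalAt W P) :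
    preservesImage W P = ⊤ := by
  refine Localization.Construction.morphismProperty_eq_top _ (fun X Y f g hg => ?_)
    (fun X Y w hw g hg => ?_)
  · rw [inImage_iff] at hg ⊢
    obtain ⟨g', rfl⟩ := hg
    exact ⟨g' ≫ f, by simp⟩
  · rw [inImage_iff] at hg ⊢
    obtain ⟨g', rfl⟩ := hg
    obtain ⟨f', rfl⟩ := (hP w hw).2 g'
    refine ⟨f', ?_⟩
    have : W.Q.map w = (Localization.Construction.wIso w hw).hom := rfl
    rw [Functor.map_comp, this, Category.assoc, Iso.hom_inv_id, Category.comp_id]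

lemma IsColocalAt.Q_map_surjective {P : C} (hP : IsColocalAt W P) {X : C}
    (g : W.Q.obj P ⟶ W.Q.obj X) : ∃ f, W.Q.map f = g := by
  have h : preservesImage W P g := by
    rw [hP.preservesImage_eq_top]
    trivial
  obtain ⟨f, hf⟩ := (inImage_iff _).1 (h (𝟙 _) ⟨P, rfl, 𝟙 P, by simp⟩)
  exact ⟨f, by rw [← hf, Category.id_comp]⟩

end CategoryTheory.MorphismProperty

open CategoryTheory.MorphismProperty

/-! ## Isomorphisms and quasi-isomorphisms -/

/-- Homology inverts quasi-isomorphisms, hence extends to the localization and detects the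
quasi-isomorphisms there. -/
lemma isIso_toDerBase_map_iff {C D : ChainComplex (ModuleCat.{u} K) ℤ} (f : C ⟶ D) :
    IsIso ((toDerBase K).map f) ↔ QuasiIso f := by
  constructor
  · intro h
    refine ⟨fun i => (quasiIsoAt_iff_isIso_homologyMap f i).2 ?_⟩
    have hG : (HomologicalComplex.quasiIso (ModuleCat.{u} K) (ComplexShape.down ℤ)).IsInvertedBy
        (HomologicalComplex.homologyFunctor (ModuleCat.{u} K) (ComplexShape.down ℤ) i) :=
      fun X Y w (hw : QuasiIso w) => inferInstanceAs (IsIso (HomologicalComplex.homologyMap w i))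
    exact isIso_map_of_isIso_Q_map _ hG f h
  · intro h
    exact (HomologicalComplex.quasiIso (ModuleCat.{u} K) (ComplexShape.down ℤ)).Q_inverts f h

namespace DGModule

open ElementwiseHomology HomDeg

variable {R S : DGAlgebra K}

lemma homologyMap_eq_of_homotopic {M N : DGModule R} {f g : M ⟶ N} (h : Homotopic f g) (i : ℤ) :
    HomologicalComplex.homologyMap f.hom i = HomologicalComplex.homologyMap g.hom i := by
  obtain ⟨s, -, hs⟩ := h
  ext c
  obtain ⟨z, rfl⟩ := homologyπ_surjective i c
  have hn : ∀ f : M ⟶ N, HomologicalComplex.homologyMap f.hom i (M.cx.homologyπ i z) =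
      N.cx.homologyπ i (HomologicalComplex.cyclesMap f.hom i z) := fun f => by
    rw [← ModuleCat.comp_apply, HomologicalComplex.homologyπ_naturality, ModuleCat.comp_apply]
  have hc : ∀ f : M ⟶ N, N.cx.iCycles i (HomologicalComplex.cyclesMap f.hom i z) =
      f.hom.f i (M.cx.iCycles i z) := fun f => by
    rw [← ModuleCat.comp_apply, HomologicalComplex.cyclesMap_i, ModuleCat.comp_apply]
  refine (hn f).trans (Eq.trans ?_ (hn g).symm)
  rw [← sub_eq_zero, ← map_sub, homologyπ_eq_zero_iff i (i + 1) rfl]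
  refine ⟨s i (i + 1) rfl (M.cx.iCycles i z), ?_⟩
  rw [map_sub, hc, hc, hs i (i - 1) (i + 1) (by omega) rfl, d_iCycles, map_zero, add_zero]

variable (R) in
/-- The homology as a functor on the homotopy category. -/
def hoHomology (i : ℤ) : HoCat R ⥤ ModuleCat.{u} K :=
  CategoryTheory.Quotient.lift _
    { obj := fun M => M.cx.homology i
      map := fun f => HomologicalComplex.homologyMap (Hom.hom f) i
      map_id := fun _ => HomologicalComplex.homologyMap_id _ _
      map_comp := fun _ _ => HomologicalComplex.homologyMap_comp _ _ _ }
    (fun _ _ _ _ h => homologyMap_eq_of_homotopic h i)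

/-- As for complexes over `K`, with homology regarded as a functor on `𝒦(R)`. This reduces the
canonical morphisms of the theorem to honest morphisms of DG modules. -/
lemma isIso_toDer_map_iff {M N : DGModule R} (f : M ⟶ N) :
    IsIso ((toDer R).map f) ↔ IsQuasiIso f := by
  constructor
  · intro h
    refine ⟨fun i => (quasiIsoAt_iff_isIso_homologyMap f.hom i).2 ?_⟩
    have hG : (hoQuasiIso R).IsInvertedBy (hoHomology R i) := by
      rintro X Y _ ⟨w, hw, rfl⟩
      have hw : QuasiIso (Hom.hom w) := hw
      exact inferInstanceAs (IsIso (HomologicalComplex.homologyMap (Hom.hom w) i))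
    exact isIso_map_of_isIso_Q_map _ hG ((toHo R).map f) h
  · intro h
    exact (hoQuasiIso R).Q_inverts _ ⟨f, h, rfl⟩

/-! ## Morphisms out of K-projective modules in the derived category -/

/-- Existence and uniqueness up to homotopy of lifts along quasi-isomorphisms is colocality in
`𝒦(R)`. Consequently the morphisms from `P` in `𝒟(R)` are homotopy classes. -/
lemma IsKProjective.isColocalAt {P : DGModule R} (hP : IsKProjective P) :
    IsColocalAt (hoQuasiIso R) ((toHo R).obj P) := by
  rintro ⟨X⟩ ⟨Y⟩ _ ⟨w, hw, rfl⟩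
  constructor
  · intro f g h
    obtain ⟨f, rfl⟩ := (toHo R).map_surjective f
    obtain ⟨g, rfl⟩ := (toHo R).map_surjective g
    refine (toHo_map_eq_iff f g).2 (hP.homotopic_of_comp hw ((toHo_map_eq_iff _ _).1 ?_))
    rw [Functor.map_comp, Functor.map_comp]
    exact h
  · intro f
    obtain ⟨f, rfl⟩ := (toHo R).map_surjective f
    obtain ⟨f', hf'⟩ := hP.exists_lift hw f
    refine ⟨(toHo R).map f', ?_⟩
    rw [← toHo_map_eq_iff, Functor.map_comp] at hf'
    exact hf'

lemma IsKProjective.toDer_map_eq_iff {P N : DGModule R} (hP : IsKProjective P) (f g : P ⟶ N) :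
    (toDer R).map f = (toDer R).map g ↔ Homotopic f g := by
  rw [← toHo_map_eq_iff]
  exact ⟨fun h => hP.isColocalAt.Q_map_injective h, fun h => congrArg (hoQuasiIso R).Q.map h⟩

lemma IsKProjective.toDer_map_surjective {P N : DGModule R} (hP : IsKProjective P)
    (g : (toDer R).obj P ⟶ (toDer R).obj N) : ∃ f : P ⟶ N, (toDer R).map f = g := by
  obtain ⟨f, hf⟩ := hP.isColocalAt.Q_map_surjective g
  obtain ⟨f, rfl⟩ := (toHo R).map_surjective f
  exact ⟨f, hf⟩

/-! ## Restriction of scalars on derived categories -/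

/-- The action of `𝒟(φ)` on the morphisms between given DG modules. -/
def resDer (φ : R.Hom S) {M N : DGModule S} (g : (toDer S).obj M ⟶ (toDer S).obj N) :
    (toDer R).obj (restrict φ M) ⟶ (toDer R).obj (restrict φ N) :=
  (restrictDer φ).map g

lemma resDer_map (φ : R.Hom S) {M N : DGModule S} (f : M ⟶ N) :
    resDer φ ((toDer S).map f) = (toDer R).map ((restrictFunctor φ).map f) :=
  lift_map_Q_map (restrictHo φ ⋙ (hoQuasiIso R).Q) (restrictHo_inverts φ) ((toHo S).map f)

lemma resDer_comp (φ : R.Hom S) {L M N : DGModule S} (f : (toDer S).obj L ⟶ (toDer S).obj M)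
    (g : (toDer S).obj M ⟶ (toDer S).obj N) : resDer φ (f ≫ g) = resDer φ f ≫ resDer φ g :=
  (restrictDer φ).map_comp f g

/-- The homotopy is transported through the adjunction in degree one; its boundary is checked
through the adjunction in degree zero, since `extendAdj` is a chain map. -/
lemma homotopic_of_unitExtend (φ : R.Hom S) {P : DGModule R} {N : DGModule S}
    {f g : extend φ P ⟶ N}
    (h : Homotopic (unitExtend φ P ≫ (restrictFunctor φ).map f)
      (unitExtend φ P ≫ (restrictFunctor φ).map g)) : Homotopic f g := by
  obtain ⟨s, hs⟩ := (homotopic_iff _ _).1 h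
  obtain ⟨t, rfl⟩ := (extendAdj_bijective φ P N 1).2 s
  refine (homotopic_iff _ _).2 ⟨t, (extendAdj_bijective φ P N 0).1 ?_⟩
  rw [← homCx_d_apply, hom_comm, homCx_d_apply (by omega)]
  refine hs.trans (HomDeg.ext fun p q hq y => ?_)
  obtain rfl : p = q := by omega
  rfl

/-- The map `Hom(S ⊗ᴸ_R P, N) → Hom(P, N)` on morphisms in the derived categories. -/
def derAdj (φ : R.Hom S) (P : DGModule R) (N : DGModule S)
    (h : (toDer S).obj (extend φ P) ⟶ (toDer S).obj N) :
    (toDer R).obj P ⟶ (toDer R).obj (restrict φ N) :=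
  (toDer R).map (unitExtend φ P) ≫ resDer φ h

lemma derAdj_map (φ : R.Hom S) {P : DGModule R} {N : DGModule S} (f : extend φ P ⟶ N) :
    derAdj φ P N ((toDer S).map f) =
      (toDer R).map (unitExtend φ P ≫ (restrictFunctor φ).map f) := by
  rw [derAdj, resDer_map, Functor.map_comp]

/-- Both sides are sets of homotopy classes, `P` and `S ⊗_R P` being K-projective, so the adjunction
up to homotopy suffices. -/
lemma derAdj_bijective (φ : R.Hom S) {P : DGModule R} (hP : IsKProjective P) (N : DGModule S) :
    Function.Bijective (derAdj φ P N) := by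
  have hP' := isKProjective_extend φ hP
  constructor
  · intro f g h
    obtain ⟨f, rfl⟩ := hP'.toDer_map_surjective f
    obtain ⟨g, rfl⟩ := hP'.toDer_map_surjective g
    rw [derAdj_map, derAdj_map, hP.toDer_map_eq_iff] at h
    exact (hP'.toDer_map_eq_iff _ _).2 (homotopic_of_unitExtend φ h)
  · intro g
    obtain ⟨g, rfl⟩ := hP.toDer_map_surjective g
    exact ⟨(toDer S).map (fromExtend φ N g), by rw [derAdj_map, unitExtend_fromExtend]⟩

lemma derAdj_comp (φ : R.Hom S) {P : DGModule R} {M N : DGModule S} (π : P ⟶ restrict φ M)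
    (g : (toDer S).obj M ⟶ (toDer S).obj N) :
    derAdj φ P N ((toDer S).map (fromExtend φ M π) ≫ g) =
      (toDer R).map π ≫ resDer φ g := by
  rw [derAdj, resDer_comp, resDer_map, ← Category.assoc, ← Functor.map_comp,
    unitExtend_fromExtend]

/-- The derived adjunction and the isomorphism `π` fit `𝒟(φ)` and precomposition with the counit
into a square whose other two sides are bijective. -/
lemma bijective_resDer_iff (φ : R.Hom S) {P : DGModule R} (hP : IsKProjective P)
    {M : DGModule S} {π : P ⟶ restrict φ M} (hπ : IsQuasiIso π) (N : DGModule S) :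
    Function.Bijective (resDer φ (M := M) (N := N)) ↔
      Function.Bijective (fun g : (toDer S).obj M ⟶ (toDer S).obj N =>
        (toDer S).map (fromExtend φ M π) ≫ g) := by
  have hi : IsIso ((toDer R).map π) := (isIso_toDer_map_iff π).2 hπ
  have hb : Function.Bijective (fun g : (toDer R).obj (restrict φ M) ⟶
      (toDer R).obj (restrict φ N) => (toDer R).map π ≫ g) :=
    ⟨fun f g h => (cancel_epi _).1 h, fun g => ⟨inv ((toDer R).map π) ≫ g, by simp⟩⟩
  have e : derAdj φ P N ∘ (fun g : (toDer S).obj M ⟶ (toDer S).obj N =>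
      (toDer S).map (fromExtend φ M π) ≫ g) =
      (fun g : (toDer R).obj (restrict φ M) ⟶
        (toDer R).obj (restrict φ N) => (toDer R).map π ≫ g) ∘
      (resDer φ (M := M) (N := N)) :=
    funext fun g => derAdj_comp φ π g
  rw [← (derAdj_bijective φ hP N).of_comp_iff', e, hb.of_comp_iff']

/-- Restriction of scalars is fully faithful on derived categories if and only if the counit
`S ⊗ᴸ_R M → M` is an isomorphism for all `M`. -/
lemma full_faithful_restrictDer_iff (φ : R.Hom S)
    (res : ∀ M : DGModule S, KProjectiveResolution (restrict φ M)) :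
    (restrictDer φ).Full ∧ (restrictDer φ).Faithful ↔
      ∀ M, IsIso ((toDer S).map (fromExtend φ M (res M).map)) := by
  -- Yoneda: the counit at `M` is invertible exactly when precomposition with it is bijective for
  -- all targets, and every object of `𝒟(S)` is the image of a DG module.
  have key : ∀ M, (∀ N, Function.Bijective (resDer φ (M := M) (N := N))) ↔
      IsIso ((toDer S).map (fromExtend φ M (res M).map)) := by
    intro M
    rw [isIso_iff_coyoneda_map_bijective]
    simp_rw [bijective_resDer_iff φ (res M).isKProjective (res M).isQuasiIso]
    constructor
    · rintro h ⟨⟨⟨N⟩⟩⟩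
      exact h N
    · intro h N
      exact h ((toDer S).obj N)
  simp_rw [← key]
  constructor
  · rintro ⟨h₁, h₂⟩ M N
    exact ⟨fun f g h => (restrictDer φ).map_injective h, fun g =>
      (restrictDer φ).map_surjective (X := (toDer S).obj M) (Y := (toDer S).obj N) g⟩
  · intro h
    refine ⟨⟨?_⟩, ⟨?_⟩⟩
    · rintro ⟨⟨⟨M⟩⟩⟩ ⟨⟨⟨N⟩⟩⟩ g
      exact (h M N).2 g
    · rintro ⟨⟨⟨M⟩⟩⟩ ⟨⟨⟨N⟩⟩⟩ f g e
      exact (h M N).1 e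

end DGModule

/-! ## Tensor products -/

namespace DGTensor

open DGModule ElementwiseHomology

variable {R S : DGAlgebra K}

lemma cx_hom_ext {M : DGRightModule R} {N : DGModule R} {C : ChainComplex (ModuleCat.{u} K) ℤ}
    {f g : cx M N ⟶ C}
    (h : ∀ (n i j : ℤ) (hij : i + j = n) (x : M.cx.X i) (y : N.cx.X j),
      f.f n (tmul M N i j n hij x y) = g.f n (tmul M N i j n hij x y)) : f = g :=
  HomologicalComplex.hom_ext _ _ fun n => ModuleCat.hom_ext (lin_ext fun i j hij x y =>
    h n i j hij x y)

lemma cxLift_tmul {M : DGRightModule R} {N : DGModule R} {C : ChainComplex (ModuleCat.{u} K) ℤ}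
    (b : ∀ n i j : ℤ, i + j = n → (M.cx.X i →ₗ[K] N.cx.X j →ₗ[K] C.X n)) (hb) (hf)
    (n i j : ℤ) (h : i + j = n) (x : M.cx.X i) (y : N.cx.X j) :
    (cxLift b hb hf).f n (tmul M N i j n h x y) = b n i j h x y :=
  lift_tmul (b n) (hb n) i j h x y

/-- The morphism `M ⊗_R N → M ⊗_R N'` induced by a morphism `N → N'`. -/
def map (M : DGRightModule R) {N N' : DGModule R} (f : N ⟶ N') : cx M N ⟶ cx M N' :=
  cxLift (fun n i j h => (tmul M N' i j n h).compl₂ (f.hom.f j).hom) (by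
    intro n i j k ij jk h₁ h₂ h₃ h₄ x r y
    refine (tmul_smul M N' n i j k ij jk h₁ h₂ h₃ h₄ x r (f.hom.f k y)).trans ?_
    exact congrArg (tmul M N' i jk n h₄ x) (f.map_smul j k jk h₂ r y).symm) (by
    intro n n' i j i' j' hn hi hj h x y
    rw [cx_d M N' n n' hn]
    refine (diff_tmul M N' n n' hn i j i' j' hi hj h x (f.hom.f j y)).trans ?_
    rw [← DGModule.hom_comm f.hom j j' y]
    rfl)

lemma map_tmul (M : DGRightModule R) {N N' : DGModule R} (f : N ⟶ N') (n i j : ℤ)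
    (h : i + j = n) (x : M.cx.X i) (y : N.cx.X j) :
    (map M f).f n (tmul M N i j n h x y) = tmul M N' i j n h x (f.hom.f j y) :=
  cxLift_tmul _ _ _ n i j h x y

lemma map_comp (M : DGRightModule R) {N N' N'' : DGModule R} (f : N ⟶ N') (g : N' ⟶ N'') :
    map M (f ≫ g) = map M f ≫ map M g :=
  cx_hom_ext fun n i j hij x y => by
    rw [map_tmul, HomologicalComplex.comp_f, ModuleCat.comp_apply, map_tmul, map_tmul]
    rfl

/-- The map `x ⊗ y ↦ (-1)^|x| x ⊗ s y` induced by a homogeneous map `s` of degree one. -/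
def mapHomotopy (M : DGRightModule R) {N N' : DGModule R} (s : HomDeg N N' 1) (n n' : ℤ)
    (hn : n + 1 = n') : Deg M N n →ₗ[K] Deg M N' n' :=
  lift (fun i j h => i.negOnePow • (tmul M N' i (j + 1) n' (by omega)).compl₂ (s.app j (j + 1) rfl))
    (by
      intro i j k ij jk h₁ h₂ h₃ h₄ x r y
      simp only [LinearMap.smul_apply, LinearMap.compl₂_apply]
      rw [s.app_smul j k jk (k + 1) (jk + 1) h₂ rfl rfl, LinearMap.map_smul_of_tower, smul_smul,
        tmul_smul M N' n' i j (k + 1) ij (jk + 1) h₁ (by omega) (by omega) (by omega), one_mul,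
        ← Int.negOnePow_add, h₁])

lemma mapHomotopy_tmul (M : DGRightModule R) {N N' : DGModule R} (s : HomDeg N N' 1) (n n' : ℤ)
    (hn : n + 1 = n') (i j j' : ℤ) (h : i + j = n) (hj : j + 1 = j') (x : M.cx.X i)
    (y : N.cx.X j) : mapHomotopy M s n n' hn (tmul M N i j n h x y) =
      i.negOnePow • tmul M N' i j' n' (by omega) x (s.app j j' hj y) := by
  subst hj
  exact lift_tmul (M := M) (N := N) _ _ i j h x y

/-- The map `x ⊗ y ↦ (-1)^|x| x ⊗ s y` is a homotopy from the identity to `1 ⊗ e`; the sign cancels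
the terms that contain `∂x`. -/
lemma quasiIso_map_of_homotopic_id (M : DGRightModule R) {N : DGModule R} {e : N ⟶ N}
    (h : Homotopic (𝟙 N) e) : QuasiIso (map M e) := by
  obtain ⟨s, hs⟩ := (homotopic_iff _ _).1 h
  have hid : QuasiIso (𝟙 (cx M N)) := inferInstance
  refine quasiIso_of_homotopy (mapHomotopy M s) (fun n n' n'' hn' hn'' z => ?_) hid
  rw [cx_d M N n'' n hn'', cx_d M N n n' hn']
  refine LinearMap.congr_fun (f := LinearMap.id - ((map M e).f n).hom)
    (g := diff M N n'' n hn'' ∘ₗ mapHomotopy M s n n'' hn'' +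
      mapHomotopy M s n' n hn' ∘ₗ diff M N n n' hn') (lin_ext fun i j hij x y => ?_) z
  rw [LinearMap.sub_apply, LinearMap.add_apply, LinearMap.comp_apply, LinearMap.comp_apply,
    mapHomotopy_tmul M s n n'' hn'' i j (j + 1) hij rfl, LinearMap.map_smul_of_tower,
    diff_tmul M N n'' n hn'' i (j + 1) (i - 1) j (by omega) rfl,
    diff_tmul M N n n' hn' i j (i - 1) (j - 1) (by omega) (by omega), map_add,
    LinearMap.map_smul_of_tower,
    mapHomotopy_tmul M s n' n hn' (i - 1) j (j + 1) _ rfl,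
    mapHomotopy_tmul M s n' n hn' i (j - 1) j _ (by omega)]
  have e₁ : s.app (j - 1) j (by omega) (N.cx.d j (j - 1) y) =
      y - e.hom.f j y - N.cx.d (j + 1) j (s.app j (j + 1) rfl y) := by
    have := congrArg (fun t => t.app j j (add_zero j) y) hs
    rw [homDiff_app N N 1 0 _ s j (j - 1) (j + 1) j (by omega) rfl] at this
    simp only [Int.negOnePow_one, Units.neg_smul, _root_.one_smul, HomDeg.sub_app,
      LinearMap.sub_apply, HomDeg.ofHom_app] at this
    refine eq_sub_of_add_eq' ((sub_neg_eq_add _ _).symm.trans this)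
  have e₂ : ((map M e).f n).hom (tmul M N i j n hij x y) = tmul M N i j n hij x (e.hom.f j y) :=
    map_tmul M e n i j hij x y
  rw [e₁, e₂, smul_add, smul_smul, smul_smul, Int.units_mul_self, _root_.one_smul,
    Int.negOnePow_sub, Int.negOnePow_one, map_sub, map_sub, LinearMap.id_apply]
  simp only [mul_neg, mul_one, Units.neg_smul, _root_.one_smul]
  abel

lemma quasiIso_map_of_isHomotopyEquiv (M : DGRightModule R) {N N' : DGModule R} {f : N ⟶ N'}
    (hf : IsHomotopyEquiv f) : QuasiIso (map M f) := by
  obtain ⟨g, h, h'⟩ := hf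
  have e := quasiIso_map_of_homotopic_id M h.symm
  have e' := quasiIso_map_of_homotopic_id M h'.symm
  rw [map_comp] at e e'
  exact quasiIso_of_quasiIso_comp e e'

lemma changeRings_tmul (φ : R.Hom S) (M : DGRightModule S) {P : DGModule R} {N : DGModule S}
    (f : P ⟶ DGModule.restrict φ N) (n i j : ℤ) (h : i + j = n) (x : M.cx.X i) (y : P.cx.X j) :
    (changeRings φ M f).f n (tmul (M.restrict φ) P i j n h x y) =
      tmul M N i j n h x (f.hom.f j y) :=
  cxLift_tmul (M := M.restrict φ) (N := P) _ _ _ n i j h x y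

/-- The factorization of `M ⊗_R P → M ⊗_S N` through `M ⊗_S (S ⊗_R P)`, which isolates the
dependence on `S ⊗_R P → N`. -/
lemma changeRings_eq (φ : R.Hom S) (M : DGRightModule S) {P : DGModule R} {N : DGModule S}
    (f : P ⟶ DGModule.restrict φ N) :
    changeRings φ M f = changeRings φ M (unitExtend φ P) ≫ map M (fromExtend φ N f) :=
  cx_hom_ext fun n i j hij x y => by
    rw [HomologicalComplex.comp_f, ModuleCat.comp_apply]
    refine (changeRings_tmul φ M f n i j hij x y).trans (Eq.symm ?_)
    refine (congrArg ((map M (fromExtend φ N f)).f n)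
      (changeRings_tmul φ M (unitExtend φ P) n i j hij x y)).trans ?_
    refine (map_tmul M (fromExtend φ N f) n i j hij x _).trans ?_
    refine congrArg (tmul M N i j n hij x) ?_
    exact (fromExtend_tmul φ N f 0 j j (zero_add j) S.one y).trans (N.one_smul j _)

/-- The map `s ⊗ y ↦ x s ⊗ y` for an element `x` of `M`. -/
def assocAux (φ : R.Hom S) (M : DGRightModule S) (P : DGModule R) (i j n : ℤ) (h : i + j = n)
    (x : M.cx.X i) : Deg (S.rightSelf.restrict φ) P j →ₗ[K] Deg (M.restrict φ) P n :=
  lift (fun p q hpq => (tmul (M.restrict φ) P (i + p) q n (by omega)).comp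
    (M.smul i p (i + p) rfl x)) (by
    intro p q l pq ql h₁ h₂ h₃ h₄ s r y
    refine Eq.trans ?_ (tmul_smul (M.restrict φ) P n (i + p) q l (i + pq) ql
      (by omega) h₂ (by omega) (by omega) (M.smul i p (i + p) rfl x s) r y)
    exact congrArg (fun z => tmul (M.restrict φ) P (i + pq) l n (by omega) z y)
      (M.smul_mul i p q (i + p) pq (i + pq) rfl h₁ (by omega) rfl x s (φ.hom.f q r)).symm)

lemma assocAux_tmul (φ : R.Hom S) (M : DGRightModule S) (P : DGModule R) (i j n : ℤ)
    (h : i + j = n) (x : M.cx.X i) (p q ip : ℤ) (hpq : p + q = j) (hp : i + p = ip)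
    (s : S.cx.X p) (y : P.cx.X q) :
    assocAux φ M P i j n h x (tmul (S.rightSelf.restrict φ) P p q j hpq s y) =
      tmul (M.restrict φ) P ip q n (by omega) (M.smul i p ip hp x s) y := by
  subst hp
  exact lift_tmul (M := S.rightSelf.restrict φ) (N := P) _ _ p q hpq s y

/-- The bilinear map `(x, s ⊗ y) ↦ x s ⊗ y`. -/
def assocBilin (φ : R.Hom S) (M : DGRightModule S) (P : DGModule R) (i j n : ℤ) (h : i + j = n) :
    M.cx.X i →ₗ[K] Deg (S.rightSelf.restrict φ) P j →ₗ[K] Deg (M.restrict φ) P n where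
  toFun x := assocAux φ M P i j n h x
  map_add' x x' := lin_ext fun p q hpq s y => by
    rw [LinearMap.add_apply]
    refine (assocAux_tmul φ M P i j n h _ p q (i + p) hpq rfl s y).trans ?_
    refine Eq.trans ?_ (congrArg₂ (· + ·) (assocAux_tmul φ M P i j n h x p q (i + p) hpq rfl s y)
      (assocAux_tmul φ M P i j n h x' p q (i + p) hpq rfl s y)).symm
    simp only [map_add, LinearMap.add_apply]
  map_smul' c x := lin_ext fun p q hpq s y => by
    rw [LinearMap.smul_apply]
    refine (assocAux_tmul φ M P i j n h _ p q (i + p) hpq rfl s y).trans ?_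
    refine Eq.trans ?_ (congrArg (c • ·)
      (assocAux_tmul φ M P i j n h x p q (i + p) hpq rfl s y)).symm
    simp only [map_smul, LinearMap.smul_apply]

lemma assocBilin_balanced (φ : R.Hom S) (M : DGRightModule S) (P : DGModule R) (n : ℤ)
    (i j k ij jk : ℤ) (h₁ : i + j = ij) (h₂ : j + k = jk) (h₃ : ij + k = n) (h₄ : i + jk = n)
    (x : M.cx.X i) (s : S.cx.X j) :
    assocAux φ M P ij k n h₃ (M.smul i j ij h₁ x s) =
      assocAux φ M P i jk n h₄ x ∘ₗ extendSMul φ P j k jk h₂ s :=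
  lin_ext fun p q hpq t y => by
    rw [LinearMap.comp_apply]
    refine (assocAux_tmul φ M P ij k n h₃ _ p q (ij + p) hpq rfl t y).trans (Eq.symm ?_)
    refine (congrArg (assocAux φ M P i jk n h₄ x)
      (extendSMul_tmul φ P j k jk h₂ s p q (j + p) hpq rfl t y)).trans ?_
    refine (assocAux_tmul φ M P i jk n h₄ x (j + p) q (ij + p) (by omega) (by omega) _ y).trans ?_
    exact congrArg (fun z => tmul (M.restrict φ) P (ij + p) q n (by omega) z y)
      (M.smul_mul i j p ij (j + p) (ij + p) h₁ rfl rfl (by omega) x s t).symm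

/-- The map `M ⊗_S (S ⊗_R P) → M ⊗_R P`. -/
def assoc (φ : R.Hom S) (M : DGRightModule S) (P : DGModule R) (n : ℤ) :
    Deg M (extend φ P) n →ₗ[K] Deg (M.restrict φ) P n :=
  lift (M := M) (N := extend φ P) (fun i j h => assocBilin φ M P i j n h)
    (fun i j k ij jk h₁ h₂ h₃ h₄ x s z =>
      LinearMap.congr_fun (assocBilin_balanced φ M P n i j k ij jk h₁ h₂ h₃ h₄ x s) z)

lemma assoc_tmul (φ : R.Hom S) (M : DGRightModule S) (P : DGModule R) (n i j : ℤ)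
    (h : i + j = n) (x : M.cx.X i) (z : Deg (S.rightSelf.restrict φ) P j) :
    assoc φ M P n (tmul M (extend φ P) i j n h x z) = assocAux φ M P i j n h x z :=
  lift_tmul (M := M) (N := extend φ P) _ _ i j h x z

/-- Associativity of the tensor product, `M ⊗_R P ≅ M ⊗_S (S ⊗_R P)`; the inverse sends `x ⊗ (s ⊗
y)` to `x s ⊗ y`. -/
lemma changeRings_unitExtend_bijective (φ : R.Hom S) (M : DGRightModule S) (P : DGModule R)
    (n : ℤ) : Function.Bijective ((changeRings φ M (unitExtend φ P)).f n) := by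
  have h₁ : assoc φ M P n ∘ₗ ((changeRings φ M (unitExtend φ P)).f n).hom = LinearMap.id := by
    refine lin_ext fun i j hij x y => ?_
    rw [LinearMap.comp_apply]
    refine (congrArg (assoc φ M P n)
      (changeRings_tmul φ M (unitExtend φ P) n i j hij x y)).trans ?_
    refine (assoc_tmul φ M P n i j hij x _).trans ?_
    refine (assocAux_tmul φ M P i j n hij x 0 j i (zero_add j) (add_zero i) S.one y).trans ?_
    exact congrArg (fun z => tmul (M.restrict φ) P i j n hij z y) (M.smul_one i x)
  have h₂ : ((changeRings φ M (unitExtend φ P)).f n).hom ∘ₗ assoc φ M P n = LinearMap.id := by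
    refine lin_ext (M := M) (N := extend φ P) fun i j hij x z => ?_
    rw [LinearMap.comp_apply]
    refine (congrArg ((changeRings φ M (unitExtend φ P)).f n).hom
      (assoc_tmul φ M P n i j hij x z)).trans ?_
    refine LinearMap.congr_fun
      (f := ((changeRings φ M (unitExtend φ P)).f n).hom ∘ₗ assocAux φ M P i j n hij x)
      (g := tmul M (extend φ P) i j n hij x) (lin_ext fun p q hpq s y => ?_) z
    rw [LinearMap.comp_apply]
    refine (congrArg ((changeRings φ M (unitExtend φ P)).f n).hom
      (assocAux_tmul φ M P i j n hij x p q (i + p) hpq rfl s y)).trans ?_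
    refine (changeRings_tmul φ M (unitExtend φ P) n (i + p) q (by omega) _ y).trans ?_
    refine (tmul_smul M (extend φ P) n i p q (i + p) j rfl hpq (by omega) hij x s _).trans ?_
    exact congrArg (tmul M (extend φ P) i j n hij x) (extendSMul_one_tmul φ P p q j hpq s y)
  exact ⟨Function.LeftInverse.injective (LinearMap.congr_fun h₁),
    Function.RightInverse.surjective (LinearMap.congr_fun h₂)⟩

/-- If `S ⊗_R P → N` is a homotopy equivalence, then `M ⊗_R P → M ⊗_S N` is a
quasi-isomorphism. -/
lemma quasiIso_changeRings (φ : R.Hom S) (M : DGRightModule S) {P : DGModule R} {N : DGModule S}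
    (f : P ⟶ DGModule.restrict φ N) (h : IsHomotopyEquiv (fromExtend φ N f)) :
    QuasiIso (changeRings φ M f) := by
  rw [changeRings_eq]
  have h₁ := quasiIso_of_bijective _ (changeRings_unitExtend_bijective φ M P)
  have h₂ := quasiIso_map_of_isHomotopyEquiv M h
  infer_instance

/-- The multiplication `S ⊗_S N → N`. -/
def selfTensor (N : DGModule S) : cx S.rightSelf N ⟶ N.cx :=
  cxLift (fun n i j h => N.smul i j n h)
    (fun n i j k ij jk h₁ h₂ h₃ h₄ x r y => N.mul_smul i j k ij jk n h₁ h₂ h₃ h₄ x r y)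
    (fun n n' i j i' j' hn hi hj h x y => N.leibniz i j n i' j' n' hi hj hn h x y)

lemma selfTensor_tmul (N : DGModule S) (n i j : ℤ) (h : i + j = n) (x : S.cx.X i)
    (y : N.cx.X j) :
    (selfTensor N).f n (tmul S.rightSelf N i j n h x y) = N.smul i j n h x y :=
  cxLift_tmul (M := S.rightSelf) (N := N) _ _ _ n i j h x y

lemma selfTensor_bijective (N : DGModule S) (n : ℤ) :
    Function.Bijective ((selfTensor N).f n) := by
  have h₁ : tmul S.rightSelf N 0 n n (zero_add n) S.one ∘ₗ ((selfTensor N).f n).hom =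
      LinearMap.id := by
    refine lin_ext fun i j hij (x : S.cx.X i) y => ?_
    rw [LinearMap.comp_apply]
    refine (congrArg (tmul S.rightSelf N 0 n n (zero_add n) S.one)
      (selfTensor_tmul N n i j hij x y)).trans ?_
    refine (tmul_smul S.rightSelf N n 0 i j i n (zero_add i) hij hij (zero_add n) S.one x
      y).symm.trans ?_
    exact congrArg (fun z => tmul S.rightSelf N i j n hij z y) (S.one_mul i x)
  refine ⟨Function.LeftInverse.injective (g := tmul S.rightSelf N 0 n n (zero_add n) S.one)
    (LinearMap.congr_fun h₁), fun y => ⟨tmul S.rightSelf N 0 n n (zero_add n) S.one y, ?_⟩⟩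
  exact (selfTensor_tmul N n 0 n (zero_add n) S.one y).trans (N.one_smul n y)

/-- The isomorphism `S ⊗_S N ≅ N` carries one map to the other. It makes condition 1 a special case
of condition 3. -/
lemma isQuasiIso_fromExtend_iff (φ : R.Hom S) {P : DGModule R} (N : DGModule S)
    (f : P ⟶ DGModule.restrict φ N) :
    IsQuasiIso (fromExtend φ N f) ↔ QuasiIso (changeRings φ S.rightSelf f) := by
  have e : (fromExtend φ N f).hom = changeRings φ S.rightSelf f ≫ selfTensor N :=
    cx_hom_ext (M := S.rightSelf.restrict φ) fun n i j hij x y => by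
      rw [HomologicalComplex.comp_f, ModuleCat.comp_apply]
      refine (fromExtend_tmul φ N f i j n hij x y).trans (Eq.symm ?_)
      refine (congrArg ((selfTensor N).f n)
        (changeRings_tmul φ S.rightSelf f n i j hij x y)).trans ?_
      exact selfTensor_tmul N n i j hij x _
  have h := quasiIso_of_bijective _ (selfTensor_bijective N)
  rw [IsQuasiIso, e]
  exact quasiIso_iff_comp_right _ _

end DGTensor

/-! ### Tools for the construction of resolutions -/

/-- A sequence of dependent choices. -/
lemma exists_dependent_seq {X : ℕ → Type*} (base : X 0 → Prop) (inv : ∀ k, X k → Prop)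
    (step : ∀ k, X k → X (k + 1) → Prop) (h₀ : ∃ x, base x ∧ inv 0 x)
    (h : ∀ k x, inv k x → ∃ x', step k x x' ∧ inv (k + 1) x') :
    ∃ s : ∀ k, X k, base (s 0) ∧ ∀ k, step k (s k) (s (k + 1)) := by
  choose f hf using h
  obtain ⟨x₀, hb, hi⟩ := h₀
  let t : ∀ k, {x : X k // inv k x} := fun k =>
    Nat.rec ⟨x₀, hi⟩ (fun k x => ⟨f k x.1 x.2, (hf k x.1 x.2).2⟩) k
  exact ⟨fun k => (t k).1, hb, fun k => (hf k (t k).1 (t k).2).1⟩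

namespace DGModule

open ElementwiseHomology HomDeg

variable {R : DGAlgebra K} {M N P : DGModule R}

/-! ## Shifts -/

/-- The shift of a DG module by `n`, with underlying modules `i ↦ Mᵢ₊ₙ`. -/
abbrev shift (M : DGModule R) (n : ℤ) : DGModule R where
  cx :=
    { X := fun i => M.cx.X (i + n)
      d := fun i j => n.negOnePow • M.cx.d (i + n) (j + n)
      shape := fun i j h => by
        have h : ¬ j + 1 = i := h
        have h' : ¬ (j + n) + 1 = i + n := by omega
        rw [M.cx.shape _ _ h', smul_zero]
      d_comp_d' := fun i j k _ _ => by simp }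
  smul i j k h := (n * i).negOnePow • M.smul i (j + n) (k + n) (by omega)
  one_smul i x := by simpa using M.one_smul (i + n) x
  mul_smul i j k ij jk l h₁ h₂ h₃ h₄ r s x := by
    simp only [LinearMap.smul_apply, LinearMap.map_smul_of_tower]
    rw [M.mul_smul i j (k + n) ij (jk + n) (l + n) h₁ (by omega) (by omega) (by omega), smul_smul,
      ← Int.negOnePow_add, ← mul_add, h₁]
  leibniz i j k i' j' k' hi hj hk h r x := by
    have e := M.leibniz i (j + n) (k + n) i' (j' + n) (k' + n) hi (by omega) (by omega) (by omega)
      r x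
    have hs : ∀ (a b : ℤ) (y : M.cx.X (a + n)), (n.negOnePow • M.cx.d (a + n) (b + n)) y =
      n.negOnePow • M.cx.d (a + n) (b + n) y := fun a b y => rfl
    simp only [LinearMap.smul_apply, hs, LinearMap.map_smul_of_tower]
    rw [e]
    obtain rfl : i = i' + 1 := hi.symm
    simp only [mul_add, mul_one, Int.negOnePow_add, Int.negOnePow_one]
    rcases Int.units_eq_one_or (n * i').negOnePow with h₁ | h₁ <;>
    rcases Int.units_eq_one_or n.negOnePow with h₂ | h₂ <;>
    rcases Int.units_eq_one_or i'.negOnePow with h₃ | h₃ <;>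
    simp [h₁, h₂, h₃]

lemma shift_d (M : DGModule R) (n i j : ℤ) (x : M.cx.X (i + n)) :
    (shift M n).cx.d i j x = n.negOnePow • M.cx.d (i + n) (j + n) x := rfl

lemma shift_smul (M : DGModule R) (n i j k : ℤ) (h : i + j = k) (r : R.cx.X i)
    (x : M.cx.X (j + n)) :
    (shift M n).smul i j k h r x = (n * i).negOnePow • M.smul i (j + n) (k + n) (by omega) r x :=
  rfl

/-- The identity as a homogeneous map `M → M[n]`. -/
def toShift (M : DGModule R) (n m : ℤ) (h : m + n = 0) : HomDeg M (shift M n) m :=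
  HomDeg.mk (fun p q hq => castDeg M.cx (by omega : p = q + n)) (by
    intro i p p' q q' hp hq hq' r x
    rw [shift_smul, smul_castDeg, castDeg_smul, smul_smul, ← Int.negOnePow_add, ← add_mul, h]
    simp)

/-- The identity as a homogeneous map `M[n] → M`. -/
def fromShift (M : DGModule R) (n : ℤ) : HomDeg (shift M n) M n :=
  HomDeg.mk (fun p q hq => castDeg M.cx hq) (by
    intro i p p' q q' hp hq hq' r x
    rw [shift_smul, smul_castDeg, LinearMap.map_smul_of_tower, castDeg_smul])

lemma toShift_app (M : DGModule R) (n m : ℤ) (h : m + n = 0) (p q : ℤ) (hq : p + m = q)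
    (x : M.cx.X p) : (toShift M n m h).app p q hq x = castDeg M.cx (by omega : p = q + n) x := rfl

lemma fromShift_app (M : DGModule R) (n : ℤ) (p q : ℤ) (hq : p + n = q)
    (x : M.cx.X (p + n)) : (fromShift M n).app p q hq x = castDeg M.cx hq x := rfl

lemma homDiff_toShift (M : DGModule R) (n m : ℤ) (h : m + n = 0) (m' : ℤ) (hm : m' + 1 = m) :
    homDiff _ _ m m' hm (toShift M n m h) = 0 := by
  refine HomDeg.ext fun p q hq x => ?_
  rw [homDiff_app _ _ m m' hm _ p (p - 1) (q + 1) q (by omega) (by omega) hq, toShift_app,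
    toShift_app, shift_d, d_castDeg, castDeg_d]
  have e : m.negOnePow = n.negOnePow := by
    rw [Int.negOnePow_eq_iff]
    exact ⟨-n, by omega⟩
  rw [e, sub_self]
  rfl

lemma homDiff_fromShift (M : DGModule R) (n n' : ℤ) (hn : n' + 1 = n) :
    homDiff _ _ n n' hn (fromShift M n) = 0 := by
  refine HomDeg.ext fun p q hq (x : M.cx.X (p + n)) => ?_
  rw [homDiff_app _ _ n n' hn _ p (p - 1) (q + 1) q (by omega) (by omega) hq]
  refine (congrArg₂ (fun a b => M.cx.d (q + 1) q a - n.negOnePow • b)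
    (fromShift_app M n p (q + 1) (by omega) x) (fromShift_app M n (p - 1) q (by omega)
      ((shift M n).cx.d p (p - 1) x))).trans ?_
  rw [d_castDeg, shift_d, LinearMap.map_smul_of_tower, castDeg_d, smul_smul, Int.units_mul_self,
    _root_.one_smul, sub_self]
  rfl

lemma fromShift_comp_toShift (M : DGModule R) (n m : ℤ) (h : m + n = 0) :
    (fromShift M n).comp (toShift M n m h) h = ofHom (𝟙 M) :=
  HomDeg.ext fun p q hq x => by
    obtain rfl : p = q := by omega
    rw [comp_app _ _ _ p (p + m) _ _ rfl, toShift_app]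
    refine (fromShift_app M n _ _ _ _).trans ?_
    rw [castDeg_castDeg, castDeg_self]
    rfl

lemma toShift_comp_fromShift (M : DGModule R) (n m : ℤ) (h : m + n = 0) :
    (toShift M n m h).comp (fromShift M n) (by omega) = ofHom (𝟙 (shift M n)) :=
  HomDeg.ext fun p q hq (x : M.cx.X (p + n)) => by
    obtain rfl : p = q := by omega
    rw [comp_app _ _ _ p (p + n) _ _ rfl, toShift_app]
    refine (congrArg _ (fromShift_app M n _ _ rfl x)).trans ?_
    rw [castDeg_self]
    rfl

/-- Through `s` and `t`, the complex `Hom(N, -)` is a retract of a shift of `Hom(M, -)`: the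
equations are solved for `α s` and `β s`, and the solutions are composed with `t`. -/
lemma IsKProjective.of_comp_eq_id (hM : IsKProjective M) {a b : ℤ} (hab : b + a = 0)
    (s : HomDeg M N a) (t : HomDeg N M b) (hs : homDiff M N a (a - 1) (by omega) s = 0)
    (ht : homDiff N M b (b - 1) (by omega) t = 0) (hst : s.comp t hab = ofHom (𝟙 N)) :
    IsKProjective N := by
  intro X Y g hg
  rw [quasiIso_homPost_iff]
  intro k i j l hk hj hl α β hα hβ
  obtain ⟨α', β', h₁, h₂⟩ := (quasiIso_homPost_iff M g).1 (hM g hg) (a + k) (a + i) (a + j) (a + l)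
    (by omega) (by omega) (by omega) (α.comp s rfl) (β.comp s rfl) (by
      rw [homDiff_comp (n' := a - 1) α s rfl (by omega) hk (by omega), hα, hs]; simp) (by
      rw [homDiff_comp (n' := a - 1) β s rfl (by omega) hj (by omega), hβ, hs, comp_zero,
        smul_zero, add_zero]
      exact (comp_assoc _ _ _ _ _ _ _).symm)
  refine ⟨α'.comp t (by omega), β'.comp t (by omega), ?_, ?_⟩
  · rw [homDiff_comp (m' := a + i) (n' := b - 1) α' t (by omega) hj (by omega) (by omega), h₁, ht,
      comp_zero, smul_zero,
      add_zero, ← comp_assoc α s t hab rfl (by omega) (by omega), hst, comp_ofHom_id]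
  · rw [homDiff_comp (m' := a + j) (n' := b - 1) β' t (by omega) hl (by omega) (by omega), ht,
      comp_zero, smul_zero,
      add_zero, comp_assoc (bc := a + j) _ α' t (by omega) (by omega) (by omega) (by omega),
      ← add_comp, h₂,
      ← comp_assoc β s t hab rfl (by omega) (by omega), hst, comp_ofHom_id]

lemma IsKProjective.shift (hM : IsKProjective M) (n : ℤ) : IsKProjective (M.shift n) :=
  hM.of_comp_eq_id (by omega : n + -n = 0) (toShift M n (-n) (by omega)) (fromShift M n)
    (homDiff_toShift _ _ _ _ _ _) (homDiff_fromShift _ _ _ _) (toShift_comp_fromShift _ _ _ _)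

/-! ## Contractible modules -/

/-- Precomposition with `s` contracts `Hom(M, X)` for every `X`, so the map to be tested goes
between acyclic complexes. -/
lemma isKProjective_of_contractible (s : HomDeg M M 1)
    (hs : homDiff M M 1 0 (by omega) s = ofHom (𝟙 M)) : IsKProjective M := by
  intro X Y g hg
  rw [quasiIso_homPost_iff]
  intro k i j l hk hj hl α β hα hβ
  refine ⟨i.negOnePow • α.comp s (by omega), j.negOnePow • β.comp s (by omega), ?_, ?_⟩
  · rw [LinearMap.map_smul_of_tower, homDiff_comp (n' := 0) α s (by omega) hj hk (by omega), hα, hs,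
      comp_ofHom_id, zero_comp, zero_add, smul_smul, Int.units_mul_self, _root_.one_smul]
  · have e : j.negOnePow = -i.negOnePow := by rw [← hj, Int.negOnePow_succ]
    rw [LinearMap.map_smul_of_tower, homDiff_comp (n' := 0) β s (by omega) hl hj (by omega), hβ, hs,
      comp_ofHom_id, smul_add, smul_smul, Int.units_mul_self, _root_.one_smul, comp_units_smul,
      comp_assoc (bc := i) _ α s (by omega) (by omega) (by omega) (by omega), e, Units.neg_smul]
    abel

lemma isKInjective_of_contractible (s : HomDeg M M 1)
    (hs : homDiff M M 1 0 (by omega) s = ofHom (𝟙 M)) : IsKInjective M := by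
  intro X Y g hg
  rw [quasiIso_homPre_iff]
  intro k i j l hk hj hl α β hα hβ
  refine ⟨s.comp α (by omega), s.comp β (by omega), ?_, ?_⟩
  · rw [homDiff_comp (m' := 0) s α (by omega) hj (by omega) hk, hα, hs, ofHom_id_comp, comp_zero,
      smul_zero,
      add_zero]
  · rw [homDiff_comp (m' := 0) s β (by omega) hl (by omega) hj, hβ, hs, ofHom_id_comp,
      Int.negOnePow_one,
      comp_assoc s α _ (by omega) (by omega) (by omega) (by omega), Units.neg_smul,
      _root_.one_smul]
    abel

/-! ## Constructions from elementwise data -/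

/-- A complex from a family of modules with differentials between consecutive degrees. -/
abbrev buildCx (X : ℤ → Type u) [∀ i, AddCommGroup (X i)] [∀ i, Module K (X i)]
    (d : ∀ i j : ℤ, j + 1 = i → (X i →ₗ[K] X j))
    (dd : ∀ (i j k : ℤ) (h : j + 1 = i) (h' : k + 1 = j) (x : X i), d j k h' (d i j h x) = 0) :
    ChainComplex (ModuleCat.{u} K) ℤ where
  X i := ModuleCat.of K (X i)
  d i j := if h : j + 1 = i then ModuleCat.ofHom (d i j h) else 0
  shape i j h := dif_neg h
  d_comp_d' i j k hij hjk := by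
    rw [dif_pos (show j + 1 = i from hij), dif_pos (show k + 1 = j from hjk)]
    exact ModuleCat.hom_ext (LinearMap.ext fun x => dd i j k hij hjk x)

lemma buildCx_d {X : ℤ → Type u} [∀ i, AddCommGroup (X i)] [∀ i, Module K (X i)]
    {d : ∀ i j : ℤ, j + 1 = i → (X i →ₗ[K] X j)} {dd} (i j : ℤ) (h : j + 1 = i) (x : X i) :
    (buildCx X d dd).d i j x = d i j h x := by
  have e : (buildCx X d dd).d i j = ModuleCat.ofHom (d i j h) := dif_pos h
  rw [e]
  rfl

/-- A DG module from a family of modules with differentials between consecutive degrees. -/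
abbrev build (X : ℤ → Type u) [∀ i, AddCommGroup (X i)] [∀ i, Module K (X i)]
    (d : ∀ i j : ℤ, j + 1 = i → (X i →ₗ[K] X j))
    (smul : ∀ i j k : ℤ, i + j = k → (R.cx.X i →ₗ[K] X j →ₗ[K] X k))
    (dd : ∀ (i j k : ℤ) (h : j + 1 = i) (h' : k + 1 = j) (x : X i), d j k h' (d i j h x) = 0)
    (one_smul : ∀ (i : ℤ) (x : X i), smul 0 i i (zero_add i) R.one x = x)
    (mul_smul : ∀ (i j k ij jk n : ℤ) (h₁ : i + j = ij) (h₂ : j + k = jk) (h₃ : ij + k = n)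
      (h₄ : i + jk = n) (r : R.cx.X i) (s : R.cx.X j) (x : X k),
      smul ij k n h₃ (R.mul i j ij h₁ r s) x = smul i jk n h₄ r (smul j k jk h₂ s x))
    (leibniz : ∀ (i j k i' j' k' : ℤ) (hi : i' + 1 = i) (hj : j' + 1 = j) (hk : k' + 1 = k)
      (h : i + j = k) (r : R.cx.X i) (x : X j),
      d k k' hk (smul i j k h r x) = smul i' j k' (by omega) (R.cx.d i i' r) x +
        i.negOnePow • smul i j' k' (by omega) r (d j j' hj x)) : DGModule R where
  cx := buildCx X d dd
  smul i j k h := smul i j k h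
  one_smul := one_smul
  mul_smul := mul_smul
  leibniz i j k i' j' k' hi hj hk h r x := by
    refine (buildCx_d k k' hk _).trans ((leibniz i j k i' j' k' hi hj hk h r x).trans ?_)
    exact congrArg (fun t => smul i' j k' (by omega) (R.cx.d i i' r) x +
      i.negOnePow • smul i j' k' (by omega) r t) (buildCx_d (dd := dd) j j' hj x).symm

lemma cyl_dd {A B : DGModule R} (σ : HomDeg A B (-1))
    (hσ : homDiff A B (-1) (-2) (by omega) σ = 0) (i j k : ℤ) (h : j + 1 = i) (h' : k + 1 = j)
    (a : A.cx.X i) (b : B.cx.X i) :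
    B.cx.d j k (B.cx.d i j b + σ.app i j (by omega) a) +
      σ.app j k (by omega) (A.cx.d i j a) = 0 := by
  have e := congrArg (fun t => t.app i k (by omega) a) hσ
  rw [homDiff_app A B (-1) (-2) _ σ i j j k h (by omega)] at e
  rw [map_add, d_d, zero_add]
  simpa using e

lemma cyl_leibniz {A B : DGModule R} (σ : HomDeg A B (-1)) (i j k i' j' k' : ℤ) (hi : i' + 1 = i)
    (hj : j' + 1 = j) (hk : k' + 1 = k) (h : i + j = k) (r : R.cx.X i) (a : A.cx.X j)
    (b : B.cx.X j) :
    B.cx.d k k' (B.smul i j k h r b) + σ.app k k' (by omega) (A.smul i j k h r a) =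
      B.smul i' j k' (by omega) (R.cx.d i i' r) b + i.negOnePow • B.smul i j' k' (by omega) r
        (B.cx.d j j' b + σ.app j j' (by omega) a) := by
  rw [B.leibniz i j k i' j' k' hi hj hk h, σ.app_smul i j k j' k' h (by omega) (by omega),
    map_add, smul_add, add_assoc]
  simp [Int.negOnePow_neg]

/-- The extension of `A` by `B` with underlying graded module `A × B` and differential
`(a, b) ↦ (∂a, ∂b + σ a)`. -/
abbrev cyl (A B : DGModule R) (σ : HomDeg A B (-1))
    (hσ : homDiff A B (-1) (-2) (by omega) σ = 0) : DGModule R :=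
  build (fun i => A.cx.X i × B.cx.X i)
    (fun i j h => ((A.cx.d i j).hom ∘ₗ LinearMap.fst K (A.cx.X i) (B.cx.X i)).prod
      ((B.cx.d i j).hom ∘ₗ LinearMap.snd K (A.cx.X i) (B.cx.X i) +
        σ.app i j (by omega) ∘ₗ LinearMap.fst K (A.cx.X i) (B.cx.X i)))
    (fun i j k h => LinearMap.mk₂ K (fun r x => (A.smul i j k h r x.1, B.smul i j k h r x.2))
      (fun r s x => by simp) (fun c r x => by simp) (fun r x y => by simp) (fun c r x => by simp))
    (fun i j k h h' x => Prod.ext (d_d _ _ _ _ _) (cyl_dd σ hσ i j k h h' x.1 x.2))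
    (fun i x => Prod.ext (A.one_smul i x.1) (B.one_smul i x.2))
    (fun i j k ij jk n h₁ h₂ h₃ h₄ r s x =>
      Prod.ext (A.mul_smul i j k ij jk n h₁ h₂ h₃ h₄ r s x.1)
        (B.mul_smul i j k ij jk n h₁ h₂ h₃ h₄ r s x.2))
    (fun i j k i' j' k' hi hj hk h r x =>
      Prod.ext (A.leibniz i j k i' j' k' hi hj hk h r x.1)
        (cyl_leibniz σ i j k i' j' k' hi hj hk h r x.1 x.2))

section

variable {A B : DGModule R} {σ : HomDeg A B (-1)} {hσ : homDiff A B (-1) (-2) (by omega) σ = 0}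

lemma cyl_d (i j : ℤ) (h : j + 1 = i) (x : (cyl A B σ hσ).cx.X i) :
    (cyl A B σ hσ).cx.d i j x =
      (A.cx.d i j x.1, B.cx.d i j x.2 + σ.app i j (by omega) x.1) := by
  have e : (cyl A B σ hσ).cx.d i j = ModuleCat.ofHom _ := dif_pos h
  rw [e]
  rfl

/-- The projection of an extension. -/
def cylFst : cyl A B σ hσ ⟶ A where
  hom :=
    { f := fun i => ModuleCat.ofHom (LinearMap.fst K _ _)
      comm' := fun i j hij => by
        refine ModuleCat.hom_ext (LinearMap.ext fun x => ?_)
        exact (congrArg Prod.fst (cyl_d (hσ := hσ) i j hij x)).symm }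
  map_smul i j k h r x := rfl

/-- The inclusion into an extension. -/
def cylInr : B ⟶ cyl A B σ hσ where
  hom :=
    { f := fun i => ModuleCat.ofHom (LinearMap.inr K _ _)
      comm' := fun i j hij => by
        refine ModuleCat.hom_ext (LinearMap.ext fun x => ?_)
        refine (cyl_d (hσ := hσ) i j hij (0, x)).trans ?_
        simp }
  map_smul i j k h r x := Prod.ext (map_zero _).symm rfl

/-- The extension is the cone of an isomorphism with inverse `ρ`; the contraction is `(a, b) ↦ (ρ b,
0)`. -/
lemma exists_cyl_contraction (ρ : HomDeg B A 1) (hρ : homDiff B A 1 0 (by omega) ρ = 0)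
    (h₁ : ρ.comp σ (by omega) = ofHom (𝟙 A)) (h₂ : σ.comp ρ (by omega) = ofHom (𝟙 B)) :
    ∃ s : HomDeg (cyl A B σ hσ) (cyl A B σ hσ) 1, homDiff _ _ 1 0 (by omega) s = ofHom (𝟙 _) := by
  refine ⟨HomDeg.mk (fun p q hq => LinearMap.inl K _ _ ∘ₗ ρ.app p q hq ∘ₗ LinearMap.snd K _ _)
    (fun i p p' q q' hp hq hq' r x => Prod.ext (ρ.app_smul i p p' q q' hp hq hq' r x.2) ?_),
    HomDeg.ext fun p q hq x => ?_⟩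
  · change 0 = (((1 * i).negOnePow • (cyl A B σ hσ).smul i q q' _ r
      ((ρ.app p q hq x.2, 0) : A.cx.X q × B.cx.X q) : (cyl A B σ hσ).cx.X q')).2
    rcases Int.units_eq_one_or (1 * i).negOnePow with h | h <;> rw [h] <;>
    simp [cyl]
  · obtain rfl : p = q := by omega
    rw [homDiff_app _ _ 1 0 _ _ p (p - 1) (p + 1) p (by omega) rfl]
    rw [cyl_d (p + 1) p rfl, cyl_d p (p - 1) (by omega)]
    have e₁ := congrArg (fun t => t.app p p (add_zero p) x.1) h₁
    have e₂ := congrArg (fun t => t.app p p (add_zero p) x.2) h₂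
    have e₃ := congrArg (fun t => t.app p p (add_zero p) x.2) hρ
    rw [homDiff_app _ _ 1 0 _ _ p (p - 1) (p + 1) p (by omega) rfl] at e₃
    rw [comp_app _ _ _ p (p - 1) _ _ rfl] at e₁
    rw [comp_app _ _ _ p (p + 1) _ _ rfl] at e₂
    simp only [Int.negOnePow_one, Units.neg_smul, _root_.one_smul, sub_neg_eq_add] at e₃ ⊢
    refine Prod.ext ?_ ?_
    · change A.cx.d (p + 1) p (ρ.app p (p + 1) _ x.2) + ρ.app (p - 1) p _
        (B.cx.d p (p - 1) x.2 + σ.app p (p - 1) _ x.1) = x.1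
      rw [map_add, ← add_assoc, e₃, e₁]
      exact zero_add x.1
    · change B.cx.d (p + 1) p 0 + σ.app (p + 1) p _ (ρ.app p (p + 1) _ x.2) + 0 = x.2
      rw [map_zero, zero_add, add_zero, e₂]
      rfl

end

end DGModule

namespace DGModule

open ElementwiseHomology HomDeg

variable {R : DGAlgebra K} {M N P : DGModule R}

/-! ## Twisting the differential -/

/-- The module `M` with the differential `∂ + τ`. -/
abbrev twist (M : DGModule R) (τ : HomDeg M M (-1))
    (hτ : homDiff M M (-1) (-2) (by omega) τ + τ.comp τ (by omega) = 0) : DGModule R :=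
  build (fun i => M.cx.X i) (fun i j h => (M.cx.d i j).hom + τ.app i j (by omega)) M.smul
    (fun i j k h h' x => by
      -- The hypothesis `∂τ + τ∂ + τ² = 0` is what remains of `(∂ + τ)² = 0` after `∂² = 0`.
      have e := congrArg (fun t => t.app i k (by omega) x) hτ
      simp only [HomDeg.add_app, LinearMap.add_apply] at e
      rw [homDiff_app M M (-1) (-2) _ τ i j j k h (by omega),
        comp_app _ _ _ i j _ _ (by omega)] at e
      change M.cx.d j k (M.cx.d i j x + τ.app i j _ x) +
        τ.app j k _ (M.cx.d i j x + τ.app i j _ x) = 0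
      rw [map_add, map_add, d_d, zero_add, ← add_assoc]
      simpa using e)
    M.one_smul M.mul_smul
    (fun i j k i' j' k' hi hj hk h r x => by
      change M.cx.d k k' (M.smul i j k h r x) + τ.app k k' _ (M.smul i j k h r x) =
        M.smul i' j k' _ (R.cx.d i i' r) x + i.negOnePow • M.smul i j' k' _ r
          (M.cx.d j j' x + τ.app j j' _ x)
      rw [M.leibniz i j k i' j' k' hi hj hk h, τ.app_smul i j k j' k' h (by omega) (by omega),
        map_add, smul_add, add_assoc]
      simp [Int.negOnePow_neg])

section

variable {τ : HomDeg M M (-1)}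
    {hτ : homDiff M M (-1) (-2) (by omega) τ + τ.comp τ (by omega) = 0}

lemma twist_d (i j : ℤ) (h : j + 1 = i) (x : M.cx.X i) :
    (twist M τ hτ).cx.d i j x = M.cx.d i j x + τ.app i j (by omega) x := by
  have e : (twist M τ hτ).cx.d i j = ModuleCat.ofHom _ := dif_pos h
  rw [e]
  rfl

variable (τ hτ) in
/-- The identity as a homogeneous map into the twisted module. -/
def toTwist : HomDeg M (twist M τ hτ) 0 :=
  HomDeg.mk (fun p q hq => castDeg M.cx (by omega)) (by
    intro i p p' q q' hp hq hq' r x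
    obtain rfl : p = q := by omega
    obtain rfl : p' = q' := by omega
    simp)

variable (τ hτ) in
/-- The identity as a homogeneous map out of the twisted module. -/
def fromTwist : HomDeg (twist M τ hτ) M 0 :=
  HomDeg.mk (fun p q hq => castDeg M.cx (by omega)) (by
    intro i p p' q q' hp hq hq' r x
    obtain rfl : p = q := by omega
    obtain rfl : p' = q' := by omega
    simp)

lemma toTwist_app (p : ℤ) (x : M.cx.X p) : (toTwist τ hτ).app p p (add_zero p) x = x := rfl

lemma fromTwist_comp_toTwist :
    (fromTwist τ hτ).comp (toTwist τ hτ) (add_zero 0) = ofHom (𝟙 M) :=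
  HomDeg.ext fun p q hq x => by
    obtain rfl : p = q := by omega
    rw [comp_app _ _ _ p p _ _ (add_zero p)]
    rfl

lemma toTwist_comp_fromTwist :
    (toTwist τ hτ).comp (fromTwist τ hτ) (add_zero 0) = ofHom (𝟙 (twist M τ hτ)) :=
  HomDeg.ext fun p q hq x => by
    obtain rfl : p = q := by omega
    rw [comp_app _ _ _ p p _ _ (add_zero p)]
    rfl

/-- The identity fails to be a chain map exactly by the twist. For total modules this gives the
boundaries of the inclusions and projections. -/
lemma homDiff_toTwist : homDiff _ _ 0 (-1) (by omega) (toTwist τ hτ) =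
    (toTwist τ hτ).comp τ (by omega) :=
  HomDeg.ext fun p q hq x => by
    rw [homDiff_app _ _ 0 (-1) _ _ p q p q (by omega) (by omega), comp_app _ _ _ p q _ _ hq,
      toTwist_app, toTwist_app, toTwist_app, twist_d p q (by omega)]
    simp

lemma homDiff_fromTwist : homDiff _ _ 0 (-1) (by omega) (fromTwist τ hτ) =
    -τ.comp (fromTwist τ hτ) (by omega) :=
  HomDeg.ext fun p q hq (x : M.cx.X p) => by
    rw [homDiff_app _ _ 0 (-1) _ _ p q p q (by omega) (by omega), neg_app, LinearMap.neg_apply,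
      comp_app _ _ _ p p _ _ (add_zero p)]
    refine (congrArg (fun t => M.cx.d p q x - (0 : ℤ).negOnePow • t)
      (twist_d (hτ := hτ) p q (by omega) x)).trans ?_
    rw [Int.negOnePow_zero, _root_.one_smul, sub_add_cancel_left]
    rfl

end

/-! ## Families of homogeneous maps with a universal property -/

/-- Homogeneous maps out of `T` correspond to families of homogeneous maps. -/
def IsCoproduct {A : Type*} {G : A → DGModule R} {T : DGModule R}
    (ι : ∀ a, HomDeg (G a) T 0) : Prop :=
  ∀ (Y : DGModule R) (n : ℤ), Function.Bijective
    fun (F : HomDeg T Y n) (a : A) => F.comp (ι a) (zero_add n)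

/-- Homogeneous maps into `T` correspond to families of homogeneous maps. -/
def IsProduct {A : Type*} {G : A → DGModule R} {T : DGModule R}
    (π : ∀ a, HomDeg T (G a) 0) : Prop :=
  ∀ (Y : DGModule R) (n : ℤ), Function.Bijective
    fun (F : HomDeg Y T n) (a : A) => (π a).comp F (add_zero n)

/-- The universal property concerns homogeneous maps and not differentials, and twisting leaves the
graded module unchanged. -/
lemma IsCoproduct.toTwist {A : Type*} {G : A → DGModule R} {ι : ∀ a, HomDeg (G a) M 0}
    (h : IsCoproduct ι) (τ : HomDeg M M (-1)) (hτ) :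
    IsCoproduct fun a => (toTwist τ hτ).comp (ι a) (add_zero 0) := by
  refine fun Y n => ⟨fun F F' e => ?_, fun f => ?_⟩
  · have e' : F.comp (DGModule.toTwist τ hτ) (zero_add n) =
        F'.comp (DGModule.toTwist τ hτ) (zero_add n) := (h Y n).1 (funext fun a => by
      have := congrFun e a
      dsimp only at this ⊢
      rwa [comp_assoc F _ (ι a) _ (zero_add n) _ (zero_add n),
        comp_assoc F' _ (ι a) _ (zero_add n) _ (zero_add n)] at this)
    rw [← comp_ofHom_id F (zero_add n), ← comp_ofHom_id F' (zero_add n),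
      ← toTwist_comp_fromTwist, comp_assoc F _ _ _ (zero_add n) _ (zero_add n), e',
      ← comp_assoc]
  · obtain ⟨F, rfl⟩ := (h Y n).2 f
    refine ⟨F.comp (fromTwist τ hτ) (zero_add n), funext fun a => ?_⟩
    dsimp only
    rw [comp_assoc _ _ (ι a) _ (zero_add n) _ (zero_add n),
      ← comp_assoc F _ _ (add_zero 0) (zero_add n) (zero_add n) (zero_add n),
      fromTwist_comp_toTwist, comp_ofHom_id]

lemma IsProduct.fromTwist {A : Type*} {G : A → DGModule R} {π : ∀ a, HomDeg M (G a) 0}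
    (h : IsProduct π) (τ : HomDeg M M (-1)) (hτ) :
    IsProduct fun a => (π a).comp (fromTwist τ hτ) (add_zero 0) := by
  refine fun Y n => ⟨fun F F' e => ?_, fun f => ?_⟩
  · have e' : (DGModule.fromTwist τ hτ).comp F (add_zero n) =
        (DGModule.fromTwist τ hτ).comp F' (add_zero n) := (h Y n).1 (funext fun a => by
      have := congrFun e a
      dsimp only at this ⊢
      rwa [← comp_assoc (π a) _ F (add_zero n) _ (add_zero n),
        ← comp_assoc (π a) _ F' (add_zero n) _ (add_zero n)] at this)
    rw [← ofHom_id_comp F (add_zero n), ← ofHom_id_comp F' (add_zero n),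
      ← toTwist_comp_fromTwist, ← comp_assoc _ _ F (add_zero n) (add_zero 0) (add_zero n), e',
      ← comp_assoc]
  · obtain ⟨F, rfl⟩ := (h Y n).2 f
    refine ⟨(DGModule.toTwist τ hτ).comp F (add_zero n), funext fun a => ?_⟩
    dsimp only
    rw [← comp_assoc (π a) _ _ (add_zero n) _ (add_zero n),
      comp_assoc _ _ F (add_zero n) (add_zero 0) (add_zero n) (add_zero n),
      fromTwist_comp_toTwist, ofHom_id_comp]

/-- If the inclusions are chain maps, `Hom(M, -)` is the product of the complexes `Hom(G a, -)`: the
equations are solved on each summand and the solutions are glued. -/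
lemma IsCoproduct.isKProjective {A : Type*} {G : A → DGModule R} {ι : ∀ a, HomDeg (G a) M 0}
    (h : IsCoproduct ι) (hι : ∀ a, homDiff _ _ 0 (-1) (by omega) (ι a) = 0)
    (hG : ∀ a, IsKProjective (G a)) : IsKProjective M := by
  intro X Y g hg
  rw [quasiIso_homPost_iff]
  intro k i j l hk hj hl α β hα hβ
  have hd : ∀ {Z : DGModule R} {m m' : ℤ} (hm : m' + 1 = m) (f : HomDeg M Z m) (a : A),
      homDiff _ _ m m' hm (f.comp (ι a) (zero_add m)) =
        (homDiff _ _ m m' hm f).comp (ι a) (zero_add m') := fun hm f a => by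
    rw [homDiff_comp f (ι a) _ hm hm (by omega : (-1 : ℤ) + 1 = 0), hι]
    simp
  have key := fun a => (quasiIso_homPost_iff (G a) g).1 (hG a g hg) k i j l hk hj hl
    (α.comp (ι a) (zero_add i)) (β.comp (ι a) (zero_add j)) (by rw [hd, hα, zero_comp])
    (by rw [hd, hβ, comp_assoc])
  choose α' β' h₁ h₂ using key
  obtain ⟨F, hF⟩ := (h X j).2 α'
  obtain ⟨F', hF'⟩ := (h Y l).2 β'
  refine ⟨F, F', (h _ _).1 (funext fun a => ?_), (h _ _).1 (funext fun a => ?_)⟩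
  · have := congrFun hF a
    dsimp only at this ⊢
    rw [← hd, this, h₁]
  · have e := congrFun hF a
    have e' := congrFun hF' a
    dsimp only at e e' ⊢
    rw [add_comp, ← hd, e', ← h₂, ← comp_assoc _ _ _ (zero_add j) _ _ _, e]

lemma IsProduct.isKInjective {A : Type*} {G : A → DGModule R} {π : ∀ a, HomDeg M (G a) 0}
    (h : IsProduct π) (hπ : ∀ a, homDiff _ _ 0 (-1) (by omega) (π a) = 0)
    (hG : ∀ a, IsKInjective (G a)) : IsKInjective M := by
  intro X Y g hg
  rw [quasiIso_homPre_iff]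
  intro k i j l hk hj hl α β hα hβ
  have hd : ∀ {Z : DGModule R} {m m' : ℤ} (hm : m' + 1 = m) (f : HomDeg Z M m) (a : A),
      homDiff _ _ m m' hm ((π a).comp f (add_zero m)) =
        (π a).comp (homDiff _ _ m m' hm f) (add_zero m') := fun hm f a => by
    rw [homDiff_comp (π a) f _ hm (by omega : (-1 : ℤ) + 1 = 0) hm, hπ]
    simp
  have key := fun a => (quasiIso_homPre_iff g (G a)).1 (hG a g hg) k i j l hk hj hl
    ((π a).comp α (add_zero i)) ((π a).comp β (add_zero j)) (by rw [hd, hα, comp_zero])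
    (by rw [hd, hβ, comp_assoc])
  choose α' β' h₁ h₂ using key
  obtain ⟨F, hF⟩ := (h _ j).2 α'
  obtain ⟨F', hF'⟩ := (h _ l).2 β'
  refine ⟨F, F', (h _ _).1 (funext fun a => ?_), (h _ _).1 (funext fun a => ?_)⟩
  · have := congrFun hF a
    dsimp only at this ⊢
    rw [← hd, this, h₁]
  · have e := congrFun hF a
    have e' := congrFun hF' a
    dsimp only at e e' ⊢
    rw [comp_add, ← hd, e', ← h₂, comp_assoc _ _ _ _ (add_zero j) _ _, e]

/-! ## Total modules of sequences -/

/-- Here `M` is the direct sum of the `G k` with differential `∂ + δ`, filtered by its partial sums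
with the K-projective quotients `G k`. The equations on `G (n + 1)` differ from those of a plain
direct sum by a term that involves the solution on `G n`, so the solutions are found one after
another. -/
lemma IsCoproduct.isKProjective_of_sequence {G : ℕ → DGModule R} {ι : ∀ k, HomDeg (G k) M 0}
    (h : IsCoproduct ι) (δ : ∀ k, HomDeg (G (k + 1)) (G k) (-1))
    (hδ : ∀ k, homDiff _ _ (-1) (-2) (by omega) (δ k) = 0)
    (hδδ : ∀ k, (δ k).comp (δ (k + 1)) (by omega : -1 + -1 = -2) = 0)
    (h₀ : homDiff _ _ 0 (-1) (by omega) (ι 0) = 0)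
    (hι : ∀ k, homDiff _ _ 0 (-1) (by omega) (ι (k + 1)) = (ι k).comp (δ k) (by omega))
    (hG : ∀ k, IsKProjective (G k)) : IsKProjective M := by
  intro X Y g hg
  rw [quasiIso_homPost_iff]
  intro k i j l hk hj hl α β hα hβ
  have hsj : j.negOnePow = -i.negOnePow := by rw [← hj, Int.negOnePow_succ]
  have hsl : l.negOnePow = i.negOnePow := by rw [← hl, Int.negOnePow_succ, hsj, neg_neg]
  have hd₀ : ∀ {Z : DGModule R} {m m' : ℤ} (hm : m' + 1 = m) (f : HomDeg M Z m),
      homDiff _ _ m m' hm (f.comp (ι 0) (zero_add m)) =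
        (homDiff _ _ m m' hm f).comp (ι 0) (zero_add m') := fun hm f => by
    rw [homDiff_comp f (ι 0) _ hm hm (by omega : (-1 : ℤ) + 1 = 0), h₀]
    simp
  have hd : ∀ {Z : DGModule R} {m m' : ℤ} (hm : m' + 1 = m) (f : HomDeg M Z m) (n : ℕ),
      homDiff _ _ m m' hm (f.comp (ι (n + 1)) (zero_add m)) =
        (homDiff _ _ m m' hm f).comp (ι (n + 1)) (zero_add m') +
          m.negOnePow • (f.comp (ι n) (zero_add m)).comp (δ n) (by omega) := fun hm f n => by
    rw [homDiff_comp f (ι (n + 1)) _ hm hm (by omega : (-1 : ℤ) + 1 = 0), hι, comp_assoc]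
  have hdδ : ∀ {Z : DGModule R} {m m' : ℤ} (hm : m' + 1 = m) (n : ℕ) (f : HomDeg (G n) Z m)
      (s : ℤ) (hs : -1 + m' = s),
      homDiff _ _ m' s (by omega) (f.comp (δ n) (by omega)) =
        (homDiff _ _ m m' hm f).comp (δ n) hs := fun {Z m m'} hm n f s hs => by
    rw [homDiff_comp f (δ n) _ (by omega) hm (by omega : (-2 : ℤ) + 1 = -1), hδ]
    simp
  have hc : ∀ {Z : DGModule R} {m : ℤ} (n : ℕ) (f : HomDeg (G n) Z m) (s t : ℤ)
      (hs : -1 + m = s) (ht : -1 + s = t), (f.comp (δ n) hs).comp (δ (n + 1)) ht = 0 :=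
    fun {Z m} n f s t hs ht => by
      rw [← comp_assoc f (δ n) (δ (n + 1)) (by omega : -1 + -1 = -2) hs (by omega) ht, hδδ,
        comp_zero]
  let α₁ := fun n => α.comp (ι n) (zero_add i)
  let β₁ := fun n => β.comp (ι n) (zero_add j)
  -- The invariant keeps the equations on `G n` only after composition with `δ n`. The next step
  -- needs no more, and the correction from `G (n - 1)` disappears there because `δδ = 0`.
  obtain ⟨s, ⟨hs₁, hs₂⟩, hs⟩ := exists_dependent_seq
    (X := fun n => HomDeg (G n) X j × HomDeg (G n) Y l)
    (fun x => homDiff _ _ j i hj x.1 = α₁ 0 ∧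
      (ofHom g).comp x.1 (add_zero j) + homDiff _ _ l j hl x.2 = β₁ 0)
    (fun n x => (homDiff _ _ j i hj x.1).comp (δ n) (by omega : -1 + i = k) =
        (α₁ n).comp (δ n) (by omega) ∧
      ((ofHom g).comp x.1 (add_zero j) + homDiff _ _ l j hl x.2).comp (δ n)
        (by omega : -1 + j = i) = (β₁ n).comp (δ n) (by omega))
    (fun n x x' => homDiff _ _ j i hj x'.1 =
        α₁ (n + 1) + j.negOnePow • x.1.comp (δ n) (by omega) ∧
      (ofHom g).comp x'.1 (add_zero j) + homDiff _ _ l j hl x'.2 =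
        β₁ (n + 1) + l.negOnePow • x.2.comp (δ n) (by omega))
    (by
      obtain ⟨a, b, h₁, h₂⟩ := (quasiIso_homPost_iff (G 0) g).1 (hG 0 g hg) k i j l hk hj hl
        (α₁ 0) (β₁ 0) (by rw [hd₀, hα, zero_comp]) (by rw [hd₀, hβ, comp_assoc])
      exact ⟨(a, b), ⟨h₁, h₂⟩, by rw [h₁], by rw [h₂]⟩)
    (by
      rintro n ⟨a, b⟩ ⟨h₁, h₂⟩
      dsimp only [α₁, β₁] at h₁ h₂
      obtain ⟨a', b', h₁', h₂'⟩ := (quasiIso_homPost_iff (G (n + 1)) g).1 (hG _ g hg) k i j l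
        hk hj hl (α₁ (n + 1) + j.negOnePow • a.comp (δ n) (by omega))
        (β₁ (n + 1) + l.negOnePow • b.comp (δ n) (by omega)) (by
          rw [map_add, LinearMap.map_smul_of_tower, hdδ hj n a k (by omega), h₁, hd, hα, zero_comp,
            zero_add, hsj, Units.neg_smul, add_neg_cancel]) (by
          rw [add_comp, ← eq_sub_iff_add_eq'] at h₂
          rw [map_add, LinearMap.map_smul_of_tower, hdδ hl n b i (by omega), h₂, hd, hβ, comp_add,
            comp_units_smul, comp_assoc _ a (δ n) _ (add_zero j) _ (by omega), hsl, hsj, smul_sub,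
            comp_assoc (ofHom g) α (ι (n + 1)) (zero_add i) (add_zero i) (add_zero i) (zero_add i)]
          simp only [Units.neg_smul]
          abel)
      exact ⟨(a', b'), ⟨h₁', h₂'⟩, by
        rw [h₁', add_comp, units_smul_comp, hc, smul_zero, add_zero], by
        rw [h₂', add_comp, units_smul_comp, hc, smul_zero, add_zero]⟩)
  obtain ⟨F, hF⟩ := (h X j).2 fun n => (s n).1
  obtain ⟨F', hF'⟩ := (h Y l).2 fun n => (s n).2
  refine ⟨F, F', (h _ _).1 (funext fun n => ?_), (h _ _).1 (funext fun n => ?_)⟩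
  · have e := fun n => congrFun hF n
    dsimp only at e ⊢
    rcases n with _ | n
    · rw [← hd₀, e, hs₁]
    · rw [← add_left_inj, ← hd, e, e, (hs n).1]
  · have e := fun n => congrFun hF n
    have e' := fun n => congrFun hF' n
    dsimp only at e e' ⊢
    rw [add_comp, ← comp_assoc _ _ _ (zero_add j) (add_zero j) (add_zero j) (zero_add j), e]
    rcases n with _ | n
    · rw [← hd₀, e', hs₂]
    · rw [← add_left_inj, add_assoc, ← hd, e', e', (hs n).2]

/-- The dual successive construction: `δ` leads from `G k` to `G (k + 1)`, so the equation for the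
component at `k + 1` involves only the solution at `k`. The sign in `hπ` is that of a projection out
of a twisted module. -/
lemma IsProduct.isKInjective_of_sequence {G : ℕ → DGModule R} {π : ∀ k, HomDeg M (G k) 0}
    (h : IsProduct π) (δ : ∀ k, HomDeg (G k) (G (k + 1)) (-1))
    (hδ : ∀ k, homDiff _ _ (-1) (-2) (by omega) (δ k) = 0)
    (hδδ : ∀ k, (δ (k + 1)).comp (δ k) (by omega : -1 + -1 = -2) = 0)
    (h₀ : homDiff _ _ 0 (-1) (by omega) (π 0) = 0)
    (hπ : ∀ k, homDiff _ _ 0 (-1) (by omega) (π (k + 1)) = -(δ k).comp (π k) (by omega))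
    (hG : ∀ k, IsKInjective (G k)) : IsKInjective M := by
  intro X Y g hg
  rw [quasiIso_homPre_iff]
  intro k i j l hk hj hl α β hα hβ
  have hd₀ : ∀ {Z : DGModule R} {m m' : ℤ} (hm : m' + 1 = m) (f : HomDeg Z M m),
      homDiff _ _ m m' hm ((π 0).comp f (add_zero m)) =
        (π 0).comp (homDiff _ _ m m' hm f) (add_zero m') := fun hm f => by
    rw [homDiff_comp (π 0) f _ hm (by omega : (-1 : ℤ) + 1 = 0) hm, h₀]
    simp
  have hd : ∀ {Z : DGModule R} {m m' : ℤ} (hm : m' + 1 = m) (f : HomDeg Z M m) (n : ℕ),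
      homDiff _ _ m m' hm ((π (n + 1)).comp f (add_zero m)) =
        (π (n + 1)).comp (homDiff _ _ m m' hm f) (add_zero m') -
          (δ n).comp ((π n).comp f (add_zero m)) (by omega) := fun hm f n => by
    rw [homDiff_comp (π (n + 1)) f _ hm (by omega : (-1 : ℤ) + 1 = 0) hm, hπ, neg_comp,
      comp_assoc (δ n) (π n) f (add_zero _) (zero_add (-1)) _ (by omega), Int.negOnePow_zero,
      _root_.one_smul]
    abel
  have hdδ : ∀ {Z : DGModule R} {m m' : ℤ} (hm : m' + 1 = m) (n : ℕ) (f : HomDeg Z (G n) m)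
      (s : ℤ) (hs : m' + -1 = s),
      homDiff _ _ m' s (by omega) ((δ n).comp f (by omega)) =
        -(δ n).comp (homDiff _ _ m m' hm f) hs := fun {Z m m'} hm n f s hs => by
    rw [homDiff_comp (δ n) f _ (by omega) (by omega : (-2 : ℤ) + 1 = -1) hm, hδ]
    simp
  have hc : ∀ {Z : DGModule R} {m : ℤ} (n : ℕ) (f : HomDeg Z (G n) m) (s t : ℤ)
      (hs : m + -1 = s) (ht : s + -1 = t), (δ (n + 1)).comp ((δ n).comp f hs) ht = 0 :=
    fun {Z m} n f s t hs ht => by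
      rw [comp_assoc (δ (n + 1)) (δ n) f hs (by omega : -1 + -1 = -2) ht (by omega), hδδ,
        zero_comp]
  let α₁ := fun n => (π n).comp α (add_zero i)
  let β₁ := fun n => (π n).comp β (add_zero j)
  obtain ⟨s, ⟨hs₁, hs₂⟩, hs⟩ := exists_dependent_seq
    (X := fun n => HomDeg Y (G n) j × HomDeg X (G n) l)
    (fun x => homDiff _ _ j i hj x.1 = α₁ 0 ∧
      x.1.comp (ofHom g) (zero_add j) + homDiff _ _ l j hl x.2 = β₁ 0)
    (fun n x => (δ n).comp (homDiff _ _ j i hj x.1) (by omega : i + -1 = k) =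
        (δ n).comp (α₁ n) (by omega) ∧
      (δ n).comp (x.1.comp (ofHom g) (zero_add j) + homDiff _ _ l j hl x.2)
        (by omega : j + -1 = i) = (δ n).comp (β₁ n) (by omega))
    (fun n x x' => homDiff _ _ j i hj x'.1 =
        α₁ (n + 1) - (δ n).comp x.1 (by omega) ∧
      x'.1.comp (ofHom g) (zero_add j) + homDiff _ _ l j hl x'.2 =
        β₁ (n + 1) - (δ n).comp x.2 (by omega))
    (by
      obtain ⟨a, b, h₁, h₂⟩ := (quasiIso_homPre_iff g (G 0)).1 (hG 0 g hg) k i j l hk hj hl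
        (α₁ 0) (β₁ 0) (by rw [hd₀, hα, comp_zero]) (by rw [hd₀, hβ, comp_assoc])
      exact ⟨(a, b), ⟨h₁, h₂⟩, by rw [h₁], by rw [h₂]⟩)
    (by
      rintro n ⟨a, b⟩ ⟨h₁, h₂⟩
      dsimp only [α₁, β₁] at h₁ h₂
      obtain ⟨a', b', h₁', h₂'⟩ := (quasiIso_homPre_iff g (G (n + 1))).1 (hG _ g hg) k i j l
        hk hj hl (α₁ (n + 1) - (δ n).comp a (by omega))
        (β₁ (n + 1) - (δ n).comp b (by omega)) (by
          rw [map_sub, hdδ hj n a k (by omega), h₁, hd, hα, comp_zero]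
          abel) (by
          rw [comp_add, ← eq_sub_iff_add_eq'] at h₂
          rw [map_sub, hdδ hl n b i (by omega), h₂, hd, hβ, sub_comp,
            ← comp_assoc (δ n) a _ (zero_add j) (by omega : j + -1 = i) (by omega) (zero_add i),
            comp_assoc (π (n + 1)) α (ofHom g) (zero_add i) (add_zero i) (add_zero i) (zero_add i)]
          abel)
      exact ⟨(a', b'), ⟨h₁', h₂'⟩, by
        rw [h₁', comp_sub, hc, sub_zero], by
        rw [h₂', comp_sub, hc, sub_zero]⟩)
  obtain ⟨F, hF⟩ := (h _ j).2 fun n => (s n).1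
  obtain ⟨F', hF'⟩ := (h _ l).2 fun n => (s n).2
  refine ⟨F, F', (h _ _).1 (funext fun n => ?_), (h _ _).1 (funext fun n => ?_)⟩
  · have e := fun n => congrFun hF n
    dsimp only at e ⊢
    rcases n with _ | n
    · rw [← hd₀, e, hs₁]
    · rw [← sub_left_inj, ← hd, e, e, (hs n).1]
  · have e := fun n => congrFun hF n
    have e' := fun n => congrFun hF' n
    dsimp only at e e' ⊢
    rw [comp_add, comp_assoc _ _ _ (zero_add j) (add_zero j) (add_zero j) (zero_add j), e]
    rcases n with _ | n
    · rw [← hd₀, e', hs₂]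
    · rw [← sub_left_inj, add_sub_assoc, ← hd, e', e', (hs n).2]

end DGModule

namespace DGModule

open ElementwiseHomology HomDeg

variable {R : DGAlgebra K} {M N P : DGModule R}

/-! ## Direct sums -/

section

variable {A : Type u} (G : A → DGModule R)

/-- The direct sum of DG modules. -/
abbrev dsum : DGModule R :=
  build (fun i => Π₀ a, (G a).cx.X i)
    (fun i j h => DFinsupp.mapRange.linearMap fun a => ((G a).cx.d i j).hom)
    (fun i j k h => LinearMap.mk₂ K
      (fun r x => DFinsupp.mapRange.linearMap (fun a => (G a).smul i j k h r) x)
      (fun r s x => DFinsupp.ext fun a => by simp) (fun c r x => DFinsupp.ext fun a => by simp)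
      (fun r x y => map_add _ x y) (fun c r x => map_smul _ c x))
    (fun i j k h h' x => DFinsupp.ext fun a => d_d (G a).cx i j k (x a))
    (fun i x => DFinsupp.ext fun a => (G a).one_smul i (x a))
    (fun i j k ij jk n h₁ h₂ h₃ h₄ r s x => DFinsupp.ext fun a =>
      (G a).mul_smul i j k ij jk n h₁ h₂ h₃ h₄ r s (x a))
    (fun i j k i' j' k' hi hj hk h r x => DFinsupp.ext fun a =>
      (G a).leibniz i j k i' j' k' hi hj hk h r (x a))

variable {G}

lemma dsum_d (i j : ℤ) (h : j + 1 = i) (x : (dsum G).cx.X i) (a : A) :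
    DFinsupp.toFun ((dsum G).cx.d i j x) a = (G a).cx.d i j (DFinsupp.toFun x a) := by
  have e : (dsum G).cx.d i j = ModuleCat.ofHom _ := dif_pos h
  rw [e]
  rfl

variable (G)

open Classical in
/-- The inclusion of a summand, in a fixed degree. -/
def inclLinear (a : A) (i : ℤ) : (G a).cx.X i →ₗ[K] Π₀ a, (G a).cx.X i :=
  DFinsupp.lsingle (R := K) (M := fun a => (G a).cx.X i) a

open Classical in
/-- The inclusion of a summand. -/
def incl (a : A) : G a ⟶ dsum G where
  hom :=
    { f := fun i => ModuleCat.ofHom (inclLinear G a i)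
      comm' := fun i j hij => by
        refine ModuleCat.hom_ext (LinearMap.ext fun x => ?_)
        have e : (dsum G).cx.d i j = ModuleCat.ofHom _ := dif_pos hij
        rw [e]
        exact DFinsupp.mapRange_single (β₁ := fun a => (G a).cx.X i) (β₂ := fun a => (G a).cx.X j)
          (f := fun a => (G a).cx.d i j) (hf := fun a => map_zero _) (i := a) (b := x) }
  map_smul i j k h r x := (DFinsupp.mapRange_single
    (β₁ := fun a => (G a).cx.X j) (β₂ := fun a => (G a).cx.X k)
    (f := fun a => (G a).smul i j k h r) (hf := fun a => map_zero _) (i := a) (b := x)).symm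

/-- The projection onto a summand. -/
def coord (a : A) : dsum G ⟶ G a where
  hom :=
    { f := fun i => ModuleCat.ofHom
        (DFinsupp.lapply a : (Π₀ a, (G a).cx.X i) →ₗ[K] (G a).cx.X i)
      comm' := fun i j hij => by
        refine ModuleCat.hom_ext (LinearMap.ext fun x => ?_)
        exact (dsum_d i j hij x a).symm }
  map_smul i j k h r x := rfl

lemma incl_coord_self (a : A) (i : ℤ) (x : (G a).cx.X i) :
    (coord G a).hom.f i ((incl G a).hom.f i x) = x := by
  classical
  exact DFinsupp.single_eq_same (β := fun a => (G a).cx.X i)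

lemma incl_coord_of_ne {a b : A} (h : b ≠ a) (i : ℤ) (x : (G a).cx.X i) :
    (coord G b).hom.f i ((incl G a).hom.f i x) = 0 := by
  classical
  exact DFinsupp.single_eq_of_ne (β := fun a => (G a).cx.X i) h

variable {G}

lemma dsum_ext {i : ℤ} {x y : (dsum G).cx.X i}
    (h : ∀ a, (coord G a).hom.f i x = (coord G a).hom.f i y) : x = y := DFinsupp.ext h

open Classical in
/-- The homogeneous map out of a direct sum with given restrictions. -/
def sumDesc {n : ℤ} (f : ∀ a, HomDeg (G a) N n) : HomDeg (dsum G) N n :=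
  HomDeg.mk (fun p q hq => DFinsupp.lsum K fun a => (f a).app p q hq) (by
    intro i p p' q q' hp hq hq' r x
    refine LinearMap.congr_fun (f := (DFinsupp.lsum K fun a => (f a).app p' q' hq') ∘ₗ
      (dsum G).smul i p p' hp r) (g := ((n * i).negOnePow • N.smul i q q' (by omega) r) ∘ₗ
      (DFinsupp.lsum K fun a => (f a).app p q hq)) ?_ x
    refine DFinsupp.lhom_ext fun a y => ?_
    have e := (incl G a).map_smul i p p' hp r y
    have e' : ∀ (q q' : ℤ) (h : q + n = q') (z : (G a).cx.X q),
        (DFinsupp.lsum K fun a => (f a).app q q' h) ((incl G a).hom.f q z) = (f a).app q q' h z :=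
      fun q q' h z => DFinsupp.lsum_single (R := K) (M := fun a => (G a).cx.X q) K
          (fun a => (f a).app q q' h) a z
    refine (congrArg (DFinsupp.lsum K fun a => (f a).app p' q' hq') e.symm).trans ?_
    refine (e' _ _ _ _).trans ?_
    refine ((f a).app_smul i p p' q q' hp hq hq' r y).trans ?_
    exact congrArg (fun t => (n * i).negOnePow • N.smul i q q' (by omega) r t) (e' _ _ _ _).symm)

open Classical in
lemma sumDesc_incl {n : ℤ} (f : ∀ a, HomDeg (G a) N n) (a : A) :
    (sumDesc f).comp (ofHom (incl G a)) (zero_add n) = f a :=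
  HomDeg.ext fun p q hq x => by
    rw [comp_app _ _ _ p p _ _ (add_zero p)]
    exact DFinsupp.lsum_single (R := K) (M := fun a => (G a).cx.X p) K
      (fun a => (f a).app p q (by omega)) a x

open Classical in
lemma isCoproduct_dsum : IsCoproduct fun a => ofHom (incl G a) := by
  refine fun Y n => ⟨fun F F' h => HomDeg.ext fun p q hq x => ?_,
    fun f => ⟨sumDesc f, funext fun a => sumDesc_incl f a⟩⟩
  refine LinearMap.congr_fun (f := F.app p q hq) (g := F'.app p q hq) ?_ x
  refine DFinsupp.lhom_ext fun a y => ?_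
  have e := congrArg (fun t => t.app p q hq y) (congrFun h a)
  dsimp only at e
  rw [comp_app _ _ _ p p _ _ (add_zero p), comp_app _ _ _ p p _ _ (add_zero p)] at e
  exact e

lemma isKProjective_dsum (hG : ∀ a, IsKProjective (G a)) : IsKProjective (dsum G) :=
  isCoproduct_dsum.isKProjective (fun _ => homDiff_ofHom _ _ _) hG

end

/-! ## Products -/

section

variable {A : Type u} (G : A → DGModule R)

/-- The product of DG modules. -/
abbrev dprod : DGModule R :=
  build (fun i => ∀ a, (G a).cx.X i)
    (fun i j h => LinearMap.pi fun a => ((G a).cx.d i j).hom ∘ₗ LinearMap.proj a)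
    (fun i j k h => LinearMap.mk₂ K (fun r x a => (G a).smul i j k h r (x a))
      (fun r s x => funext fun a => by simp) (fun c r x => funext fun a => by simp)
      (fun r x y => funext fun a => by simp) (fun c r x => funext fun a => by simp))
    (fun i j k h h' x => funext fun a => d_d (G a).cx i j k (x a))
    (fun i x => funext fun a => (G a).one_smul i (x a))
    (fun i j k ij jk n h₁ h₂ h₃ h₄ r s x => funext fun a =>
      (G a).mul_smul i j k ij jk n h₁ h₂ h₃ h₄ r s (x a))
    (fun i j k i' j' k' hi hj hk h r x => funext fun a =>
      (G a).leibniz i j k i' j' k' hi hj hk h r (x a))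

variable {G}

lemma dprod_d (i j : ℤ) (h : j + 1 = i) (x : ∀ a, (G a).cx.X i) :
    (dprod G).cx.d i j x = fun a => (G a).cx.d i j (x a) := by
  have e : (dprod G).cx.d i j = ModuleCat.ofHom _ := dif_pos h
  rw [e]
  rfl

variable (G)

/-- The projection onto a factor. -/
def proj (a : A) : dprod G ⟶ G a where
  hom :=
    { f := fun i => ModuleCat.ofHom (LinearMap.proj a)
      comm' := fun i j hij => by
        refine ModuleCat.hom_ext (LinearMap.ext fun x => ?_)
        exact (congrFun (dprod_d i j hij x) a).symm }
  map_smul i j k h r x := rfl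

variable {G}

lemma dprod_ext {i : ℤ} {x y : (dprod G).cx.X i}
    (h : ∀ a, (proj G a).hom.f i x = (proj G a).hom.f i y) : x = y := funext h

/-- The homogeneous map into a product with given components. -/
def prodLift {n : ℤ} (f : ∀ a, HomDeg M (G a) n) : HomDeg M (dprod G) n :=
  HomDeg.mk (fun p q hq => LinearMap.pi fun a => (f a).app p q hq) (by
    intro i p p' q q' hp hq hq' r x
    refine funext fun a => ((f a).app_smul i p p' q q' hp hq hq' r x).trans ?_
    rcases Int.units_eq_one_or (n * i).negOnePow with h | h <;> rw [h] <;> rfl)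

lemma prodLift_proj {n : ℤ} (f : ∀ a, HomDeg M (G a) n) (a : A) :
    (ofHom (proj G a)).comp (prodLift f) (add_zero n) = f a :=
  HomDeg.ext fun p q hq x => by
    rw [comp_app _ _ _ p q _ _ hq]
    rfl

lemma isProduct_dprod : IsProduct fun a => ofHom (proj G a) := by
  refine fun Y n => ⟨fun F F' h => HomDeg.ext fun p q hq x => funext fun a => ?_,
    fun f => ⟨prodLift f, funext fun a => prodLift_proj f a⟩⟩
  have e := congrArg (fun t => t.app p q hq x) (congrFun h a)
  dsimp only at e
  rwa [comp_app _ _ _ p q _ _ hq, comp_app _ _ _ p q _ _ hq] at e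

lemma isKInjective_dprod (hG : ∀ a, IsKInjective (G a)) : IsKInjective (dprod G) :=
  isProduct_dprod.isKInjective (fun _ => homDiff_ofHom _ _ _) hG

end

end DGModule

namespace DGModule

open ElementwiseHomology HomDeg

variable {R : DGAlgebra K} {M N P : DGModule R}

lemma homDeg_d_app {n n' : ℤ} (hn : n' + 1 = n) {f : HomDeg M N n}
    (hf : homDiff M N n n' hn f = 0) (p p' q q' : ℤ) (hp : p' + 1 = p) (hq : p + n = q)
    (hq' : p' + n = q') (x : M.cx.X p) :
    N.cx.d q q' (f.app p q hq x) = n.negOnePow • f.app p' q' hq' (M.cx.d p p' x) := by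
  have e := congrArg (fun t => t.app p q' (by omega) x) hf
  rw [homDiff_app M N n n' hn f p p' q q' hp hq] at e
  exact sub_eq_zero.1 e

lemma homDeg_d_app_neg_one {f : HomDeg M N (-1)} (hf : homDiff M N (-1) (-2) (by omega) f = 0)
    (p p' q q' : ℤ) (hp : p' + 1 = p) (hq : p + -1 = q) (hq' : p' + -1 = q') (x : M.cx.X p) :
    N.cx.d q q' (f.app p q hq x) = -f.app p' q' hq' (M.cx.d p p' x) := by
  rw [homDeg_d_app _ hf p p' q q' hp hq hq']
  simp [Int.negOnePow_neg]

/-! ## The total module of a sequence going down -/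

section

variable {G : ℕ → DGModule R} (δ : ∀ k, HomDeg (G (k + 1)) (G k) (-1))

/-- The map `δ` on the direct sum of a sequence. -/
def sumShift : HomDeg (dsum fun a : ULift.{u} ℕ => G a.down) (dsum fun a : ULift.{u} ℕ => G a.down)
    (-1) :=
  sumDesc fun a => match a with
    | ⟨0⟩ => 0
    | ⟨k + 1⟩ => (ofHom (incl (fun a : ULift.{u} ℕ => G a.down) ⟨k⟩)).comp (δ k) (by omega)

lemma sumShift_incl_zero :
    (sumShift δ).comp (ofHom (incl (fun a : ULift.{u} ℕ => G a.down) ⟨0⟩)) (zero_add _) = 0 :=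
  sumDesc_incl _ _

lemma sumShift_incl_succ (k : ℕ) :
    (sumShift δ).comp (ofHom (incl (fun a : ULift.{u} ℕ => G a.down) ⟨k + 1⟩)) (zero_add _) =
      (ofHom (incl (fun a : ULift.{u} ℕ => G a.down) ⟨k⟩)).comp (δ k) (by omega) :=
  sumDesc_incl _ _

lemma coord_sumShift (k : ℕ) :
    (ofHom (coord (fun a : ULift.{u} ℕ => G a.down) ⟨k⟩)).comp (sumShift δ) (add_zero (-1)) =
      (δ k).comp (ofHom (coord (fun a : ULift.{u} ℕ => G a.down) ⟨k + 1⟩)) (zero_add (-1)) := by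
  refine (isCoproduct_dsum _ _).1 (funext fun a => ?_)
  dsimp only
  obtain ⟨_ | n⟩ := a
  · rw [← comp_assoc _ _ _ (zero_add (-1)) (add_zero (-1)) (zero_add (-1)) (add_zero (-1)),
      sumShift_incl_zero]
    refine HomDeg.ext fun p q hq x => ?_
    rw [comp_app _ _ _ p q _ _ hq, comp_app _ _ _ p p _ _ (add_zero p),
      comp_app _ _ _ p p _ _ (add_zero p), ofHom_app, ofHom_app, ofHom_app]
    rw [incl_coord_of_ne _ (by simp), map_zero, HomDeg.zero_app]
    exact map_zero _
  · rw [← comp_assoc _ _ _ (zero_add (-1)) (add_zero (-1)) (zero_add (-1)) (add_zero (-1)),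
      sumShift_incl_succ]
    refine HomDeg.ext fun p q hq x => ?_
    rw [comp_app _ _ _ p q _ _ hq, comp_app _ _ _ p q _ _ hq, comp_app _ _ _ p p _ _ (add_zero p),
      comp_app _ _ _ p p _ _ (add_zero p), ofHom_app, ofHom_app, ofHom_app, ofHom_app]
    by_cases h : n = k
    · subst h
      rw [incl_coord_self, incl_coord_self]
    · rw [incl_coord_of_ne _ (by simp; omega), incl_coord_of_ne _ (by simp; omega), map_zero]

lemma coord_sumShift_app (k : ℕ) (p q : ℤ) (hq : p + -1 = q)
    (x : (dsum fun a : ULift.{u} ℕ => G a.down).cx.X p) :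
    (coord (fun a : ULift.{u} ℕ => G a.down) ⟨k⟩).hom.f q ((sumShift δ).app p q hq x) =
      (δ k).app p q hq ((coord (fun a : ULift.{u} ℕ => G a.down) ⟨k + 1⟩).hom.f p x) := by
  have e := congrArg (fun t => t.app p q hq x) (coord_sumShift δ k)
  dsimp only at e
  rwa [comp_app _ _ _ p q _ _ hq, comp_app _ _ _ p p _ _ (add_zero p), ofHom_app, ofHom_app] at e

variable {δ}

/-- In each coordinate both terms vanish separately: `δ` anticommutes with `∂`, and `δδ = 0`. -/
lemma homDiff_sumShift_add (hδ : ∀ k, homDiff _ _ (-1) (-2) (by omega) (δ k) = 0)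
    (hδδ : ∀ k, (δ k).comp (δ (k + 1)) (by omega : -1 + -1 = -2) = 0) :
    homDiff _ _ (-1) (-2) (by omega) (sumShift δ) + (sumShift δ).comp (sumShift δ) (by omega) =
      0 := by
  refine HomDeg.ext fun p q hq x => dsum_ext fun a => ?_
  have e₁ := homDeg_d_app_neg_one (hδ a.down) p (p - 1) (p - 1) q (by omega) rfl (by omega)
    ((coord (fun a : ULift.{u} ℕ => G a.down) ⟨a.down + 1⟩).hom.f p x)
  have e₂ := congrArg (fun t => t.app p q hq
    ((coord (fun a : ULift.{u} ℕ => G a.down) ⟨a.down + 1 + 1⟩).hom.f p x)) (hδδ a.down)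
  dsimp only at e₂
  rw [comp_app _ _ _ p (p - 1) _ _ rfl] at e₂
  rw [HomDeg.add_app, LinearMap.add_apply,
    homDiff_app _ _ (-1) (-2) _ _ p (p - 1) (p - 1) q (by omega) rfl,
    comp_app _ _ _ p (p - 1) _ _ rfl, map_add, map_sub, LinearMap.map_smul_of_tower]
  obtain ⟨k⟩ := a
  rw [coord_sumShift_app, coord_sumShift_app, coord_sumShift_app, hom_comm, coord_sumShift_app,
    hom_comm, e₁, e₂]
  simp [Int.negOnePow_neg]

variable (δ) in
/-- The direct sum of a sequence with the differential `∂ + δ`. -/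
abbrev totSum (hδ : ∀ k, homDiff _ _ (-1) (-2) (by omega) (δ k) = 0)
    (hδδ : ∀ k, (δ k).comp (δ (k + 1)) (by omega : -1 + -1 = -2) = 0) : DGModule R :=
  twist _ (sumShift δ) (homDiff_sumShift_add hδ hδδ)

variable {hδ : ∀ k, homDiff _ _ (-1) (-2) (by omega) (δ k) = 0}
    {hδδ : ∀ k, (δ k).comp (δ (k + 1)) (by omega : -1 + -1 = -2) = 0}

variable (hδ hδδ) in
lemma isKProjective_totSum (hG : ∀ k, IsKProjective (G k)) :
    IsKProjective (totSum δ hδ hδδ) := by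
  have h := (isCoproduct_dsum (G := fun a : ULift.{u} ℕ => G a.down)).toTwist (sumShift δ)
    (homDiff_sumShift_add hδ hδδ)
  have h' : IsCoproduct fun k : ℕ => (toTwist (sumShift δ) (homDiff_sumShift_add hδ hδδ)).comp
      (ofHom (incl (fun a : ULift.{u} ℕ => G a.down) ⟨k⟩)) (add_zero 0) := fun Y n =>
    ⟨fun F F' e => (h Y n).1 (funext fun a => congrFun e a.down), fun f => by
      obtain ⟨F, hF⟩ := (h Y n).2 fun a => f a.down
      exact ⟨F, funext fun k => congrFun hF ⟨k⟩⟩⟩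
  refine h'.isKProjective_of_sequence δ hδ hδδ ?_ (fun k => ?_) hG
  · rw [homDiff_comp _ _ _ _ (by omega : (-1 : ℤ) + 1 = 0) (by omega : (-1 : ℤ) + 1 = 0),
      homDiff_ofHom, homDiff_toTwist, comp_zero, smul_zero, add_zero,
      ← comp_assoc _ _ _ (zero_add (-1)) (add_zero (-1)) (zero_add (-1)) (add_zero (-1)),
      sumShift_incl_zero, comp_zero]
  · rw [homDiff_comp _ _ _ _ (by omega : (-1 : ℤ) + 1 = 0) (by omega : (-1 : ℤ) + 1 = 0),
      homDiff_ofHom, homDiff_toTwist, comp_zero, smul_zero, add_zero,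
      ← comp_assoc _ _ _ (zero_add (-1)) (add_zero (-1)) (zero_add (-1)) (add_zero (-1)),
      sumShift_incl_succ, comp_assoc]

/-- A component of an element of the total module. -/
def totCoord (k : ℕ) (i : ℤ) : (totSum δ hδ hδδ).cx.X i →ₗ[K] (G k).cx.X i :=
  ((coord (fun a : ULift.{u} ℕ => G a.down) ⟨k⟩).hom.f i).hom

/-- An element of the total module concentrated in one component. -/
def totIncl (k : ℕ) (i : ℤ) : (G k).cx.X i →ₗ[K] (totSum δ hδ hδδ).cx.X i :=
  ((incl (fun a : ULift.{u} ℕ => G a.down) ⟨k⟩).hom.f i).hom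

lemma totSum_ext {i : ℤ} {x y : (totSum δ hδ hδδ).cx.X i}
    (h : ∀ k, totCoord k i x = totCoord k i y) : x = y := dsum_ext fun a => h a.down

lemma totCoord_totIncl_self (k : ℕ) (i : ℤ) (x : (G k).cx.X i) :
    totCoord (hδ := hδ) (hδδ := hδδ) k i (totIncl k i x) = x :=
  incl_coord_self _ _ _ _

lemma totCoord_totIncl_of_ne {k l : ℕ} (h : l ≠ k) (i : ℤ) (x : (G k).cx.X i) :
    totCoord (hδ := hδ) (hδδ := hδδ) l i (totIncl k i x) = 0 :=
  incl_coord_of_ne _ (by simpa using h) _ _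

/-- Elements of a direct sum have finite support; this is what makes the induction in
`isQuasiIso_totAug` end. -/
lemma exists_totCoord_eq_zero {i : ℤ} (x : (totSum δ hδ hδδ).cx.X i) :
    ∃ n, ∀ k, n ≤ k → totCoord k i x = 0 := by
  classical
  obtain ⟨n, hn⟩ := ((DFinsupp.support (β := fun a : ULift.{u} ℕ => (G a.down).cx.X i)
    x).image ULift.down).bddAbove
  refine ⟨n + 1, fun k hk => ?_⟩
  by_contra h
  have := hn (Finset.mem_coe.2 (Finset.mem_image_of_mem ULift.down
    ((DFinsupp.mem_support_toFun (β := fun a : ULift.{u} ℕ => (G a.down).cx.X i) x ⟨k⟩).2 h)))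
  dsimp only at this
  omega

lemma totCoord_d (k : ℕ) (i j : ℤ) (h : j + 1 = i) (x : (totSum δ hδ hδδ).cx.X i) :
    totCoord k j ((totSum δ hδ hδδ).cx.d i j x) =
      (G k).cx.d i j (totCoord k i x) + (δ k).app i j (by omega) (totCoord (k + 1) i x) := by
  rw [twist_d i j h]
  refine (map_add (totCoord k j) _ _).trans (congrArg₂ (· + ·) ?_ ?_)
  · exact (hom_comm (coord (fun a : ULift.{u} ℕ => G a.down) ⟨k⟩).hom i j x)
  · exact coord_sumShift_app δ k i j (by omega) x

/-- The map out of a total module induced by a map `ε` with `εδ = 0`. -/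
def totAug (ε : G 0 ⟶ M) (hε : (ofHom ε).comp (δ 0) (by omega : -1 + 0 = -1) = 0) :
    totSum δ hδ hδδ ⟶ M where
  hom :=
    { f := fun i => ModuleCat.ofHom ((ε.hom.f i).hom ∘ₗ totCoord 0 i)
      comm' := fun i j hij => by
        refine ModuleCat.hom_ext (LinearMap.ext fun x => ?_)
        have hij : j + 1 = i := hij
        have e := congrArg (fun t => t.app i j (by omega)
          (totCoord (hδ := hδ) (hδδ := hδδ) 1 i x)) hε
        dsimp only at e
        rw [comp_app _ _ _ i j _ _ (by omega), ofHom_app] at e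
        change M.cx.d i j (ε.hom.f i (totCoord 0 i x)) =
          ε.hom.f j (totCoord 0 j ((totSum δ hδ hδδ).cx.d i j x))
        rw [totCoord_d 0 i j hij, map_add, e, hom_comm]
        exact (add_zero _).symm }
  map_smul i j k h r x := ε.map_smul i j k h r _

lemma totAug_f (ε : G 0 ⟶ M) (hε) (i : ℤ) (x : (totSum δ hδ hδδ).cx.X i) :
    (totAug ε hε).hom.f i x = ε.hom.f i (totCoord 0 i x) := rfl

/-- The hypotheses are exactness of the sequence on homology, with bounding elements made explicit.
Surjectivity is `h₁`. For injectivity, the top component of a cycle is itself a cycle, and its image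
under `δ` or `ε` bounds, by the component below or by `m`; exactness lets a boundary be subtracted
which removes the top component. Induction on the length concludes. -/
lemma isQuasiIso_totAug (ε : G 0 ⟶ M) (hε)
    (h₁ : ∀ (k i : ℤ), k + 1 = i → ∀ m : M.cx.X i, M.cx.d i k m = 0 →
      ∃ z : (G 0).cx.X i, (G 0).cx.d i k z = 0 ∧ ε.hom.f i z = m)
    (h₀ : ∀ (k i j : ℤ), k + 1 = i → ∀ hj : i + 1 = j, ∀ (z : (G 0).cx.X i) (m : M.cx.X j),
      (G 0).cx.d i k z = 0 → M.cx.d j i m = ε.hom.f i z →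
      ∃ (u : (G 1).cx.X j) (y : (G 0).cx.X j), (G 1).cx.d j i u = 0 ∧
        z = (δ 0).app j i (by omega) u + (G 0).cx.d j i y)
    (h₂ : ∀ (n : ℕ) (k i j : ℤ), ∀ hk : k + 1 = i, ∀ hj : i + 1 = j,
      ∀ (z : (G (n + 1)).cx.X i) (m : (G n).cx.X i), (G (n + 1)).cx.d i k z = 0 →
      (G n).cx.d i k m = (δ n).app i k (by omega) z →
      ∃ (u : (G (n + 2)).cx.X j) (y : (G (n + 1)).cx.X j), (G (n + 2)).cx.d j i u = 0 ∧
        z = (δ (n + 1)).app j i (by omega) u + (G (n + 1)).cx.d j i y) :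
    IsQuasiIso (totAug (hδ := hδ) (hδδ := hδδ) ε hε) := by
  refine (quasiIso_iff_injective_surjective _).2 ⟨?_, ?_⟩
  · intro k i j hk hj x m hx hm
    change M.cx.d j i m = ε.hom.f i (totCoord 0 i x) at hm
    obtain ⟨n, hn⟩ := exists_totCoord_eq_zero x
    induction n generalizing x m with
    | zero =>
      refine ⟨0, (map_zero _).trans (totSum_ext fun k => ?_)⟩
      rw [hn k (Nat.zero_le k), map_zero]
    | succ n ih =>
      have hd : ∀ l, (G l).cx.d i k (totCoord l i x) +
          (δ l).app i k (by omega) (totCoord (l + 1) i x) = 0 := fun l => by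
        rw [← totCoord_d l i k hk, hx, map_zero]
      have hz : (G n).cx.d i k (totCoord n i x) = 0 := by
        have := hd n
        rwa [hn (n + 1) le_rfl, map_zero, add_zero] at this
      obtain ⟨u, y, hu, hy⟩ : ∃ (u : (G (n + 1)).cx.X j) (y : (G n).cx.X j),
          (G (n + 1)).cx.d j i u = 0 ∧
            totCoord n i x = (δ n).app j i (by omega) u + (G n).cx.d j i y := by
        rcases n with _ | n
        · exact h₀ k i j hk hj _ m hz hm
        · exact h₂ n k i j hk hj _ (-totCoord n i x) hz (by
            rw [map_neg, neg_eq_iff_add_eq_zero, hd n])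
      -- The boundary of `w` has component `δ u + ∂ y` at `n`, which is the top component of `x`,
      -- and nothing at `n + 1`, because `u` is a cycle.
      let w : (totSum δ hδ hδδ).cx.X j := totIncl (n + 1) j u + totIncl n j y
      have hwl : ∀ l, totCoord l j w =
          totCoord l j (totIncl (n + 1) j u) + totCoord l j (totIncl n j y) := fun l =>
        map_add _ _ _
      have hw : ∀ l, n ≤ l → totCoord l i (x - (totSum δ hδ hδδ).cx.d j i w) = 0 := by
        intro l hl
        rw [map_sub, totCoord_d l j i hj, hwl, hwl, sub_eq_zero]
        rcases hl.eq_or_lt with rfl | hl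
        · rw [totCoord_totIncl_of_ne (by omega), totCoord_totIncl_self, totCoord_totIncl_self,
            totCoord_totIncl_of_ne (by omega), hy, zero_add, add_zero, add_comm]
        · rw [hn l hl, totCoord_totIncl_of_ne (k := n) (by omega),
            totCoord_totIncl_of_ne (k := n + 1) (l := l + 1) (by omega),
            totCoord_totIncl_of_ne (k := n) (l := l + 1) (by omega)]
          by_cases h : l = n + 1
          · subst h
            rw [totCoord_totIncl_self, add_zero, hu, add_zero, map_zero, add_zero]
          · rw [totCoord_totIncl_of_ne h]
            simp
      obtain ⟨x', hx'⟩ := ih (x - (totSum δ hδ hδδ).cx.d j i w)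
        (m - (totAug (hδ := hδ) (hδδ := hδδ) ε hε).hom.f j w) (by rw [map_sub, hx, d_d, sub_zero])
        (by
          have := hom_comm (totAug (hδ := hδ) (hδδ := hδδ) ε hε).hom j i w
          rw [map_sub, hm, ← this, totAug_f, map_sub, map_sub]) hw
      exact ⟨x' + w, by rw [map_add, hx', sub_add_cancel]⟩
  · intro k i j hk hj m hm
    obtain ⟨z, hz, rfl⟩ := h₁ k i hk m hm
    refine ⟨totIncl 0 i z, 0, totSum_ext fun l => ?_, ?_⟩
    · rw [totCoord_d l i k hk, totCoord_totIncl_of_ne (l := l + 1) (by omega), map_zero, map_zero,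
        add_zero]
      rcases l with _ | l
      · rw [totCoord_totIncl_self, hz]
      · rw [totCoord_totIncl_of_ne (by omega), map_zero]
    · rw [map_zero, add_zero]
      exact congrArg _ (totCoord_totIncl_self _ _ _)

end

end DGModule

namespace DGModule

open ElementwiseHomology HomDeg

variable {R : DGAlgebra K} {M N P : DGModule R}

lemma HomDeg.comp_neg {m n l : ℤ} (g : HomDeg N P m) (f : HomDeg M N n) (h : n + m = l) :
    g.comp (-f) h = -g.comp f h :=
  HomDeg.ext fun p q hq x => by simp [comp_app _ _ _ _ (p + n) _ _ rfl]

/-! ## The total module of a sequence going up -/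

section

variable {G : ℕ → DGModule R} (δ : ∀ k, HomDeg (G k) (G (k + 1)) (-1))

/-- The map `δ` on the product of a sequence. -/
def prodShift : HomDeg (dprod fun a : ULift.{u} ℕ => G a.down)
    (dprod fun a : ULift.{u} ℕ => G a.down) (-1) :=
  prodLift fun a => match a with
    | ⟨0⟩ => 0
    | ⟨k + 1⟩ => (δ k).comp (ofHom (proj (fun a : ULift.{u} ℕ => G a.down) ⟨k⟩)) (by omega)

lemma proj_prodShift_zero :
    (ofHom (proj (fun a : ULift.{u} ℕ => G a.down) ⟨0⟩)).comp (prodShift δ) (add_zero _) = 0 :=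
  prodLift_proj _ _

lemma proj_prodShift_succ (k : ℕ) :
    (ofHom (proj (fun a : ULift.{u} ℕ => G a.down) ⟨k + 1⟩)).comp (prodShift δ) (add_zero _) =
      (δ k).comp (ofHom (proj (fun a : ULift.{u} ℕ => G a.down) ⟨k⟩)) (by omega) :=
  prodLift_proj _ _

lemma proj_prodShift_zero_app (p q : ℤ) (hq : p + -1 = q)
    (x : (dprod fun a : ULift.{u} ℕ => G a.down).cx.X p) :
    (proj (fun a : ULift.{u} ℕ => G a.down) ⟨0⟩).hom.f q ((prodShift δ).app p q hq x) = 0 := rfl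

lemma proj_prodShift_succ_app (k : ℕ) (p q : ℤ) (hq : p + -1 = q)
    (x : (dprod fun a : ULift.{u} ℕ => G a.down).cx.X p) :
    (proj (fun a : ULift.{u} ℕ => G a.down) ⟨k + 1⟩).hom.f q ((prodShift δ).app p q hq x) =
      (δ k).app p q hq ((proj (fun a : ULift.{u} ℕ => G a.down) ⟨k⟩).hom.f p x) := by
  have e := congrArg (fun t => t.app p q hq x) (proj_prodShift_succ δ k)
  dsimp only at e
  rwa [comp_app _ _ _ p q _ _ hq, comp_app _ _ _ p p _ _ (add_zero p), ofHom_app, ofHom_app] at e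

variable {δ}

lemma homDiff_prodShift_add (hδ : ∀ k, homDiff _ _ (-1) (-2) (by omega) (δ k) = 0)
    (hδδ : ∀ k, (δ (k + 1)).comp (δ k) (by omega : -1 + -1 = -2) = 0) :
    homDiff _ _ (-1) (-2) (by omega) (prodShift δ) + (prodShift δ).comp (prodShift δ) (by omega) =
      0 := by
  refine HomDeg.ext fun p q hq x => dprod_ext fun a => ?_
  rw [HomDeg.add_app, LinearMap.add_apply,
    homDiff_app _ _ (-1) (-2) _ _ p (p - 1) (p - 1) q (by omega) rfl,
    comp_app _ _ _ p (p - 1) _ _ rfl, map_add, map_sub, LinearMap.map_smul_of_tower]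
  obtain ⟨_ | k⟩ := a
  · rw [proj_prodShift_zero_app, proj_prodShift_zero_app, hom_comm, proj_prodShift_zero_app]
    simp
  · have e₁ := homDeg_d_app_neg_one (hδ k) p (p - 1) (p - 1) q (by omega) rfl (by omega)
      ((proj (fun a : ULift.{u} ℕ => G a.down) ⟨k⟩).hom.f p x)
    rw [proj_prodShift_succ_app, proj_prodShift_succ_app, hom_comm, proj_prodShift_succ_app,
      hom_comm, e₁]
    rcases k with _ | k
    · rw [proj_prodShift_zero_app]
      simp [Int.negOnePow_neg]
    · have e₂ := congrArg (fun t => t.app p q hq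
        ((proj (fun a : ULift.{u} ℕ => G a.down) ⟨k⟩).hom.f p x)) (hδδ k)
      dsimp only at e₂
      rw [comp_app _ _ _ p (p - 1) _ _ rfl] at e₂
      rw [proj_prodShift_succ_app, e₂]
      simp [Int.negOnePow_neg]

variable (δ) in
/-- The product of a sequence with the differential `∂ + δ`. -/
abbrev totProd (hδ : ∀ k, homDiff _ _ (-1) (-2) (by omega) (δ k) = 0)
    (hδδ : ∀ k, (δ (k + 1)).comp (δ k) (by omega : -1 + -1 = -2) = 0) : DGModule R :=
  twist _ (prodShift δ) (homDiff_prodShift_add hδ hδδ)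

variable {hδ : ∀ k, homDiff _ _ (-1) (-2) (by omega) (δ k) = 0}
    {hδδ : ∀ k, (δ (k + 1)).comp (δ k) (by omega : -1 + -1 = -2) = 0}

variable (hδ hδδ) in
lemma isKInjective_totProd (hG : ∀ k, IsKInjective (G k)) :
    IsKInjective (totProd δ hδ hδδ) := by
  have h := (isProduct_dprod (G := fun a : ULift.{u} ℕ => G a.down)).fromTwist (prodShift δ)
    (homDiff_prodShift_add hδ hδδ)
  have h' : IsProduct fun k : ℕ => (ofHom (proj (fun a : ULift.{u} ℕ => G a.down) ⟨k⟩)).comp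
      (fromTwist (prodShift δ) (homDiff_prodShift_add hδ hδδ)) (add_zero 0) := fun Y n =>
    ⟨fun F F' e => (h Y n).1 (funext fun a => congrFun e a.down), fun f => by
      obtain ⟨F, hF⟩ := (h Y n).2 fun a => f a.down
      exact ⟨F, funext fun k => congrFun hF ⟨k⟩⟩⟩
  refine h'.isKInjective_of_sequence δ hδ hδδ ?_ (fun k => ?_) hG
  · rw [homDiff_comp _ _ _ _ (by omega : (-1 : ℤ) + 1 = 0) (by omega : (-1 : ℤ) + 1 = 0),
      homDiff_ofHom, homDiff_fromTwist, zero_comp, zero_add, comp_neg,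
      comp_assoc _ _ _ (zero_add (-1)) (add_zero (-1)) (add_zero (-1)) (zero_add (-1)),
      proj_prodShift_zero, zero_comp, neg_zero, smul_zero]
  · rw [homDiff_comp _ _ _ _ (by omega : (-1 : ℤ) + 1 = 0) (by omega : (-1 : ℤ) + 1 = 0),
      homDiff_ofHom, homDiff_fromTwist, zero_comp, zero_add, comp_neg,
      comp_assoc _ _ _ (zero_add (-1)) (add_zero (-1)) (add_zero (-1)) (zero_add (-1)),
      proj_prodShift_succ,
      ← comp_assoc _ _ _ (zero_add 0) (zero_add (-1)) (zero_add (-1)) (zero_add (-1))]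
    simp

/-- A component of an element of the total module. -/
def totProj (k : ℕ) (i : ℤ) : (totProd δ hδ hδδ).cx.X i →ₗ[K] (G k).cx.X i :=
  ((proj (fun a : ULift.{u} ℕ => G a.down) ⟨k⟩).hom.f i).hom

lemma totProd_ext {i : ℤ} {x y : (totProd δ hδ hδδ).cx.X i}
    (h : ∀ k, totProj k i x = totProj k i y) : x = y := dprod_ext fun a => h a.down

/-- The element of the total module with given components. -/
def totMk {i : ℤ} (x : ∀ k, (G k).cx.X i) : (totProd δ hδ hδδ).cx.X i :=
  fun a : ULift.{u} ℕ => x a.down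

lemma totProj_totMk {i : ℤ} (x : ∀ k, (G k).cx.X i) (k : ℕ) :
    totProj k i (totMk (hδ := hδ) (hδδ := hδδ) x) = x k := rfl

lemma totProj_zero_d (i j : ℤ) (h : j + 1 = i) (x : (totProd δ hδ hδδ).cx.X i) :
    totProj 0 j ((totProd δ hδ hδδ).cx.d i j x) = (G 0).cx.d i j (totProj 0 i x) := by
  rw [twist_d i j h]
  refine (map_add (totProj 0 j) _ _).trans ((congrArg₂ (· + ·) ?_ ?_).trans (add_zero _))
  · exact hom_comm (proj (fun a : ULift.{u} ℕ => G a.down) ⟨0⟩).hom i j x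
  · exact proj_prodShift_zero_app δ i j (by omega) x

lemma totProj_succ_d (k : ℕ) (i j : ℤ) (h : j + 1 = i) (x : (totProd δ hδ hδδ).cx.X i) :
    totProj (k + 1) j ((totProd δ hδ hδδ).cx.d i j x) =
      (G (k + 1)).cx.d i j (totProj (k + 1) i x) +
        (δ k).app i j (by omega) (totProj k i x) := by
  rw [twist_d i j h]
  refine (map_add (totProj (k + 1) j) _ _).trans (congrArg₂ (· + ·) ?_ ?_)
  · exact hom_comm (proj (fun a : ULift.{u} ℕ => G a.down) ⟨k + 1⟩).hom i j x
  · exact proj_prodShift_succ_app δ k i j (by omega) x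

/-- The map into a total module induced by a map `η` with `δη = 0`. -/
def totCoaug (η : M ⟶ G 0) (hη : (δ 0).comp (ofHom η) (by omega : 0 + -1 = -1) = 0) :
    M ⟶ totProd δ hδ hδδ where
  hom :=
    { f := fun i => ModuleCat.ofHom (LinearMap.pi fun a => match a with
        | ⟨0⟩ => (η.hom.f i).hom
        | ⟨k + 1⟩ => 0)
      comm' := fun i j hij => by
        refine ModuleCat.hom_ext (LinearMap.ext fun x => totProd_ext fun k => ?_)
        have hij : j + 1 = i := hij
        rcases k with _ | _ | k
        · refine (totProj_zero_d (hδ := hδ) (hδδ := hδδ) i j hij _).trans ?_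
          exact (hom_comm η.hom i j x).symm
        · refine (totProj_succ_d (hδ := hδ) (hδδ := hδδ) 0 i j hij _).trans ?_
          have e := congrArg (fun t => t.app i j (by omega) x) hη
          rw [comp_app _ _ _ i i _ _ (by omega), ofHom_app] at e
          refine (congrArg₂ (· + ·) (map_zero _) e).trans (add_zero _)
        · refine (totProj_succ_d (hδ := hδ) (hδδ := hδδ) (k + 1) i j hij _).trans ?_
          exact (congrArg₂ (· + ·) (map_zero _) (map_zero _)).trans (add_zero _) }
  map_smul i j k h r x := totProd_ext (hδ := hδ) (hδδ := hδδ) fun n => by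
    rcases n with _ | n
    · exact η.map_smul i j k h r x
    · exact (map_zero ((G (n + 1)).smul i j k h r)).symm

lemma totProj_zero_totCoaug (η : M ⟶ G 0) (hη) (i : ℤ) (x : M.cx.X i) :
    totProj 0 i ((totCoaug (hδ := hδ) (hδδ := hδδ) η hη).hom.f i x) = η.hom.f i x := rfl

lemma totProj_succ_totCoaug (η : M ⟶ G 0) (hη) (k : ℕ) (i : ℤ) (x : M.cx.X i) :
    totProj (k + 1) i ((totCoaug (hδ := hδ) (hδδ := hδδ) η hη).hom.f i x) = 0 := rfl

/-- Dual to `isQuasiIso_totAug`, with injectivity read off at position zero. For surjectivity, a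
cycle is reduced to the image of `m` by a boundary whose components are chosen upwards without end;
the product, unlike the direct sum, contains the resulting family. -/
lemma isQuasiIso_totCoaug (η : M ⟶ G 0) (hη)
    (h₁ : ∀ (k i j : ℤ), k + 1 = i → i + 1 = j → ∀ (m : M.cx.X i) (y : (G 0).cx.X j),
      M.cx.d i k m = 0 → (G 0).cx.d j i y = η.hom.f i m → ∃ m' : M.cx.X j, M.cx.d j i m' = m)
    (h₀ : ∀ (k i j : ℤ), ∀ hk : k + 1 = i, i + 1 = j → ∀ (z : (G 0).cx.X i) (y : (G 1).cx.X i),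
      (G 0).cx.d i k z = 0 → (G 1).cx.d i k y = (δ 0).app i k (by omega) z →
      ∃ (m : M.cx.X i) (y' : (G 0).cx.X j), M.cx.d i k m = 0 ∧
        z = η.hom.f i m + (G 0).cx.d j i y')
    (h₂ : ∀ (n : ℕ) (k i j : ℤ), ∀ hk : k + 1 = i, ∀ hj : i + 1 = j,
      ∀ (z : (G (n + 1)).cx.X i) (y : (G (n + 2)).cx.X i), (G (n + 1)).cx.d i k z = 0 →
      (G (n + 2)).cx.d i k y = (δ (n + 1)).app i k (by omega) z →
      ∃ (w : (G n).cx.X j) (y' : (G (n + 1)).cx.X j), (G n).cx.d j i w = 0 ∧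
        z = (δ n).app j i (by omega) w + (G (n + 1)).cx.d j i y') :
    IsQuasiIso (totCoaug (hδ := hδ) (hδδ := hδδ) η hη) := by
  refine (quasiIso_iff_injective_surjective _).2 ⟨?_, ?_⟩
  · intro k i j hk hj m y hm hy
    refine h₁ k i j hk hj m (totProj (hδ := hδ) (hδδ := hδδ) 0 j y) hm ?_
    rw [← totProj_zero_d j i hj, hy, totProj_zero_totCoaug]
  · intro k i j hk hj x hx
    have hx₀ : (G 0).cx.d i k (totProj (hδ := hδ) (hδδ := hδδ) 0 i x) = 0 := by
      rw [← totProj_zero_d i k hk, hx, map_zero]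
    have hx₁ : ∀ n, (G (n + 1)).cx.d i k (totProj (hδ := hδ) (hδδ := hδδ) (n + 1) i x) +
        (δ n).app i k (by omega) (totProj (hδ := hδ) (hδδ := hδδ) n i x) = 0 := fun n => by
      rw [← totProj_succ_d n i k hk, hx, map_zero]
    have hδd : ∀ n (y : (G n).cx.X j), (G (n + 1)).cx.d i k ((δ n).app j i (by omega) y) =
        -(δ n).app i k (by omega) ((G n).cx.d j i y) := fun n y =>
      homDeg_d_app_neg_one (hδ n) j i i k hj (by omega) (by omega) y
    have hδ₂ : ∀ n (y : (G n).cx.X j), (δ (n + 1)).app i k (by omega)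
        ((δ n).app j i (by omega) y) = 0 := fun n y => by
      have e := congrArg (fun t => t.app j k (by omega) y) (hδδ n)
      rwa [comp_app _ _ _ j i _ _ (by omega)] at e
    obtain ⟨m, y₀, hm, hy₀⟩ := h₀ k i j hk hj _ (-totProj (hδ := hδ) (hδδ := hδδ) 1 i x) hx₀
      (by rw [map_neg, neg_eq_iff_add_eq_zero, hx₁ 0])
    have hηm : (δ 0).app i k (by omega) (η.hom.f i m) = 0 := by
      have e := congrArg (fun t => t.app i k (by omega) m) hη
      rwa [comp_app _ _ _ i i _ _ (by omega), ofHom_app] at e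
    -- The choice at position `n` is provisional: the next step may add a cycle `w` to it, which
    -- alters its image under `δ` but not its boundary. The final component is `s n + w n`.
    obtain ⟨s, hs₀, hs⟩ := exists_dependent_seq (X := fun n => (G n).cx.X j)
      (fun y => totProj 0 i x = η.hom.f i m + (G 0).cx.d j i y)
      (fun n y => (G (n + 1)).cx.d i k (totProj (n + 1) i x - (δ n).app j i (by omega) y) = 0)
      (fun n y y' => ∃ w, (G n).cx.d j i w = 0 ∧
        totProj (n + 1) i x = (δ n).app j i (by omega) (y + w) + (G (n + 1)).cx.d j i y')
      ⟨y₀, hy₀, by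
        have e := hx₁ 0
        have e' : (δ 0).app i k (by omega) (totProj (hδ := hδ) (hδδ := hδδ) 0 i x) =
            (δ 0).app i k (by omega) ((G 0).cx.d j i y₀) := by
          rw [hy₀, map_add, hηm]
          exact zero_add _
        rw [e'] at e
        rw [map_sub, hδd, sub_neg_eq_add]
        exact e⟩
      (fun n y hy => by
        obtain ⟨w, y', hw, h⟩ := h₂ n k i j hk hj _
          (-totProj (hδ := hδ) (hδδ := hδδ) (n + 2) i x) hy (by
            rw [map_neg, map_sub, hδ₂, sub_zero, neg_eq_iff_add_eq_zero, hx₁ (n + 1)])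
        have h' : totProj (n + 1) i x = (δ n).app j i (by omega) (y + w) +
            (G (n + 1)).cx.d j i y' := by
          rw [map_add, add_assoc, ← h, add_sub_cancel]
        refine ⟨y', ⟨w, hw, h'⟩, ?_⟩
        have e := hx₁ (n + 1)
        rw [h', map_add, hδ₂, zero_add] at e
        rw [map_sub, hδd, sub_neg_eq_add, e])
    choose w hw hsw using hs
    refine ⟨m, totMk fun n => s n + w n, hm, totProd_ext fun n => ?_⟩
    refine (map_add (totProj n i) _ _).trans ?_
    rcases n with _ | n
    · rw [totProj_zero_totCoaug, totProj_zero_d j i hj, totProj_totMk, map_add, hw, add_zero, hs₀]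
    · rw [totProj_succ_totCoaug, totProj_succ_d n j i hj, totProj_totMk, totProj_totMk, map_add,
        hw, add_zero, zero_add, hsw]
      exact add_comm _ _

end

end DGModule

namespace DGModule

open ElementwiseHomology HomDeg

variable {R : DGAlgebra K} {M N P : DGModule R}

/-! ## Kernels -/

/-- The kernel of a morphism of DG modules. -/
abbrev ker (f : M ⟶ N) : DGModule R :=
  build (fun i => LinearMap.ker (f.hom.f i).hom)
    (fun i j h => (M.cx.d i j).hom.restrict (fun x (hx : f.hom.f i x = 0) => by
      change f.hom.f j (M.cx.d i j x) = 0
      rw [hom_comm, hx, map_zero]))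
    (fun i j k h => LinearMap.mk₂ K
      (fun r x => ⟨M.smul i j k h r x.1, by
        have hx : f.hom.f j x.1 = 0 := x.2
        change f.hom.f k (M.smul i j k h r x.1) = 0
        rw [f.map_smul, hx, map_zero]⟩)
      (fun r s x => Subtype.ext (by simp)) (fun c r x => Subtype.ext (by simp))
      (fun r x y => Subtype.ext (by simp)) (fun c r x => Subtype.ext (by simp)))
    (fun i j k h h' x => Subtype.ext (d_d M.cx i j k x.1))
    (fun i x => Subtype.ext (M.one_smul i x.1))
    (fun i j k ij jk n h₁ h₂ h₃ h₄ r s x => Subtype.ext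
      (M.mul_smul i j k ij jk n h₁ h₂ h₃ h₄ r s x.1))
    (fun i j k i' j' k' hi hj hk h r x => Subtype.ext
      (M.leibniz i j k i' j' k' hi hj hk h r x.1))

/-- The inclusion of the kernel. -/
def kerIncl (f : M ⟶ N) : ker f ⟶ M where
  hom :=
    { f := fun i => ModuleCat.ofHom (LinearMap.ker (f.hom.f i).hom).subtype
      comm' := fun i j hij => by
        refine ModuleCat.hom_ext (LinearMap.ext fun x => ?_)
        have e : (ker f).cx.d i j = ModuleCat.ofHom _ := dif_pos hij
        rw [e]
        rfl }
  map_smul i j k h r x := rfl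

lemma kerIncl_injective (f : M ⟶ N) (i : ℤ) : Function.Injective ((kerIncl f).hom.f i) :=
  Subtype.val_injective

lemma exists_kerIncl_eq (f : M ⟶ N) (i : ℤ) (x : M.cx.X i) (hx : f.hom.f i x = 0) :
    ∃ y, (kerIncl f).hom.f i y = x := ⟨⟨x, hx⟩, rfl⟩

lemma kerIncl_comp (f : M ⟶ N) (i : ℤ) (y : (ker f).cx.X i) :
    f.hom.f i ((kerIncl f).hom.f i y) = 0 := y.2

/-! ## K-projective covers -/

/-- The morphism out of a direct sum with given restrictions. -/
def sumDescHom {A : Type u} {G : A → DGModule R} (f : ∀ a, G a ⟶ N) : dsum G ⟶ N :=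
  toHom (sumDesc fun a => ofHom (f a)) ((isCoproduct_dsum N (-1)).1 (funext fun a => by
    have e := homDiff_comp (m' := -1) (n' := -1) (sumDesc fun a => ofHom (f a))
      (ofHom (incl G a)) (add_zero 0) (by omega : (-1 : ℤ) + 1 = 0) (by omega) (by omega)
    rw [sumDesc_incl, homDiff_ofHom, homDiff_ofHom, comp_zero, smul_zero, add_zero] at e
    exact e.symm))

lemma sumDescHom_incl {A : Type u} {G : A → DGModule R} (f : ∀ a, G a ⟶ N) (a : A) (i : ℤ)
    (x : (G a).cx.X i) : (sumDescHom f).hom.f i ((incl G a).hom.f i x) = (f a).hom.f i x := by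
  have e := congrArg (fun t => t.app i i (add_zero i) x) (sumDesc_incl (fun a => ofHom (f a)) a)
  rwa [comp_app _ _ _ i i _ _ (add_zero i)] at e

/-- The free module on a generator of degree `j`, mapping to a given cycle of degree `j`. -/
def freeHom (j : ℤ) (z : N.cx.X j) (hz : N.cx.d j (j - 1) z = 0) :
    shift R.leftSelf (-j) ⟶ N :=
  toHom ((ofElem z).comp (fromShift R.leftSelf (-j)) (by omega)) (by
    rw [homDiff_comp (m' := j - 1) (n' := -j - 1) (ofElem z) (fromShift R.leftSelf (-j)) (by omega)
      (by omega) (by omega) (by omega), homDiff_fromShift, homDiff_ofElem, hz, comp_zero, smul_zero,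
      add_zero]
    have e : (ofElem (0 : N.cx.X (j - 1)) : HomDeg R.leftSelf N (j - 1)) = 0 :=
      ofElem_ext (by rw [ofElem_app_one]; rfl)
    rw [e, zero_comp])

lemma exists_freeHom_eq (j : ℤ) (z : N.cx.X j) (hz : N.cx.d j (j - 1) z = 0) :
    ∃ y : (shift R.leftSelf (-j)).cx.X j, (∀ k, (shift R.leftSelf (-j)).cx.d j k y = 0) ∧
      (freeHom j z hz).hom.f j y = z := by
  -- The generator is the unit of `R`, placed in degree `j` by the shift.
  refine ⟨(toShift R.leftSelf (-j) j (by omega)).app 0 j (zero_add j) R.one, fun k => ?_, ?_⟩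
  · rw [toShift_app, shift_d, d_castDeg]
    have e : R.leftSelf.cx.d 0 (k + -j) R.one = 0 := R.d_one _
    rw [e, smul_zero]
  · have e := congrArg (fun t => t.app 0 0 (add_zero 0) R.one)
      (fromShift_comp_toShift R.leftSelf (-j) j (by omega))
    rw [comp_app _ _ _ 0 j _ _ (zero_add j)] at e
    refine (toHom_app _ _ _ _).trans ?_
    rw [comp_app _ _ _ j 0 _ _ (by omega), e]
    exact ofElem_app_one z

/-- Every DG module is the image of a contractible one. -/
lemma exists_contractible_cover (N : DGModule R) : ∃ (C : DGModule R) (f : C ⟶ N),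
    IsKProjective C ∧ ∀ i, Function.Surjective (f.hom.f i) := by
  obtain ⟨s, hs⟩ := exists_cyl_contraction (hσ := homDiff_toShift N 1 (-1) (by omega) (-2)
    (by omega)) (fromShift N 1) (homDiff_fromShift N 1 0 (by omega))
    (fromShift_comp_toShift N 1 (-1) (by omega)) (toShift_comp_fromShift N 1 (-1) (by omega))
  exact ⟨_, cylFst, isKProjective_of_contractible s hs, fun i x => ⟨(x, 0), rfl⟩⟩

/-- The contractible summand takes care of surjectivity in each degree, and a free summand for every
cycle takes care of surjectivity on cycles, since its generator is a cycle. -/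
lemma exists_cover (N : DGModule R) : ∃ (C : DGModule R) (f : C ⟶ N), IsKProjective C ∧
    (∀ i, Function.Surjective (f.hom.f i)) ∧
    ∀ (k i : ℤ), k + 1 = i → ∀ x : N.cx.X i, N.cx.d i k x = 0 →
      ∃ y : C.cx.X i, C.cx.d i k y = 0 ∧ f.hom.f i y = x := by
  obtain ⟨C₀, f₀, hC₀, hf₀⟩ := exists_contractible_cover N
  let A := Option (Σ j : ℤ, {z : N.cx.X j // N.cx.d j (j - 1) z = 0})
  let G : A → DGModule R := fun a => a.elim C₀ fun z => shift R.leftSelf (-z.1)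
  let F : ∀ a, G a ⟶ N := fun a => match a with
    | none => f₀
    | some z => freeHom z.1 z.2.1 z.2.2
  refine ⟨dsum G, sumDescHom F, isKProjective_dsum fun a => ?_, fun i x => ?_, ?_⟩
  · rcases a with _ | z
    · exact hC₀
    · exact (isKProjective_leftSelf R).shift _
  · obtain ⟨y, hy⟩ := hf₀ i x
    exact ⟨(incl G none).hom.f i y, (sumDescHom_incl F none i y).trans hy⟩
  · intro k i hk x hx
    obtain rfl : k = i - 1 := by omega
    obtain ⟨y, hy, hy'⟩ := exists_freeHom_eq i x hx
    refine ⟨(incl G (some ⟨i, x, hx⟩)).hom.f i y, ?_,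
      (sumDescHom_incl F (some ⟨i, x, hx⟩) i y).trans hy'⟩
    refine (hom_comm (incl G (some ⟨i, x, hx⟩)).hom i (i - 1) y).symm.trans ?_
    exact (congrArg _ (hy (i - 1))).trans (map_zero _)

/-- A cover together with its shifted kernel. -/
lemma exists_presentation (N : DGModule R) : ∃ (C : DGModule R) (ε : C ⟶ N) (N' : DGModule R)
    (κ : HomDeg N' C (-1)), IsKProjective C ∧
    (∀ i, Function.Surjective (ε.hom.f i)) ∧
    (∀ (k i : ℤ), k + 1 = i → ∀ x : N.cx.X i, N.cx.d i k x = 0 →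
      ∃ y : C.cx.X i, C.cx.d i k y = 0 ∧ ε.hom.f i y = x) ∧
    homDiff _ _ (-1) (-2) (by omega) κ = 0 ∧ (ofHom ε).comp κ (add_zero (-1)) = 0 ∧
    (∀ (i j : ℤ) (h : j + -1 = i), Function.Injective (κ.app j i h)) ∧
    ∀ (i j : ℤ) (h : j + -1 = i) (x : C.cx.X i), ε.hom.f i x = 0 → ∃ y, κ.app j i h y = x := by
  obtain ⟨C, ε, hC, h₁, h₂⟩ := exists_cover N
  have ha : ∀ (i j : ℤ) (h : j + -1 = i) (y : (shift (ker ε) (-1)).cx.X j),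
      ((ofHom (kerIncl ε)).comp (fromShift (ker ε) (-1)) (add_zero (-1))).app j i h y =
        (kerIncl ε).hom.f i (castDeg (ker ε).cx h y) := fun i j h y => by
    rw [comp_app _ _ _ j i _ _ h]
    rfl
  -- The kernel is shifted so that its inclusion has degree `-1`, like the differential to which it
  -- will be added.
  refine ⟨C, ε, shift (ker ε) (-1), (ofHom (kerIncl ε)).comp (fromShift (ker ε) (-1))
    (add_zero (-1)), hC, h₁, h₂, ?_, ?_, fun i j h x y hxy => ?_, fun i j h x hx => ?_⟩
  · rw [homDiff_comp (m' := -1) _ _ _ _ (by omega) (by omega : (-2 : ℤ) + 1 = -1), homDiff_ofHom,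
      homDiff_fromShift]
    simp
  · refine HomDeg.ext fun p q hq x => ?_
    rw [comp_app _ _ _ p q _ _ hq, ha, ofHom_app, kerIncl_comp]
    rfl
  · rw [ha, ha] at hxy
    subst h
    exact kerIncl_injective ε _ hxy
  · obtain ⟨y, rfl⟩ := exists_kerIncl_eq ε i x hx
    subst h
    exact ⟨y, ha _ _ _ _⟩

/-- Covers of `M`, of the kernel, of the next kernel and so on are spliced into a sequence. It is
exact on homology because all covers are surjective both on elements and on cycles, so its total
module resolves `M`. -/
theorem exists_kProjective_quasiIso (M : DGModule R) :
    ∃ (P : DGModule R) (f : P ⟶ M), IsKProjective P ∧ IsQuasiIso f := by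
  choose C ε N' κ hC hε hc hκ hεκ hinj hsurj using fun N : DGModule R => exists_presentation N
  let L : ℕ → DGModule R := fun n => Nat.rec M (fun _ N => N' N) n
  have hL : ∀ n, L (n + 1) = N' (L n) := fun n => rfl
  let G : ℕ → DGModule R := fun n => C (L n)
  let δ : ∀ n, HomDeg (G (n + 1)) (G n) (-1) := fun n =>
    (κ (L n)).comp (ofHom (ε (L (n + 1)))) (zero_add (-1))
  have hδa : ∀ n (p q : ℤ) (hq : p + -1 = q) (x : (G (n + 1)).cx.X p),
      (δ n).app p q hq x = (κ (L n)).app p q hq ((ε (L (n + 1))).hom.f p x) := fun n p q hq x => by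
    refine (comp_app _ _ _ p p _ _ (add_zero p) x).trans ?_
    rfl
  have hκd : ∀ n (p q s : ℤ) (hq : p + -1 = q) (hs : q + -1 = s) (x : (L (n + 1)).cx.X p),
      (G n).cx.d q s ((κ (L n)).app p q hq x) =
        -(κ (L n)).app q s hs ((L (n + 1)).cx.d p q x) := fun n p q s hq hs x =>
    homDeg_d_app_neg_one (hκ (L n)) p q q s (by omega) hq hs x
  have hεκa : ∀ n (p q : ℤ) (hq : p + -1 = q) (x : (L (n + 1)).cx.X p),
      (ε (L n)).hom.f q ((κ (L n)).app p q hq x) = 0 := fun n p q hq x => by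
    have e := congrArg (fun t => t.app p q hq x) (hεκ (L n))
    rwa [comp_app _ _ _ p q _ _ hq] at e
  have hδ : ∀ n, homDiff _ _ (-1) (-2) (by omega) (δ n) = 0 := fun n => by
    refine (homDiff_comp (m' := -2) (n' := -1) _ _ _ _ (by omega) (by omega)).trans ?_
    rw [homDiff_ofHom, hκ]
    simp
  have hδδ : ∀ n, (δ n).comp (δ (n + 1)) (by omega : -1 + -1 = -2) = 0 := fun n => by
    refine HomDeg.ext fun p q hq x => ?_
    rw [comp_app _ _ _ p (p - 1) _ _ rfl, hδa]
    refine (congrArg _ ((congrArg _ (hδa (n + 1) p (p - 1) rfl x)).trans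
      (hεκa (n + 1) p (p - 1) rfl _))).trans (map_zero _)
  have hεδ : (ofHom (ε M)).comp (δ 0) (by omega : -1 + 0 = -1) = 0 := by
    refine HomDeg.ext fun p q hq x => ?_
    rw [comp_app _ _ _ p q _ _ hq, hδa]
    exact hεκa 0 p q hq _
  -- Exactness at `G n` for a cycle `z` whose image in `L n` bounds. Lift the bounding element to
  -- `y`; then `z - ∂y` is in the kernel, hence equals `κ v`, where `v` is a cycle by injectivity of
  -- `κ`; finally `v` lifts to a cycle.
  have key : ∀ (n : ℕ) (k i j : ℤ), k + 1 = i → ∀ hj : i + 1 = j, ∀ (z : (G n).cx.X i)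
      (m : (L n).cx.X j), (G n).cx.d i k z = 0 → (L n).cx.d j i m = (ε (L n)).hom.f i z →
      ∃ (u : (G (n + 1)).cx.X j) (y : (G n).cx.X j), (G (n + 1)).cx.d j i u = 0 ∧
        z = (δ n).app j i (by omega) u + (G n).cx.d j i y := by
    intro n k i j hk hj z m hz hm
    obtain ⟨y, rfl⟩ := hε (L n) j m
    obtain ⟨v, hv⟩ := hsurj (L n) i j (by omega) (z - (G n).cx.d j i y) (by
      rw [map_sub, ← hm, hom_comm, sub_self])
    have hdv : (L (n + 1)).cx.d j i v = 0 := by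
      refine hinj (L n) k i (by omega) ?_
      have e := hκd n j i k (by omega) (by omega) v
      rw [hv, map_sub, hz, d_d, sub_zero] at e
      rw [map_zero]
      exact neg_eq_zero.1 e.symm
    obtain ⟨w, hw, hwv⟩ := hc (L (n + 1)) i j hj v hdv
    refine ⟨w, y, hw, ?_⟩
    rw [hδa, hwv]
    exact (sub_eq_iff_eq_add.1 hv.symm)
  refine ⟨totSum δ hδ hδδ, totAug (ε M) hεδ, isKProjective_totSum hδ hδδ fun n => hC _,
    isQuasiIso_totAug _ _ (hc M) (key 0) ?_⟩
  intro n k i j hk hj z m hz hm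
  rw [hδa] at hm
  -- It is only known that the image of `z` bounds in `G n`, by `m`, while `key` needs a bound
  -- inside the kernel. Subtracting from `m` a cycle `c` with the same image under `ε` moves it into
  -- the kernel.
  obtain ⟨c, hc₁, hc₂⟩ := hc (L n) k i hk ((ε (L n)).hom.f i m) (by
    rw [← hom_comm, hm, hεκa n])
  obtain ⟨v, hv⟩ := hsurj (L n) i j (by omega) (m - c) (by rw [map_sub, hc₂, sub_self])
  refine key (n + 1) k i j hk hj z (-v) hz (hinj (L n) k i (by omega) ?_)
  have e := hκd n j i k (by omega) (by omega) v
  rw [hv, map_sub, hc₁, sub_zero, hm] at e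
  rw [map_neg, map_neg, e]

end DGModule

namespace DGModule

open ElementwiseHomology HomDeg

variable {R : DGAlgebra K} {M N P : DGModule R}

/-! ## Cokernels -/

/-- The cokernel of a morphism of DG modules. -/
abbrev coker (f : M ⟶ N) : DGModule R :=
  build (fun i => N.cx.X i ⧸ LinearMap.range (f.hom.f i).hom)
    (fun i j h => Submodule.mapQ _ _ (N.cx.d i j).hom (by
      rintro _ ⟨x, rfl⟩
      exact ⟨M.cx.d i j x, hom_comm f.hom i j x⟩))
    (fun i j k h => (Submodule.liftQ _ ((N.smul i j k h).flip.compr₂ (Submodule.mkQ _)) (by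
      rintro _ ⟨x, rfl⟩
      refine LinearMap.ext fun r => (Submodule.Quotient.mk_eq_zero _).2 ?_
      exact ⟨M.smul i j k h r x, f.map_smul i j k h r x⟩)).flip)
    (fun i j k h h' x => by
      obtain ⟨x, rfl⟩ := Submodule.Quotient.mk_surjective _ x
      exact congrArg Submodule.Quotient.mk (d_d N.cx i j k x))
    (fun i x => by
      obtain ⟨x, rfl⟩ := Submodule.Quotient.mk_surjective _ x
      exact congrArg Submodule.Quotient.mk (N.one_smul i x))
    (fun i j k ij jk n h₁ h₂ h₃ h₄ r s x => by
      obtain ⟨x, rfl⟩ := Submodule.Quotient.mk_surjective _ x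
      exact congrArg Submodule.Quotient.mk (N.mul_smul i j k ij jk n h₁ h₂ h₃ h₄ r s x))
    (fun i j k i' j' k' hi hj hk h r x => by
      obtain ⟨x, rfl⟩ := Submodule.Quotient.mk_surjective _ x
      refine (congrArg (Submodule.mkQ (LinearMap.range (f.hom.f k').hom))
        (N.leibniz i j k i' j' k' hi hj hk h r x)).trans ?_
      rw [map_add, LinearMap.map_smul_of_tower]
      rfl)

/-- The projection onto the cokernel. -/
def cokerProj (f : M ⟶ N) : N ⟶ coker f where
  hom :=
    { f := fun i => ModuleCat.ofHom (LinearMap.range (f.hom.f i).hom).mkQ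
      comm' := fun i j hij => by
        refine ModuleCat.hom_ext (LinearMap.ext fun x => ?_)
        have e : (coker f).cx.d i j = ModuleCat.ofHom _ := dif_pos hij
        rw [e]
        rfl }
  map_smul i j k h r x := rfl

lemma cokerProj_surjective (f : M ⟶ N) (i : ℤ) : Function.Surjective ((cokerProj f).hom.f i) :=
  Submodule.Quotient.mk_surjective _

lemma cokerProj_eq_zero (f : M ⟶ N) (i : ℤ) (x : N.cx.X i) (hx : (cokerProj f).hom.f i x = 0) :
    ∃ y, f.hom.f i y = x := (Submodule.Quotient.mk_eq_zero _).1 hx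

lemma cokerProj_comp (f : M ⟶ N) (i : ℤ) (y : M.cx.X i) :
    (cokerProj f).hom.f i (f.hom.f i y) = 0 := (Submodule.Quotient.mk_eq_zero _).2 ⟨y, rfl⟩

/-! ## Characters -/

lemma character_units_smul {A : Type u} [AddCommGroup A] (f : CharacterModule A) (c : ℤˣ) (x : A) :
    f (c • x) = c • f x := by
  rcases Int.units_eq_one_or c with rfl | rfl
  · simp
  · rw [Units.neg_smul, Units.neg_smul, _root_.one_smul, _root_.one_smul, map_neg]

/-- A character which vanishes on the kernel of a linear map extends along it. -/
lemma exists_character_extension {A B : Type u} [AddCommGroup A] [Module K A] [AddCommGroup B]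
    [Module K B] (f : A →ₗ[K] B) (χ : CharacterModule A) (hχ : ∀ x, f x = 0 → χ x = 0) :
    ∃ ψ : CharacterModule B, ∀ x, ψ (f x) = χ x := by
  let χ' : CharacterModule (A ⧸ LinearMap.ker f) :=
    QuotientAddGroup.lift (LinearMap.ker f).toAddSubgroup χ fun x hx => hχ x hx
  obtain ⟨ψ, hψ⟩ := CharacterModule.dual_surjective_of_injective
    ((LinearMap.ker f).liftQ f le_rfl)
    (LinearMap.ker_eq_bot.1 (Submodule.ker_liftQ_eq_bot' _ _ rfl)) χ'
  exact ⟨ψ, fun x => DFunLike.congr_fun hψ (Submodule.Quotient.mk x)⟩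

/-- Characters which vanish on the range of a linear map detect that range. -/
lemma mem_range_of_character {A B : Type u} [AddCommGroup A] [Module K A] [AddCommGroup B]
    [Module K B] (f : A →ₗ[K] B) (y : B)
    (hy : ∀ χ : CharacterModule B, (∀ x, χ (f x) = 0) → χ y = 0) : ∃ x, f x = y := by
  refine (Submodule.Quotient.mk_eq_zero (LinearMap.range f)).1
    (CharacterModule.eq_zero_of_character_apply fun χ => ?_)
  exact hy (CharacterModule.dual (LinearMap.range f).mkQ χ) fun x => by
    have e : (LinearMap.range f).mkQ (f x) = 0 := (Submodule.Quotient.mk_eq_zero _).2 ⟨x, rfl⟩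
    exact (congrArg χ e).trans (map_zero χ)

/-! ## Cofree modules -/

variable (R) in
/-- The differential of the cofree module. -/
def cofreeDiff (j i i' : ℤ) :
    CharacterModule (R.cx.X (j - i)) →ₗ[K] CharacterModule (R.cx.X (j - i')) :=
  CharacterModule.dual (-i.negOnePow • (R.cx.d (j - i') (j - i)).hom)

lemma cofreeDiff_apply (j i i' : ℤ) (f : CharacterModule (R.cx.X (j - i))) (x : R.cx.X (j - i')) :
    cofreeDiff R j i i' f x = -i.negOnePow • f (R.cx.d (j - i') (j - i) x) :=
  character_units_smul f _ _

variable (R) in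
/-- The action on the cofree module. -/
def cofreeSMul (j a i k : ℤ) (h : a + i = k) :
    R.cx.X a →ₗ[K] CharacterModule (R.cx.X (j - i)) →ₗ[K] CharacterModule (R.cx.X (j - k)) :=
  LinearMap.mk₂ K (fun r f => CharacterModule.dual
      ((a * (j - a)).negOnePow • (R.mul (j - k) a (j - i) (by omega)).flip r) f)
    (fun r s f => DFunLike.ext _ _ fun x => by
      refine (congrArg f ?_).trans (map_add f _ _)
      simp only [map_add, smul_add]
      rfl)
    (fun c r f => DFunLike.ext _ _ fun x => by
      refine congrArg f (?_ : (a * (j - a)).negOnePow • R.mul (j - k) a (j - i) _ x (c • r) =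
        (a * (j - a)).negOnePow • R.mul (j - k) a (j - i) _ (c • x) r)
      rw [map_smul, map_smul, LinearMap.smul_apply])
    (fun r f g => map_add _ _ _) (fun c r f => map_smul _ _ _)

lemma cofreeSMul_apply (j a i k : ℤ) (h : a + i = k) (r : R.cx.X a)
    (f : CharacterModule (R.cx.X (j - i))) (x : R.cx.X (j - k)) :
    cofreeSMul R j a i k h r f x =
      (a * (j - a)).negOnePow • f (R.mul (j - k) a (j - i) (by omega) x r) :=
  character_units_smul f _ _

variable (R) in
/-- The module of characters of `R`, shifted by `j`. -/
abbrev cofree (j : ℤ) : DGModule R :=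
  build (fun i => CharacterModule (R.cx.X (j - i))) (fun i i' h => cofreeDiff R j i i')
    (fun a i k h => cofreeSMul R j a i k h)
    (fun i i' i'' h h' f => DFunLike.ext _ _ fun x => by
      rw [cofreeDiff_apply, cofreeDiff_apply, d_d, map_zero, smul_zero, smul_zero]
      rfl)
    (fun i f => DFunLike.ext _ _ fun x => by
      rw [cofreeSMul_apply, R.mul_one]
      simp)
    (fun a b i ab bi k h₁ h₂ h₃ h₄ r s f => DFunLike.ext _ _ fun x => by
      rw [cofreeSMul_apply, cofreeSMul_apply, cofreeSMul_apply, smul_smul, ← Int.negOnePow_add,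
        R.mul_assoc (j - k) a b (j - bi) ab (j - i) (by omega) h₁ (by omega) (by omega)]
      congr 1
      rw [Int.negOnePow_eq_iff]
      subst h₁
      exact ⟨- a * b, by ring⟩)
    (fun a i k a' i' k' ha hi hk h r f => DFunLike.ext _ _ fun x => by
      rw [cofreeDiff_apply, cofreeSMul_apply]
      have e : (cofreeSMul R j a' i k' (by omega) (R.cx.d a a' r) f +
          a.negOnePow • cofreeSMul R j a i' k' (by omega) r (cofreeDiff R j i i' f)) x =
          cofreeSMul R j a' i k' (by omega) (R.cx.d a a' r) f x +
          a.negOnePow • cofreeSMul R j a i' k' (by omega) r (cofreeDiff R j i i' f) x := by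
        rcases Int.units_eq_one_or a.negOnePow with h | h <;> rw [h] <;>
        simp only [Units.neg_smul, _root_.one_smul] <;> rfl
      rw [e, cofreeSMul_apply, cofreeSMul_apply, cofreeDiff_apply,
        R.leibniz (j - k') a (j - i') (j - k) a' (j - i) (by omega) ha (by omega) (by omega),
        map_add, character_units_smul]
      have e₁ : (a' * (j - a')).negOnePow = (a * (j - a)).negOnePow * (j + 1).negOnePow := by
        rw [← Int.negOnePow_add, Int.negOnePow_eq_iff]
        obtain rfl := ha
        exact ⟨-j + a', by ring⟩
      have e₂ : (j - k').negOnePow = j.negOnePow * -(a.negOnePow * i.negOnePow) := by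
        rw [← Int.negOnePow_add, ← Int.negOnePow_succ, ← Int.negOnePow_add,
          Int.negOnePow_eq_iff]
        exact ⟨-k, by omega⟩
      have e₃ : k.negOnePow = a.negOnePow * i.negOnePow := by rw [← h, Int.negOnePow_add]
      rw [e₁, e₂, e₃, Int.negOnePow_succ]
      rcases Int.units_eq_one_or (a * (j - a)).negOnePow with h₁ | h₁ <;>
      rcases Int.units_eq_one_or a.negOnePow with h₂ | h₂ <;>
      rcases Int.units_eq_one_or i.negOnePow with h₃ | h₃ <;>
      rcases Int.units_eq_one_or j.negOnePow with h₄ | h₄ <;>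
      simp [h₁, h₂, h₃, h₄])

lemma cofree_d (j i i' : ℤ) (h : i' + 1 = i) (f : CharacterModule (R.cx.X (j - i))) :
    (cofree R j).cx.d i i' f = cofreeDiff R j i i' f := by
  have e : (cofree R j).cx.d i i' = ModuleCat.ofHom _ := dif_pos h
  rw [e]
  rfl

/-! ## Homogeneous maps into cofree modules -/

variable (R) in
/-- The unit in a degree which equals zero. -/
def oneAt (e : ℤ) (h : 0 = e) : R.cx.X e := castDeg R.cx h R.one

lemma d_oneAt (e : ℤ) (h : 0 = e) (k : ℤ) : R.cx.d e k (oneAt R e h) = 0 := by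
  subst h
  exact R.d_one k

lemma oneAt_mul (e : ℤ) (h : 0 = e) (i k : ℤ) (hk : e + i = k) (x : R.cx.X i) :
    R.mul e i k hk (oneAt R e h) x = castDeg R.cx (by omega) x := by
  subst h
  obtain rfl : i = k := by omega
  exact R.one_mul i x

lemma oneAt_smul (e : ℤ) (h : 0 = e) (i k : ℤ) (hk : e + i = k) (x : M.cx.X i) :
    M.smul e i k hk (oneAt R e h) x = castDeg M.cx (by omega) x := by
  subst h
  obtain rfl : i = k := by omega
  exact M.one_smul i x

/-- The character `m ↦ F(m)(1)` of a homogeneous map into a cofree module. -/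
def toCharacter {j n : ℤ} (F : HomDeg M (cofree R j) n) (p : ℤ) (hp : p + n = j) :
    CharacterModule (M.cx.X p) :=
  AddMonoidHom.mk' (fun m => (F.app p j hp m : CharacterModule (R.cx.X (j - j)))
    (oneAt R (j - j) (by omega))) (fun x y => by rw [map_add]; rfl)

lemma toCharacter_apply {j n : ℤ} (F : HomDeg M (cofree R j) n) (p : ℤ) (hp : p + n = j)
    (m : M.cx.X p) : toCharacter F p hp m =
      (F.app p j hp m : CharacterModule (R.cx.X (j - j))) (oneAt R (j - j) (by omega)) := rfl

/-- By graded linearity `F(m)(r) = ± (r F(m))(1) = ± F(r m)(1)`. Hence `F` is determined by one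
character, of the component which it maps to degree `j`. -/
lemma app_eq_toCharacter {j n : ℤ} (F : HomDeg M (cofree R j) n) (p : ℤ) (hp : p + n = j)
    (s q : ℤ) (hq : s + n = q) (m : M.cx.X s) (r : R.cx.X (j - q)) :
    (F.app s q hq m : CharacterModule (R.cx.X (j - q))) r =
      (((j - q) * q).negOnePow * (n * (j - q)).negOnePow) •
        toCharacter F p hp (M.smul (j - q) s p (by omega) r m) := by
  have e : F.app p j hp (M.smul (j - q) s p (by omega) r m) =
      (n * (j - q)).negOnePow • (cofreeSMul R j (j - q) q j (by omega) r (F.app s q hq m) :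
        CharacterModule (R.cx.X (j - j))) := F.app_smul (j - q) s p q j _ hq hp r m
  have e' : ∀ (c : ℤˣ) (f : CharacterModule (R.cx.X (j - j))) x, (c • f) x = c • f x :=
    fun c f x => by
      rcases Int.units_eq_one_or c with rfl | rfl
      · simp only [_root_.one_smul]
      · simp only [Units.neg_smul, _root_.one_smul]; rfl
  rw [toCharacter_apply, e]
  refine Eq.trans ?_ (congrArg (_ • ·) (e' _ _ _).symm)
  rw [cofreeSMul_apply, oneAt_mul, castDeg_self, smul_smul, smul_smul, sub_sub_cancel]
  rcases Int.units_eq_one_or (n * (j - q)).negOnePow with h₁ | h₁ <;>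
  rcases Int.units_eq_one_or ((j - q) * q).negOnePow with h₂ | h₂ <;>
  · simp [h₁, h₂]

lemma toCharacter_injective {j n : ℤ} (p : ℤ) (hp : p + n = j) {F F' : HomDeg M (cofree R j) n}
    (h : toCharacter F p hp = toCharacter F' p hp) : F = F' :=
  HomDeg.ext fun s q hq m => DFunLike.ext (F := CharacterModule (R.cx.X (j - q))) _ _ fun r => by
    rw [app_eq_toCharacter F p hp, app_eq_toCharacter F' p hp, h]

/-- Together with injectivity this identifies the homogeneous maps of degree `n` into `cofree R j`
with the characters of the component of degree `j - n`; the formula of `app_eq_toCharacter` serves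
as the definition. -/
lemma exists_toCharacter_eq {j n : ℤ} (p : ℤ) (hp : p + n = j) (χ : CharacterModule (M.cx.X p)) :
    ∃ F : HomDeg M (cofree R j) n, toCharacter F p hp = χ := by
  let f : ∀ s q : ℤ, s + n = q → (M.cx.X s →ₗ[K] CharacterModule (R.cx.X (j - q))) :=
    fun s q hq =>
      { toFun := fun m => CharacterModule.dual
          ((((j - q) * q).negOnePow * (n * (j - q)).negOnePow) •
            (M.smul (j - q) s p (by omega)).flip m) χ
        map_add' := fun m m' => DFunLike.ext _ _ fun r => by
          refine (congrArg χ ?_).trans (map_add χ _ _)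
          rw [map_add, smul_add]
          rfl
        map_smul' := fun c m => DFunLike.ext _ _ fun r => by
          refine congrArg χ (?_ : (((j - q) * q).negOnePow * (n * (j - q)).negOnePow) •
              M.smul (j - q) s p _ r (c • m) =
            (((j - q) * q).negOnePow * (n * (j - q)).negOnePow) • M.smul (j - q) s p _ (c • r) m)
          rw [map_smul, map_smul, LinearMap.smul_apply] }
  have hf : ∀ (s q : ℤ) (hq : s + n = q) (m : M.cx.X s) (r : R.cx.X (j - q)),
      f s q hq m r = (((j - q) * q).negOnePow * (n * (j - q)).negOnePow) •
        χ (M.smul (j - q) s p (by omega) r m) := fun s q hq m r => character_units_smul χ _ _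
  refine ⟨HomDeg.mk f (fun a s s' q q' hs hq hq' r m => ?_), DFunLike.ext _ _ fun m => ?_⟩
  · refine DFunLike.ext (F := CharacterModule (R.cx.X (j - q'))) _ _ fun x => ?_
    have e' : ∀ (c : ℤˣ) (f : CharacterModule (R.cx.X (j - q'))) x, (c • f) x = c • f x :=
      fun c f x => by
        rcases Int.units_eq_one_or c with rfl | rfl
        · simp only [_root_.one_smul]
        · simp only [Units.neg_smul, _root_.one_smul]; rfl
    refine Eq.trans ?_ (e' _ (cofreeSMul R j a q q' (by omega) r (f s q hq m)) x).symm
    rw [hf s' q' hq', cofreeSMul_apply, hf s q hq,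
      M.mul_smul (j - q') a s (j - q) s' p (by omega) hs (by omega)
      (by omega), smul_smul, smul_smul]
    congr 1
    simp only [← Int.negOnePow_add]
    rw [Int.negOnePow_eq_iff]
    obtain rfl : q' = q + a := by omega
    exact ⟨-a * (q + n), by ring⟩
  · rw [toCharacter_apply]
    refine (hf p j hp m _).trans ?_
    rw [oneAt_smul, castDeg_self]
    simp

/-- The complex `Hom_R(M, cofree R j)` is, up to signs, the dual of `M`: the term with the
differential of the cofree module drops out because `∂1 = 0`. -/
lemma toCharacter_homDiff {j n n' : ℤ} (hn : n' + 1 = n) (F : HomDeg M (cofree R j) n)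
    (p p' : ℤ) (hp : p + n' = j) (hp' : p' + n = j) (m : M.cx.X p) :
    toCharacter (homDiff _ _ n n' hn F) p hp m =
      -n.negOnePow • toCharacter F p' hp' (M.cx.d p p' m) := by
  have e : (homDiff _ _ n n' hn F).app p j hp m =
      cofreeDiff R j (j + 1) j (F.app p (j + 1) (by omega) m) -
        n.negOnePow • (F.app p' j hp' (M.cx.d p p' m) : CharacterModule (R.cx.X (j - j))) := by
    rw [homDiff_app _ _ n n' hn F p p' (j + 1) j (by omega) (by omega), cofree_d j (j + 1) j rfl]
  have e' : ∀ (c : ℤˣ) (f g : CharacterModule (R.cx.X (j - j))) x,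
      (f - c • g) x = f x - c • g x :=
    fun c f g x => by
      rcases Int.units_eq_one_or c with rfl | rfl
      all_goals simp only [Units.neg_smul, _root_.one_smul]; rfl
  rw [toCharacter_apply, e]
  refine (e' _ _ _ _).trans ?_
  rw [cofreeDiff_apply, d_oneAt, map_zero, smul_zero, zero_sub, Units.neg_smul]
  rfl

end DGModule

/-! ### K-injectivity of cofree modules -/

namespace DGModule

open ElementwiseHomology HomDeg

variable {R : DGAlgebra K} {M N P : DGModule R}

lemma toCharacter_comp {j n : ℤ} (F : HomDeg N (cofree R j) n) (g : M ⟶ N) (p : ℤ)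
    (hp : p + n = j) (m : M.cx.X p) :
    toCharacter (F.comp (ofHom g) (zero_add n)) p hp m = toCharacter F p hp (g.hom.f p m) := by
  rw [toCharacter_apply, comp_app _ _ _ p p _ _ (add_zero p)]
  rfl

lemma toCharacter_add {j n : ℤ} (F F' : HomDeg M (cofree R j) n) (p : ℤ) (hp : p + n = j)
    (m : M.cx.X p) : toCharacter (F + F') p hp m = toCharacter F p hp m + toCharacter F' p hp m :=
  rfl

/-- Maps into a cofree module form the dual complex with values in `ℚ/ℤ`, and this group is
injective, so duality is exact. Concretely, the characters of `α` and `β` combine to a character on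
the cone of `g`, which is extended along the cone differential; the two components of the extension
are the solution. -/
lemma isKInjective_cofree (j : ℤ) : IsKInjective (cofree R j) := by
  intro X Y g hg
  have hc := (coneAcyclic_iff_quasiIso g.hom).2 hg
  rw [quasiIso_homPre_iff]
  intro k i i' l hk hi' hl α β hα hβ
  have hsi : i'.negOnePow = -i.negOnePow := by rw [← hi', Int.negOnePow_succ]
  have hsl : l.negOnePow = i.negOnePow := by rw [← hl, Int.negOnePow_succ, hsi, neg_neg]
  have units_mul : ∀ (c : ℤˣ) (t : AddCircle (1 : ℚ)), c • c • t = t := fun c t => by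
    rw [smul_smul, Int.units_mul_self, _root_.one_smul]
  let a := toCharacter α (j - i) (by omega)
  let b := toCharacter β (j - i') (by omega)
  have ha : ∀ y, a (Y.cx.d (j - k) (j - i) y) = 0 := fun y => by
    have e := toCharacter_homDiff hk α (j - k) (j - i) (by omega) (by omega) y
    rw [hα] at e
    have e' := congrArg (i.negOnePow • ·) e
    dsimp only at e'
    rw [Units.neg_smul, smul_neg, units_mul] at e'
    rw [← neg_eq_zero]
    refine e'.symm.trans ?_
    exact smul_zero _
  have hb : ∀ x, b (X.cx.d (j - i) (j - i') x) = i.negOnePow • a (g.hom.f (j - i) x) := fun x => by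
    have e := toCharacter_homDiff hi' β (j - i) (j - i') (by omega) (by omega) x
    rw [hβ, toCharacter_comp, hsi, neg_neg] at e
    refine (units_mul i.negOnePow _).symm.trans ?_
    rw [← e]
  -- The differential of the cone of `g`, in the form `(x, y) ↦ (∂x, g x + ∂y)`.
  let Φ : X.cx.X (j - i') × Y.cx.X (j - i) →ₗ[K] X.cx.X (j - l) × Y.cx.X (j - i') :=
    ((X.cx.d (j - i') (j - l)).hom ∘ₗ LinearMap.fst K _ _).prod
      ((g.hom.f (j - i')).hom ∘ₗ LinearMap.fst K _ _ +
        (Y.cx.d (j - i) (j - i')).hom ∘ₗ LinearMap.snd K _ _)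
  let χ : CharacterModule (X.cx.X (j - i') × Y.cx.X (j - i)) :=
    AddMonoidHom.mk' (fun x => b x.1 + i.negOnePow • a x.2) (fun x y => by
      change b (x.1 + y.1) + i.negOnePow • a (x.2 + y.2) = _
      rw [map_add, map_add, smul_add]
      abel)
  -- Since the cone is acyclic, the kernel of `Φ` consists of boundaries of the cone, and there `χ`
  -- vanishes by `ha` and `hb`.
  obtain ⟨ψ, hψ⟩ := exists_character_extension Φ χ (by
    rintro ⟨x, y⟩ h
    have h₁ : X.cx.d (j - i') (j - l) x = 0 := congrArg Prod.fst h
    have h₂ : g.hom.f (j - i') x + Y.cx.d (j - i) (j - i') y = 0 := congrArg Prod.snd h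
    obtain ⟨x', y', rfl, hy⟩ := hc (j - l) (j - i') (j - i) (j - k) (by omega) (by omega) (by omega)
      x (-y) h₁ (by rw [map_neg]; exact (eq_neg_of_add_eq_zero_left h₂).symm)
    change b (X.cx.d (j - i) (j - i') x') + i.negOnePow • a y = 0
    have hy' : g.hom.f (j - i) x' + y = -Y.cx.d (j - k) (j - i) y' := by
      rw [eq_neg_iff_add_eq_zero, add_right_comm, hy, neg_add_cancel]
    rw [hb, ← smul_add, ← map_add, hy', map_neg, ha, neg_zero, smul_zero])
  obtain ⟨α', hα'⟩ := exists_toCharacter_eq (M := Y) (R := R) (j := j) (n := i') (j - i') (by omega)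
    (CharacterModule.dual (LinearMap.inr K (X.cx.X (j - l)) (Y.cx.X (j - i'))) ψ)
  obtain ⟨β', hβ'⟩ := exists_toCharacter_eq (M := X) (R := R) (j := j) (n := l) (j - l) (by omega)
    (-i.negOnePow • CharacterModule.dual (LinearMap.inl K (X.cx.X (j - l)) (Y.cx.X (j - i'))) ψ)
  have hα₁ : ∀ y, toCharacter α' (j - i') (by omega) y = ψ (0, y) := fun y => by
    rw [hα']
    rfl
  have hβ₁ : ∀ x, toCharacter β' (j - l) (by omega) x = -i.negOnePow • ψ (x, 0) := fun x => by
    rw [hβ']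
    rcases Int.units_eq_one_or i.negOnePow with h | h <;> rw [h] <;>
    simp only [Units.neg_smul, _root_.one_smul, neg_neg] <;> rfl
  refine ⟨α', β', toCharacter_injective (j - i) (by omega) (DFunLike.ext _ _ fun y => ?_),
    toCharacter_injective (j - i') (by omega) (DFunLike.ext _ _ fun x => ?_)⟩
  · rw [toCharacter_homDiff hi' α' (j - i) (j - i') (by omega) (by omega), hα₁, hsi, neg_neg]
    have e : ψ (X.cx.d (j - i') (j - l) 0, g.hom.f (j - i') 0 + Y.cx.d (j - i) (j - i') y) =
        b 0 + i.negOnePow • a y := hψ (0, y)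
    rw [map_zero, map_zero, zero_add, map_zero, zero_add] at e
    rw [e, units_mul]
  · rw [toCharacter_add, toCharacter_comp, hα₁,
      toCharacter_homDiff hl β' (j - i') (j - l) (by omega) (by omega), hβ₁, hsl]
    have e : ψ (X.cx.d (j - i') (j - l) x, g.hom.f (j - i') x + Y.cx.d (j - i) (j - i') 0) =
        b x + i.negOnePow • a 0 := hψ (x, 0)
    rw [map_zero, map_zero, smul_zero, add_zero, add_zero] at e
    rw [Units.neg_smul, Units.neg_smul, smul_neg, neg_neg, units_mul, ← map_add, Prod.mk_add_mk,
      zero_add, add_zero, e]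

/-! ## K-injective hulls -/

/-- The morphism into a product with given components. -/
def prodLiftHom {A : Type u} {G : A → DGModule R} (f : ∀ a, M ⟶ G a) : M ⟶ dprod G :=
  toHom (prodLift fun a => ofHom (f a)) ((isProduct_dprod M (-1)).1 (funext fun a => by
    have e := homDiff_comp (m' := -1) (n' := -1) (ofHom (proj G a))
      (prodLift fun a => ofHom (f a)) (add_zero 0) (by omega : (-1 : ℤ) + 1 = 0) (by omega)
      (by omega)
    rw [prodLift_proj, homDiff_ofHom, homDiff_ofHom, zero_comp, zero_add, Int.negOnePow_zero,
      _root_.one_smul] at e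
    dsimp only
    rw [← e, comp_zero]))

/-- A morphism into a cofree module with a given character that vanishes on boundaries. -/
lemma exists_cofreeHom (j : ℤ) (χ : CharacterModule (M.cx.X j))
    (hχ : ∀ x, χ (M.cx.d (j + 1) j x) = 0) :
    ∃ F : M ⟶ cofree R j, ∀ (m : M.cx.X j) (y : (cofree R j).cx.X (j + 1)),
      (cofree R j).cx.d (j + 1) j y = F.hom.f j m → χ m = 0 := by
  obtain ⟨F, hF⟩ := exists_toCharacter_eq (R := R) j (add_zero j) χ
  have hd : homDiff _ _ 0 (-1) (by omega) F = 0 := by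
    refine toCharacter_injective (j + 1) (by omega) (DFunLike.ext _ _ fun x => ?_)
    rw [toCharacter_homDiff (by omega) F (j + 1) j (by omega) (by omega), hF, hχ, smul_zero]
    rfl
  refine ⟨toHom F hd, fun m y hy => ?_⟩
  rw [← hF, toCharacter_apply]
  have e : (F.app j j (add_zero j) m : CharacterModule (R.cx.X (j - j))) =
      cofreeDiff R j (j + 1) j y := (hy.symm.trans (cofree_d j (j + 1) j rfl y))
  rw [e, cofreeDiff_apply, d_oneAt, map_zero, smul_zero]

/-- Every DG module embeds into a contractible one. -/
lemma exists_contractible_hull (N : DGModule R) : ∃ (C : DGModule R) (f : N ⟶ C),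
    IsKInjective C ∧ ∀ i, Function.Injective (f.hom.f i) := by
  obtain ⟨s, hs⟩ := exists_cyl_contraction (A := shift N (-1)) (B := N)
    (hσ := homDiff_fromShift N (-1) (-2) (by omega))
    (toShift N (-1) 1 (by omega)) (homDiff_toShift N (-1) 1 (by omega) 0 (by omega))
    (toShift_comp_fromShift N (-1) 1 (by omega)) (fromShift_comp_toShift N (-1) 1 (by omega))
  exact ⟨_, cylInr, isKInjective_of_contractible s hs, fun i x y h => congrArg Prod.snd h⟩

/-- The contractible factor provides injectivity. The cofree factors, one for each character that
vanishes on boundaries, provide injectivity on homology: if the image of `x` bounds, all these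
characters vanish at `x`, so `x` is a boundary. -/
lemma exists_hull (N : DGModule R) : ∃ (C : DGModule R) (f : N ⟶ C), IsKInjective C ∧
    (∀ i, Function.Injective (f.hom.f i)) ∧
    ∀ (i j : ℤ), i + 1 = j → ∀ (x : N.cx.X i) (y : C.cx.X j), C.cx.d j i y = f.hom.f i x →
      ∃ x' : N.cx.X j, N.cx.d j i x' = x := by
  obtain ⟨C₀, f₀, hC₀, hf₀⟩ := exists_contractible_hull N
  choose F hF using fun (j : ℤ) (χ : CharacterModule (N.cx.X j)) hχ =>
    exists_cofreeHom (R := R) j χ hχ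
  let A := Option (Σ j : ℤ, {χ : CharacterModule (N.cx.X j) // ∀ x, χ (N.cx.d (j + 1) j x) = 0})
  let G : A → DGModule R := fun a => a.elim C₀ fun z => cofree R z.1
  let f : ∀ a, N ⟶ G a := fun a => match a with
    | none => f₀
    | some z => F z.1 z.2.1 z.2.2
  refine ⟨dprod G, prodLiftHom f, isKInjective_dprod fun a => ?_, fun i x y h => hf₀ i ?_, ?_⟩
  · rcases a with _ | z
    · exact hC₀
    · exact isKInjective_cofree _
  · exact congrArg ((proj G none).hom.f i) h
  · rintro i _ rfl x y hy
    refine mem_range_of_character (N.cx.d (i + 1) i).hom x fun χ hχ => ?_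
    refine hF i χ hχ x ((proj G (some ⟨i, χ, hχ⟩)).hom.f (i + 1) y) ?_
    refine (hom_comm (proj G (some ⟨i, χ, hχ⟩)).hom (i + 1) i y).symm.trans ?_
    rw [hy]
    rfl

/-- A hull together with its shifted cokernel. -/
lemma exists_copresentation (N : DGModule R) : ∃ (C : DGModule R) (η : N ⟶ C) (N' : DGModule R)
    (ϖ : HomDeg C N' (-1)), IsKInjective C ∧
    (∀ i, Function.Injective (η.hom.f i)) ∧
    (∀ (i j : ℤ), i + 1 = j → ∀ (x : N.cx.X i) (y : C.cx.X j), C.cx.d j i y = η.hom.f i x →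
      ∃ x' : N.cx.X j, N.cx.d j i x' = x) ∧
    homDiff _ _ (-1) (-2) (by omega) ϖ = 0 ∧ ϖ.comp (ofHom η) (zero_add (-1)) = 0 ∧
    (∀ (i j : ℤ) (h : j + -1 = i), Function.Surjective (ϖ.app j i h)) ∧
    ∀ (i j : ℤ) (h : j + -1 = i) (x : C.cx.X j), ϖ.app j i h x = 0 → ∃ y, η.hom.f j y = x := by
  obtain ⟨C, η, hC, h₁, h₂⟩ := exists_hull N
  have ha : ∀ (i j : ℤ) (h : j + -1 = i) (x : C.cx.X j),
      ((toShift (coker η) 1 (-1) (by omega)).comp (ofHom (cokerProj η)) (zero_add (-1))).app j i h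
        x = castDeg (coker η).cx (by omega : j = i + 1) ((cokerProj η).hom.f j x) :=
    fun i j h x => by
      rw [comp_app _ _ _ j j _ _ (add_zero j)]
      rfl
  -- The shift gives the projection onto the cokernel the degree `-1` of a differential.
  refine ⟨C, η, shift (coker η) 1, (toShift (coker η) 1 (-1) (by omega)).comp
    (ofHom (cokerProj η)) (zero_add (-1)), hC, h₁, h₂, ?_, ?_, fun i j h y => ?_,
    fun i j h x hx => ?_⟩
  · rw [homDiff_comp (n' := -1) _ _ _ _ (by omega : (-2 : ℤ) + 1 = -1) (by omega), homDiff_ofHom,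
      homDiff_toShift]
    simp
  · refine HomDeg.ext fun p q hq x => ?_
    rw [comp_app _ _ _ p p _ _ (add_zero p), ha, ofHom_app, cokerProj_comp]
    exact map_zero _
  · obtain rfl : j = i + 1 := by omega
    obtain ⟨x, rfl⟩ := cokerProj_surjective η _ y
    exact ⟨x, ha _ _ _ _⟩
  · obtain rfl : j = i + 1 := by omega
    exact cokerProj_eq_zero η _ x ((ha _ _ _ _).symm.trans hx)

/-- Dual to `exists_kProjective_quasiIso`: hulls of `M` and of the successive cokernels are spliced,
and the product total module is taken. -/
theorem exists_kInjective_quasiIso (M : DGModule R) :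
    ∃ (I : DGModule R) (f : M ⟶ I), IsKInjective I ∧ IsQuasiIso f := by
  choose C η N' ϖ hC hη hc hϖ hϖη hsurj hinj using fun N : DGModule R => exists_copresentation N
  let L : ℕ → DGModule R := fun n => Nat.rec M (fun _ N => N' N) n
  let G : ℕ → DGModule R := fun n => C (L n)
  let δ : ∀ n, HomDeg (G n) (G (n + 1)) (-1) := fun n =>
    (ofHom (η (L (n + 1)))).comp (ϖ (L n)) (add_zero (-1))
  have hδa : ∀ n (p q : ℤ) (hq : p + -1 = q) (x : (G n).cx.X p),
      (δ n).app p q hq x = (η (L (n + 1))).hom.f q ((ϖ (L n)).app p q hq x) := fun n p q hq x => by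
    refine (comp_app _ _ _ p q _ _ hq x).trans ?_
    rfl
  have hϖd : ∀ n (p q s : ℤ) (hq : p + -1 = q) (hs : q + -1 = s) (x : (G n).cx.X p),
      (L (n + 1)).cx.d q s ((ϖ (L n)).app p q hq x) =
        -(ϖ (L n)).app q s hs ((G n).cx.d p q x) := fun n p q s hq hs x =>
    homDeg_d_app_neg_one (hϖ (L n)) p q q s (by omega) hq hs x
  have hϖηa : ∀ n (p q : ℤ) (hq : p + -1 = q) (x : (L n).cx.X p),
      (ϖ (L n)).app p q hq ((η (L n)).hom.f p x) = 0 := fun n p q hq x => by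
    have e := congrArg (fun t => t.app p q hq x) (hϖη (L n))
    rwa [comp_app _ _ _ p p _ _ (add_zero p)] at e
  have hδ : ∀ n, homDiff _ _ (-1) (-2) (by omega) (δ n) = 0 := fun n => by
    refine (homDiff_comp (m' := -1) (n' := -2) _ _ _ _ (by omega) (by omega)).trans ?_
    rw [homDiff_ofHom, hϖ]
    simp
  have hδδ : ∀ n, (δ (n + 1)).comp (δ n) (by omega : -1 + -1 = -2) = 0 := fun n => by
    refine HomDeg.ext fun p q hq x => ?_
    rw [comp_app _ _ _ p (p - 1) _ _ rfl]
    refine (hδa (n + 1) (p - 1) q (by omega) _).trans ?_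
    refine (congrArg _ ((congrArg _ (hδa n p (p - 1) rfl x)).trans
      (hϖηa (n + 1) (p - 1) q (by omega) _))).trans (map_zero _)
  have hηδ : (δ 0).comp (ofHom (η M)) (by omega : 0 + -1 = -1) = 0 := by
    refine HomDeg.ext fun p q hq x => ?_
    rw [comp_app _ _ _ p p _ _ (add_zero p), hδa]
    exact (congrArg _ (hϖηa 0 p q hq x)).trans (map_zero _)
  -- If the image of the cycle `z` bounds in the next hull, it bounds already in the cokernel, since
  -- hulls are injective on homology. Lifting the bounding element to `v` makes `z + ∂v` the image
  -- of some `m`.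
  have key : ∀ (n : ℕ) (k i j : ℤ), ∀ hk : k + 1 = i, i + 1 = j → ∀ (z : (G n).cx.X i)
      (y : (G (n + 1)).cx.X i), (G n).cx.d i k z = 0 →
      (G (n + 1)).cx.d i k y = (δ n).app i k (by omega) z →
      ∃ (m : (L n).cx.X i) (y' : (G n).cx.X j), (L n).cx.d i k m = 0 ∧
        z = (η (L n)).hom.f i m + (G n).cx.d j i y' := by
    intro n k i j hk hj z y hz hy
    rw [hδa] at hy
    obtain ⟨x, hx⟩ := hc (L (n + 1)) k i hk _ y hy
    obtain ⟨v, rfl⟩ := hsurj (L n) i j (by omega) x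
    rw [hϖd n j i k (by omega) (by omega)] at hx
    obtain ⟨m, hm⟩ := hinj (L n) k i (by omega) (z + (G n).cx.d j i v) (by
      rw [map_add, ← hx, neg_add_cancel])
    refine ⟨m, -v, hη (L n) k ?_, by rw [hm, map_neg, add_neg_cancel_right]⟩
    rw [hom_comm, hm, map_add, hz, d_d, add_zero, map_zero]
  refine ⟨totProd δ hδ hδδ, totCoaug (η M) hηδ, isKInjective_totProd hδ hδδ fun n => hC _,
    isQuasiIso_totCoaug _ _ (fun k i j hk hj m y hm hy => hc M i j hj m y hy) (key 0) ?_⟩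
  intro n k i j hk hj z y hz hy
  -- The cycle `m` has a lift `w` to `G n` which need not be a cycle; but `∂w` comes from `L n`,
  -- where it bounds some `x'`, and `w - η x'` is a cycle with the same image.
  obtain ⟨m, y', hm, rfl⟩ := key (n + 1) k i j hk hj z y hz hy
  obtain ⟨w, rfl⟩ := hsurj (L n) i j (by omega) m
  rw [hϖd n j i k (by omega) (by omega), neg_eq_zero] at hm
  obtain ⟨x, hx⟩ := hinj (L n) k i (by omega) ((G n).cx.d j i w) hm
  obtain ⟨x', rfl⟩ := hc (L n) i j hj x w hx.symm
  refine ⟨w - (η (L n)).hom.f j x', y', ?_, ?_⟩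
  · rw [map_sub, ← hom_comm, hx, sub_self]
  · rw [map_sub, hδa, hδa, hϖηa, map_zero, sub_zero]

end DGModule

/-! ### Comparison of resolutions, and the proof of the equivalences -/

namespace DGModule

variable {R S : DGAlgebra K}

lemma nonempty_kProjectiveResolution (M : DGModule R) : Nonempty (KProjectiveResolution M) :=
  let ⟨P, f, hP, hf⟩ := exists_kProjective_quasiIso M
  ⟨⟨P, f, hP, hf⟩⟩

lemma nonempty_kInjectiveResolution (M : DGModule R) : Nonempty (KInjectiveResolution M) :=
  let ⟨I, f, hI, hf⟩ := exists_kInjective_quasiIso M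
  ⟨⟨I, f, hI, hf⟩⟩

lemma IsQuasiIso.restrict (φ : R.Hom S) {M N : DGModule S} {f : M ⟶ N} (hf : IsQuasiIso f) :
    IsQuasiIso ((restrictFunctor φ).map f) := hf

lemma IsQuasiIso.of_comp_right {L M N : DGModule R} {f : L ⟶ M} {g : M ⟶ N} (hg : IsQuasiIso g)
    (h : IsQuasiIso (f ≫ g)) : IsQuasiIso f := by
  have : QuasiIso g.hom := hg
  have : QuasiIso (f.hom ≫ g.hom) := h
  exact quasiIso_of_comp_right f.hom g.hom

lemma IsQuasiIso.comp {L M N : DGModule R} {f : L ⟶ M} {g : M ⟶ N} (hf : IsQuasiIso f)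
    (hg : IsQuasiIso g) : IsQuasiIso (f ≫ g) := by
  have : QuasiIso f.hom := hf
  have : QuasiIso g.hom := hg
  exact (inferInstance : QuasiIso (f.hom ≫ g.hom))

lemma isQuasiIso_id (M : DGModule R) : IsQuasiIso (𝟙 M) :=
  (inferInstance : QuasiIso (𝟙 M.cx))

/-- Any resolution over `R` is part of a compared pair, by lifting it along a resolution over `S`.
This mediates between conditions that quantify over single resolutions and those that quantify over
pairs. -/
lemma exists_comparedResolutions (φ : R.Hom S) (M : DGModule S)
    (P : KProjectiveResolution (restrict φ M)) : ∃ Q : ComparedResolutions φ M, Q.resR = P := by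
  obtain ⟨Q⟩ := nonempty_kProjectiveResolution M
  obtain ⟨c, hc⟩ := P.isKProjective.exists_lift (Q.isQuasiIso.restrict φ) P.map
  exact ⟨⟨Q, P, c, hc⟩, rfl⟩

lemma nonempty_comparedResolutions (φ : R.Hom S) (M : DGModule S) :
    Nonempty (ComparedResolutions φ M) :=
  let ⟨P⟩ := nonempty_kProjectiveResolution (restrict φ M)
  let ⟨Q, _⟩ := exists_comparedResolutions φ M P
  ⟨Q⟩

namespace ComparedResolutions

variable {φ : R.Hom S} {M : DGModule S} (P : ComparedResolutions φ M)

lemma isQuasiIso_comparison : IsQuasiIso P.comparison :=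
  (P.resS.isQuasiIso.restrict φ).of_comp_right
    (P.homotopic.symm.isQuasiIso P.resR.isQuasiIso)

/-- By the adjunction it suffices to compare the restrictions to `P.resR.obj`, and those are
homotopic by the definition of a compared pair. -/
lemma homotopic_fromExtend :
    Homotopic (fromExtend φ P.resS.obj P.comparison ≫ P.resS.map)
      (fromExtend φ M P.resR.map) := by
  refine homotopic_of_unitExtend φ ?_
  rw [Functor.map_comp, ← Category.assoc, unitExtend_fromExtend, unitExtend_fromExtend]
  exact P.homotopic

/-- Replacing `M` by its resolution over `S` does not affect `S ⊗ᴸ_R M → M`. -/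
lemma isQuasiIso_fromExtend_comparison_iff :
    IsQuasiIso (fromExtend φ P.resS.obj P.comparison) ↔ IsQuasiIso (fromExtend φ M P.resR.map) :=
  ⟨fun h => P.homotopic_fromExtend.isQuasiIso (h.comp P.resS.isQuasiIso),
    fun h => P.resS.isQuasiIso.of_comp_right (P.homotopic_fromExtend.symm.isQuasiIso h)⟩

/-- A quasi-isomorphism between K-projective modules. The homotopy equivalence is what survives
tensoring with an arbitrary right module. -/
lemma isHomotopyEquiv_fromExtend_comparison (h : IsQuasiIso (fromExtend φ M P.resR.map)) :
    IsHomotopyEquiv (fromExtend φ P.resS.obj P.comparison) :=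
  isHomotopyEquiv_of_isQuasiIso (isKProjective_extend φ P.resR.isKProjective)
    P.resS.isKProjective (P.isQuasiIso_fromExtend_comparison_iff.2 h)

end ComparedResolutions

/-- The DG module `S` is a K-projective resolution of itself. -/
def comparedResolutionsLeftSelf (φ : R.Hom S)
    (P : KProjectiveResolution (restrict φ S.leftSelf)) : ComparedResolutions φ S.leftSelf where
  resS := ⟨S.leftSelf, 𝟙 _, isKProjective_leftSelf S, isQuasiIso_id _⟩
  resR := P
  comparison := P.map
  homotopic := (toHo_map_eq_iff _ _).1
    (congrArg (toHo R).map ((congrArg (P.map ≫ ·) ((restrictFunctor φ).map_id _)).trans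
      (Category.comp_id _)))

variable (φ : R.Hom S)

/-- The implication from condition 1 to condition 4: `S ⊗_R P → S` is a homotopy equivalence, so
precomposition with it is a quasi-isomorphism for every target `M`. -/
lemma isQuasiIso_toCoextend_of_leftSelf {P : KProjectiveResolution (restrict φ S.leftSelf)}
    (h : IsQuasiIso (fromExtend φ S.leftSelf P.map)) (M : DGModule S)
    (I : KInjectiveResolution (restrict φ M)) : IsQuasiIso (toCoextend φ M I.map) :=
  isQuasiIso_toCoextend φ P.isKProjective P.isQuasiIso
    ((quasiIso_homRestrict_homPre_iff φ P.map M).2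
      ((isHomotopyEquiv_of_isQuasiIso (isKProjective_extend φ P.isKProjective)
        (isKProjective_leftSelf S) h).quasiIso_homPre M)) I

/-- The implication from condition 5 to condition 2: by adjunction, precomposition with `S ⊗_R
P.resR.obj → P.resS.obj` is a quasi-isomorphism for all targets, which forces a homotopy
equivalence. -/
lemma isQuasiIso_fromExtend_of_homRestrict {M : DGModule S} (P : ComparedResolutions φ M)
    (h : ∀ M', QuasiIso (homRestrict φ P.resS.obj M' ≫ homPre P.comparison (restrict φ M'))) :
    IsQuasiIso (fromExtend φ M P.resR.map) :=
  P.isQuasiIso_fromExtend_comparison_iff.1 (isHomotopyEquiv_of_quasiIso_homPre fun M' =>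
    (quasiIso_homRestrict_homPre_iff φ P.comparison M').1 (h M')).isQuasiIso

end DGModule

end

/-- For a morphism of DGAs `φ : R → S` the following are equivalent:
(1) `S ⊗ᴸ_R S → S` is an isomorphism;
(2) `S ⊗ᴸ_R M → M` is an isomorphism for all DG `S`-modules `M`;
(3) `M ⊗ᴸ_R N → M ⊗ᴸ_S N` is an isomorphism for all DG right `S`-modules `M` and all DG left
`S`-modules `N`;
(4) `M → RHom_R(S, M)` is an isomorphism for all DG `S`-modules `M`;
(5) `RHom_S(M, M') → RHom_R(M, M')` is an isomorphism for all DG `S`-modules `M` and `M'`;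
(6) the functor `𝒟(φ) : 𝒟(S) → 𝒟(R)` is fully faithful. -/
theorem theorem3p9 {K : Type u} [CommRing K] {R S : DGAlgebra K} (φ : R.Hom S) :
    List.TFAE [
      ForResolutions fun P : DGModule.KProjectiveResolution (DGModule.restrict φ S.leftSelf) =>
        IsIso (DGModule.tensorCanonical φ S.leftSelf P),
      ∀ M : DGModule S,
        ForResolutions fun P : DGModule.KProjectiveResolution (DGModule.restrict φ M) =>
          IsIso (DGModule.tensorCanonical φ M P),
      ∀ (M : DGRightModule S) (N : DGModule S),
        ForResolutions fun P : DGModule.ComparedResolutions φ N =>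
          IsIso (DGModule.tensorChangeCanonical φ M N P),
      ∀ M : DGModule S,
        ForResolutions fun I : DGModule.KInjectiveResolution (DGModule.restrict φ M) =>
          IsIso (DGModule.homCanonical φ M I),
      ∀ M M' : DGModule S,
        ForResolutions fun P : DGModule.ComparedResolutions φ M =>
          IsIso (DGModule.homChangeCanonical φ M M' P),
      (DGModule.restrictDer φ).Full ∧ (DGModule.restrictDer φ).Faithful] := by
  open DGModule in
  -- All canonical maps are images of actual morphisms, so the conditions 1 to 5 become statements
  -- about quasi-isomorphisms.
  simp only [tensorCanonical, tensorChangeCanonical, homCanonical, homChangeCanonical,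
    isIso_toDer_map_iff, isIso_toDerBase_map_iff]
  tfae_have 1 → 4 := fun ⟨⟨P⟩, h⟩ M =>
    ⟨nonempty_kInjectiveResolution _, fun I => isQuasiIso_toCoextend_of_leftSelf φ (h P) M I⟩
  tfae_have 4 → 5 := fun h M M' =>
    ⟨nonempty_comparedResolutions φ M, fun P =>
      let ⟨⟨I⟩, hI⟩ := h M'
      quasiIso_homRestrict_of_toCoextend φ P.resS.isKProjective P.resR.isKProjective
        P.isQuasiIso_comparison I (hI I)⟩
  tfae_have 5 → 2 := fun h M =>
    ⟨nonempty_kProjectiveResolution _, fun P => by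
      obtain ⟨Q, rfl⟩ := exists_comparedResolutions φ M P
      exact isQuasiIso_fromExtend_of_homRestrict φ Q fun M' => (h M M').2 Q⟩
  tfae_have 2 → 3 := fun h M N =>
    ⟨nonempty_comparedResolutions φ N, fun P =>
      DGTensor.quasiIso_changeRings φ M _
        (P.isHomotopyEquiv_fromExtend_comparison ((h N).2 P.resR))⟩
  tfae_have 3 → 1 := fun h =>
    ⟨nonempty_kProjectiveResolution _, fun P =>
      (DGTensor.isQuasiIso_fromExtend_iff φ S.leftSelf P.map).2
        ((h S.rightSelf S.leftSelf).2 (comparedResolutionsLeftSelf φ P))⟩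
  tfae_have 2 → 6 := fun h => by
    refine (full_faithful_restrictDer_iff φ fun M => (h M).1.some).2 fun M => ?_
    exact (isIso_toDer_map_iff _).2 ((h M).2 _)
  tfae_have 6 → 2 := fun h M =>
    ⟨nonempty_kProjectiveResolution _, fun P => by
      classical
      -- The criterion refers to a chosen resolution of each module; the choice is altered at `M` so
      -- that it is the given `P`.
      have := (full_faithful_restrictDer_iff φ (Function.update
        (fun N => (nonempty_kProjectiveResolution (restrict φ N)).some) M P)).1 h M
      rwa [Function.update_self, isIso_toDer_map_iff] at this⟩
  tfae_finish
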